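/- **Setting.** Let $\mathcal N\subset B(\mathcal H)$ be a von Neumann algebra with a faithful semi-finite normal trace $\tau$ (extended linearly to operators $T\in\mathcal N$ with $\tau(|T|)<\infty$), put $\|T\|_p:=\tau(|T|^p)^{1/p}$, and call $T\in\mathcal N$ $p$-summable if $\|T\|_p<\infty$ and $\tau$-compact if $\lim_{x\to\infty}\inf\{\|TE\| : E\in\mathcal N \text{ a projection},\ \tau(1-E)\le x\}=0$. Let $A$ be a unital Banach $*$-algebra and $\rho:A\to\mathcal N$ a continuous unital $*$-representation; write $a$ for $\rho(a)$. An *odd Breuer–Fredholm module* $(\rho,\mathcal N,F)$ is given by $F\in\mathcal N$ with $F^2=1$ and $[F,a]$ $\tau$-compact for all $a\in A$. It is *even*, with grading $\chi$, if moreover $\chi=\chi^*\in\mathcal N$, $\chi^2=1$, $\chi a=a\chi$ for all $a\in A$ and $\chi F=-F\chi$. It is *$p$-summable* if $[F,a]$ is $p$-summable for every $a\in A$. Let $C^n(A)$ be the space of bounded $(n+1)$-linear functionals $\varphi(a_0,\dots,a_n)$ on $A$ that vanish if some $a_j$ with $j\ge1$ is a scalar, with norm $\|\varphi\|=\sup_{\|a_j\|\le1}|\varphi(a_0,\dots,a_n)|$,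 and let $$(b\varphi)(a_0,\dots,a_{n+1})=\sum_{j=0}^{n}(-1)^j\varphi(\dots,a_ja_{j+1},\dots)+(-1)^{n+1}\varphi(a_{n+1}a_0,a_1,\dots,a_n),$$ $$(B\varphi)(a_0,\dots,a_{n-1})=\sum_{j=0}^{n-1}(-1)^{(n-1)j}\varphi(1,a_j,\dots,a_{n-1},a_0,\dots,a_{j-1}).$$ A sequence $(\varphi_n)_{n\ge0}$ with $\varphi_n\in C^n(A)$ is *entire* if $\sum_n\Gamma(n/2)\|\varphi_n\|z^n$ is an entire function of $z$ (the term $n=0$, which does not affect convergence, being ignored); entire cyclic cohomology is the cohomology of the complex of entire cochains with differential $b+B$. **Theorem 1.4.** Let $I\subset\mathbb R$ be an interval with more than one point, $(F_t)_{t\in I}$ a norm-continuous family in $\mathcal N$, and $p>0$, such that every $(\rho,\mathcal N,F_t)$ is a $p$-summable Breuer–Fredholm module, either even for all $t$ with a fixed grading $\chi$, or odd for all $t$, in which case we set $\chi=1$. Let $n>p$ be an integer that is even in the even case and odd in the odd case. Then the Connes character $$\mathtt{ch}^n(F_t)(a_0,\dots,a_n)=\frac{\Gamma(\frac n2+1)}{2\cdot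 n!}\,\tau\big(\chi F_t[F_t,a_0]\cdots[F_t,a_n]\big)$$ is well defined (the operators are trace class) and is an entire cyclic cocycle, and its entire cyclic cohomology class does not depend on $t\in I$. More explicitly, let $t\in I$ be a point at which $F$ is norm-differentiable (one-sidedly if $t$ is an endpoint), with derivative $\dot F_t$, and suppose that for each $a\in A$ the norms $\|[F_s,a]\|_p$ are bounded for $s\in I$ near $t$. Then $$\big(\iota(\dot F_t)\mathtt{ch}^{n-1}(F_t)\big)(b_0,\dots,b_{n-1}):=\frac{\Gamma(\frac n2+1)}{2\cdot n!}\sum_{k=0}^{n-1}(-1)^{k+1}\,\tau\big(\chi F_t[F_t,b_0]\cdots[F_t,b_k]\,\dot F_t\,[F_t,b_{k+1}]\cdots[F_t,b_{n-1}]\big)$$ is well defined (the operators are trace class) and is an entire cochain, $s\mapsto\mathtt{ch}^n(F_s)$ is differentiable at $t$ in the norm of $C^n(A)$, and $$\frac{d}{dt}\mathtt{ch}^n(F_t)=(b+B)\,\iota(\dot F_t)\,\mathtt{ch}^{n-1}(F_t).$$ -/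

import Mathlib

open Filter Topology
open scoped ComplexStarModule ENNReal

noncomputable section

namespace BreuerFredholm

/-! ### Cochains and entire cyclic cohomology of a unital Banach algebra -/

section Cohomology

variable (A : Type*) [NormedRing A] [NormedAlgebra ℂ A]

/-- Bounded `(n+1)`-linear functionals on `A`.  The cochains `C^n(A)`, the bounded functionals on
`A ⊗ (A/ℂ)^{⊗ n}` (projective tensor product), are those that vanish as soon as one of the arguments
of index at least `1` is a scalar; this normalization is part of `entireCochains` below. The norm is
the usual `sup {|φ(a₀,…,aₙ)| : ‖a_j‖ ≤ 1}`. -/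
abbrev Cochain (n : ℕ) : Type _ := ContinuousMultilinearMap ℂ (fun _ : Fin (n + 1) => A) ℂ

/-- The product over all degrees. -/
abbrev CochainSeq : Type _ := ∀ n : ℕ, Cochain A n

variable {A}

/-- Pull-back of a bounded multilinear functional along a continuous map of argument tuples that is
linear in every argument, each argument being used in exactly one slot. -/
def pullback {k n : ℕ} (g : (Fin (k + 1) → A) → (Fin (n + 1) → A)) (hg : Continuous g)
    (h : ∀ (a : Fin (k + 1) → A) (i : Fin (k + 1)), ∃ (l : Fin (n + 1)) (L : A →ₗ[ℂ] A),
      ∀ x, g (Function.update a i x) = Function.update (g a) l (L x)) :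
    Cochain A n →ₗ[ℂ] Cochain A k where
  toFun φ :=
    { toFun := fun a => φ (g a)
      map_update_add' := by
        intro inst a i x y
        obtain rfl : inst = instDecidableEqFin (k + 1) := Subsingleton.elim _ _
        obtain ⟨l, L, hL⟩ := h a i
        simp [hL]
      map_update_smul' := by
        intro inst a i c x
        obtain rfl : inst = instDecidableEqFin (k + 1) := Subsingleton.elim _ _
        obtain ⟨l, L, hL⟩ := h a i
        simp [hL]
      cont := φ.cont.comp hg }
  map_add' _ _ := rfl
  map_smul' _ _ := rfl

/-- `(a₀,…,a_{n+1}) ↦ (a₀,…,a_j a_{j+1},…,a_{n+1})`. -/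
def face {n : ℕ} (j : Fin (n + 1)) (a : Fin (n + 2) → A) : Fin (n + 1) → A := fun i =>
  if i < j then a i.castSucc else if i = j then a i.castSucc * a i.succ else a i.succ

/-- `(a₀,…,a_{n+1}) ↦ (a_{n+1} a₀, a₁,…,a_n)`. -/
def lastFace {n : ℕ} (a : Fin (n + 2) → A) : Fin (n + 1) → A := fun i =>
  if i = 0 then a (Fin.last (n + 1)) * a 0 else a i.castSucc

/-- `(a₀,…,a_n) ↦ (1, a_j,…,a_n,a₀,…,a_{j-1})`; the sum `i + j` is taken modulo `n + 1`. -/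
def rotate {n : ℕ} (j : Fin (n + 1)) (a : Fin (n + 1) → A) : Fin (n + 2) → A :=
  Fin.cons 1 fun i => a (i + j)

theorem continuous_face {n : ℕ} (j : Fin (n + 1)) : Continuous (face (A := A) j) := by
  refine continuous_pi fun i => ?_
  unfold face
  split_ifs <;> fun_prop

theorem continuous_lastFace {n : ℕ} : Continuous (lastFace (A := A) (n := n)) := by
  refine continuous_pi fun i => ?_
  unfold lastFace
  split_ifs <;> fun_prop

theorem continuous_rotate {n : ℕ} (j : Fin (n + 1)) : Continuous (rotate (A := A) j) := by
  refine continuous_pi fun i => ?_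
  unfold rotate
  refine Fin.cases ?_ (fun i => ?_) i
  · simpa using continuous_const
  · simpa using continuous_apply _

theorem face_update {n : ℕ} (j : Fin (n + 1)) (a : Fin (n + 2) → A) (i : Fin (n + 2)) :
    ∃ (l : Fin (n + 1)) (L : A →ₗ[ℂ] A),
      ∀ x, face j (Function.update a i x) = Function.update (face j a) l (L x) := by
  rcases lt_trichotomy (i : ℕ) j with h | h | h
  · refine ⟨⟨i, by omega⟩, LinearMap.id, fun x => funext fun k => ?_⟩
    simp only [face, Function.update_apply, Fin.ext_iff, Fin.lt_def, LinearMap.id_apply,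
      Fin.val_castSucc, Fin.val_succ]
    grind
  · refine ⟨j, LinearMap.mulRight ℂ (a j.succ), fun x => funext fun k => ?_⟩
    simp only [face, Function.update_apply, Fin.ext_iff, Fin.lt_def, LinearMap.mulRight_apply,
      Fin.val_castSucc, Fin.val_succ]
    grind
  · by_cases h' : (i : ℕ) = j + 1
    · refine ⟨j, LinearMap.mulLeft ℂ (a j.castSucc), fun x => funext fun k => ?_⟩
      simp only [face, Function.update_apply, Fin.ext_iff, Fin.lt_def, LinearMap.mulLeft_apply,
        Fin.val_castSucc, Fin.val_succ]
      grind
    · refine ⟨⟨i - 1, by omega⟩, LinearMap.id, fun x => funext fun k => ?_⟩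
      simp only [face, Function.update_apply, Fin.ext_iff, Fin.lt_def, LinearMap.id_apply,
        Fin.val_castSucc, Fin.val_succ]
      grind

theorem lastFace_update {n : ℕ} (a : Fin (n + 2) → A) (i : Fin (n + 2)) :
    ∃ (l : Fin (n + 1)) (L : A →ₗ[ℂ] A),
      ∀ x, lastFace (Function.update a i x) = Function.update (lastFace a) l (L x) := by
  by_cases h0 : (i : ℕ) = 0
  · refine ⟨0, LinearMap.mulLeft ℂ (a (Fin.last (n + 1))), fun x => funext fun k => ?_⟩
    simp only [lastFace, Function.update_apply, Fin.ext_iff, LinearMap.mulLeft_apply,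
      Fin.val_castSucc, Fin.val_last, Fin.val_zero]
    grind
  · by_cases h1 : (i : ℕ) = n + 1
    · refine ⟨0, LinearMap.mulRight ℂ (a 0), fun x => funext fun k => ?_⟩
      simp only [lastFace, Function.update_apply, Fin.ext_iff, LinearMap.mulRight_apply,
        Fin.val_castSucc, Fin.val_last, Fin.val_zero]
      grind
    · refine ⟨⟨i, by omega⟩, LinearMap.id, fun x => funext fun k => ?_⟩
      simp only [lastFace, Function.update_apply, Fin.ext_iff, LinearMap.id_apply,
        Fin.val_castSucc, Fin.val_last, Fin.val_zero]
      grind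

theorem rotate_update {n : ℕ} (j : Fin (n + 1)) (a : Fin (n + 1) → A) (i : Fin (n + 1)) :
    ∃ (l : Fin (n + 2)) (L : A →ₗ[ℂ] A),
      ∀ x, rotate j (Function.update a i x) = Function.update (rotate j a) l (L x) := by
  refine ⟨(i - j).succ, LinearMap.id, fun x => funext fun k => ?_⟩
  refine Fin.cases ?_ (fun k => ?_) k
  · rw [Function.update_of_ne (Fin.succ_ne_zero _).symm]
    simp [rotate]
  · simp [rotate, Function.update_apply, Fin.succ_inj, eq_sub_iff_add_eq]

/-- The Hochschild coboundary `b : C^n → C^{n+1}`,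
`(bφ)(a₀,…,a_{n+1}) = ∑_{j ≤ n} (-1)^j φ(…,a_j a_{j+1},…) + (-1)^{n+1} φ(a_{n+1}a₀,a₁,…,a_n)`. -/
def hochschildb (n : ℕ) : Cochain A n →ₗ[ℂ] Cochain A (n + 1) :=
  (∑ j : Fin (n + 1), (-1 : ℂ) ^ (j : ℕ) • pullback (face j) (continuous_face j) (face_update j)) +
    (-1 : ℂ) ^ (n + 1) • pullback lastFace continuous_lastFace lastFace_update

/-- Connes' operator `B : C^{n+1} → C^n`,
`(Bφ)(a₀,…,a_n) = ∑_{j ≤ n} (-1)^{n j} φ(1,a_j,…,a_n,a₀,…,a_{j-1})`. -/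
def connesB (n : ℕ) : Cochain A (n + 1) →ₗ[ℂ] Cochain A n :=
  ∑ j : Fin (n + 1),
    (-1 : ℂ) ^ (n * (j : ℕ)) • pullback (rotate j) (continuous_rotate j) (rotate_update j)

/-- The total coboundary `b + B`. -/
def totalbB : CochainSeq A →ₗ[ℂ] CochainSeq A :=
  LinearMap.pi fun n => match n with
    | 0 => connesB 0 ∘ₗ LinearMap.proj 1
    | k + 1 => hochschildb k ∘ₗ LinearMap.proj k + connesB (k + 1) ∘ₗ LinearMap.proj (k + 2)

variable (A)

/-- Entire cochains: normalized sequences `(φ_n)` such that `∑ Γ(n/2) ‖φ_n‖ z^n` is an entire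
function of `z`, that is, converges for every complex `z`. (The term `n = 0` has no influence on
convergence; `Real.Gamma 0 = 0` by convention.) -/
def entireCochains : Submodule ℂ (CochainSeq A) where
  carrier := {φ | (∀ (n : ℕ) (a : Fin (n + 1) → A) (i : Fin (n + 1)), i ≠ 0 →
      (∃ c : ℂ, a i = algebraMap ℂ A c) → φ n a = 0) ∧
    ∀ z : ℂ, Summable fun n : ℕ => ((Real.Gamma ((n : ℝ) / 2) * ‖φ n‖ : ℝ) : ℂ) * z ^ n}
  zero_mem' := by simp
  add_mem' := by
    rintro φ ψ ⟨h1, h2⟩ ⟨k1, k2⟩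
    refine ⟨fun n a i hi hc => by simp [h1 n a i hi hc, k1 n a i hi hc], fun z => ?_⟩
    have := (h2 z).norm.add (k2 z).norm
    refine Summable.of_norm_bounded this fun n => ?_
    have hG : 0 ≤ Real.Gamma ((n : ℝ) / 2) := Real.Gamma_nonneg_of_nonneg (by positivity)
    simp only [norm_mul, Complex.norm_real, norm_norm, Real.norm_of_nonneg hG, Pi.add_apply]
    rw [← add_mul, ← mul_add]
    gcongr
    exact norm_add_le _ _
  smul_mem' := by
    rintro c φ ⟨h1, h2⟩
    refine ⟨fun n a i hi hc => by simp [h1 n a i hi hc], fun z => ?_⟩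
    have := (h2 z).mul_left ((‖c‖ : ℝ) : ℂ)
    refine this.congr fun n => ?_
    simp only [Pi.smul_apply, norm_smul]
    push_cast
    ring

/-- Entire cyclic cocycles. -/
def entireCocycles : Submodule ℂ (CochainSeq A) := entireCochains A ⊓ LinearMap.ker totalbB

/-- Entire cyclic cohomology: entire cocycles modulo coboundaries of entire cochains. -/
abbrev HE : Type _ :=
  (entireCocycles A).toAddSubgroup ⧸
    ((entireCochains A).map totalbB).toAddSubgroup.addSubgroupOf (entireCocycles A).toAddSubgroup

variable {A}

/-- The class of an entire cocycle. -/
def HE.mk (φ : CochainSeq A) (h : φ ∈ entireCocycles A) : HE A :=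
  QuotientAddGroup.mk (⟨φ, h⟩ : (entireCocycles A).toAddSubgroup)

end Cohomology

/-! ### Traces on von Neumann algebras, summable and compact operators -/

section Trace

variable {H : Type*} [NormedAddCommGroup H] [InnerProductSpace ℂ H] [CompleteSpace H]

/-- A faithful semi-finite normal trace on a von Neumann algebra `N`. Only the values on the
positive cone of `N` have a meaning. -/
structure FSNTrace (N : VonNeumannAlgebra H) where
  /-- the value of the trace at a positive operator of `N` -/
  val : (H →L[ℂ] H) → ℝ≥0∞
  val_add : ∀ x ∈ N, ∀ y ∈ N, 0 ≤ x → 0 ≤ y → val (x + y) = val x + val y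
  val_smul : ∀ x ∈ N, 0 ≤ x → ∀ r : ℝ, 0 ≤ r → val (r • x) = ENNReal.ofReal r * val x
  tracial : ∀ x ∈ N, val (star x * x) = val (x * star x)
  faithful : ∀ x ∈ N, 0 ≤ x → val x = 0 → x = 0
  normal : ∀ S : Set (H →L[ℂ] H), S.Nonempty → DirectedOn (· ≤ ·) S → (∀ y ∈ S, y ∈ N ∧ 0 ≤ y) →
    ∀ x ∈ N, IsLUB S x → val x = ⨆ y ∈ S, val y
  semifinite : ∀ x ∈ N, 0 ≤ x → x ≠ 0 → ∃ y ∈ N, 0 ≤ y ∧ y ≤ x ∧ y ≠ 0 ∧ val y < ∞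

variable {N : VonNeumannAlgebra H}

namespace FSNTrace

/-- `T` is a `p`-summable operator of `N`: `τ(|T|^p) < ∞`. -/
def IsSummable (τ : FSNTrace N) (p : ℝ) (T : H →L[ℂ] H) : Prop :=
  T ∈ N ∧ τ.val (CFC.abs T ^ p) < ∞

/-- The `p`-norm `‖T‖_p = τ(|T|^p)^{1/p}`, with value `∞` allowed. -/
def pNorm (τ : FSNTrace N) (p : ℝ) (T : H →L[ℂ] H) : ℝ≥0∞ := τ.val (CFC.abs T ^ p) ^ (1 / p)

/-- The generalized singular number
`μ_x(T) = inf {‖T E‖ : E ∈ N a projection with τ(1 - E) ≤ x}`. -/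
def singularNumber (τ : FSNTrace N) (x : ℝ) (T : H →L[ℂ] H) : ℝ :=
  sInf {r | ∃ E ∈ N, IsStarProjection E ∧ τ.val (1 - E) ≤ ENNReal.ofReal x ∧ r = ‖T * E‖}

/-- `T` is a `τ`-compact operator of `N`. -/
def IsCompact (τ : FSNTrace N) (T : H →L[ℂ] H) : Prop :=
  T ∈ N ∧ Tendsto (fun x => τ.singularNumber x T) atTop (𝓝 0)

/-- The value of the trace at a self-adjoint operator. -/
def onSelfAdjoint (τ : FSNTrace N) (T : H →L[ℂ] H) : ℝ := (τ.val T⁺).toReal - (τ.val T⁻).toReal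

/-- The complex-linear extension of the trace to the `1`-summable operators. -/
def onTraceClass (τ : FSNTrace N) (T : H →L[ℂ] H) : ℂ :=
  (τ.onSelfAdjoint (ℜ T : H →L[ℂ] H) : ℂ) + Complex.I * (τ.onSelfAdjoint (ℑ T : H →L[ℂ] H) : ℂ)

end FSNTrace

/-! ### Breuer-Fredholm modules and the Connes character -/

variable {A : Type*} [NormedRing A] [NormedAlgebra ℂ A] [StarRing A]

/-- `(ρ, N, F)` is an (odd) Breuer-Fredholm module over `A`. -/
structure IsOddModule (τ : FSNTrace N) (ρ : A →⋆ₐ[ℂ] (H →L[ℂ] H)) (F : H →L[ℂ] H) : Prop where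
  rho_mem : ∀ a, ρ a ∈ N
  rho_continuous : Continuous ρ
  mem : F ∈ N
  sq : F * F = 1
  compact_commutator : ∀ a, τ.IsCompact ⁅F, ρ a⁆

/-- `(ρ, N, F)` with the grading `χ` is an even Breuer-Fredholm module over `A`. -/
structure IsEvenModule (τ : FSNTrace N) (ρ : A →⋆ₐ[ℂ] (H →L[ℂ] H)) (χ F : H →L[ℂ] H) : Prop
    extends IsOddModule τ ρ F where
  chi_mem : χ ∈ N
  chi_selfAdjoint : IsSelfAdjoint χ
  chi_sq : χ * χ = 1
  rho_even : ∀ a, χ * ρ a = ρ a * χ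
  odd : χ * F = -(F * χ)

/-- `p`-summability of a Breuer-Fredholm module. -/
def IsSummableModule (τ : FSNTrace N) (p : ℝ) (ρ : A →⋆ₐ[ℂ] (H →L[ℂ] H)) (F : H →L[ℂ] H) : Prop :=
  ∀ a, τ.IsSummable p ⁅F, ρ a⁆

/-- The operator `χ F [F,a₀] [F,a₁] ⋯ [F,a_n]`. -/
def characterOperator (ρ : A →⋆ₐ[ℂ] (H →L[ℂ] H)) (χ F : H →L[ℂ] H) {n : ℕ}
    (a : Fin (n + 1) → A) : H →L[ℂ] H :=
  χ * F * (List.ofFn fun j => ⁅F, ρ (a j)⁆).prod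

/-- The operator `χ F [F,a₀] ⋯ [F,a_k] D [F,a_{k+1}] ⋯ [F,a_m]`. -/
def contractionOperator (ρ : A →⋆ₐ[ℂ] (H →L[ℂ] H)) (χ F D : H →L[ℂ] H) {m : ℕ}
    (a : Fin (m + 1) → A) (k : Fin (m + 1)) : H →L[ℂ] H :=
  χ * F * (List.ofFn fun j => if j = k then ⁅F, ρ (a j)⁆ * D else ⁅F, ρ (a j)⁆).prod

/-- `φ` is the Connes character `ch^n(F)` (for odd modules, `χ = 1`): all traces below are traces of
`1`-summable operators, and
`φ(a₀,…,a_n) = Γ(n/2+1) / (2 n!) · τ(χ F [F,a₀] ⋯ [F,a_n])`. -/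
def IsConnesCharacter (τ : FSNTrace N) (ρ : A →⋆ₐ[ℂ] (H →L[ℂ] H)) (χ F : H →L[ℂ] H) {n : ℕ}
    (φ : Cochain A n) : Prop :=
  ∀ a : Fin (n + 1) → A, τ.IsSummable 1 (characterOperator ρ χ F a) ∧
    φ a = ((Real.Gamma ((n : ℝ) / 2 + 1) / (2 * (n.factorial : ℝ)) : ℝ) : ℂ) *
      τ.onTraceClass (characterOperator ρ χ F a)

/-- `φ` is the contraction cochain `ι(D) ch^m(F)`, in degree `m = n - 1`: all traces below are traces
of `1`-summable operators, and with `n = m + 1`,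
`φ(a₀,…,a_{n-1}) =
  Γ(n/2+1) / (2 n!) · ∑_{k ≤ n-1} (-1)^{k+1} τ(χ F [F,a₀] ⋯ [F,a_k] D [F,a_{k+1}] ⋯ [F,a_{n-1}])`. -/
def IsContraction (τ : FSNTrace N) (ρ : A →⋆ₐ[ℂ] (H →L[ℂ] H)) (χ F D : H →L[ℂ] H) {m : ℕ}
    (φ : Cochain A m) : Prop :=
  ∀ a : Fin (m + 1) → A, (∀ k, τ.IsSummable 1 (contractionOperator ρ χ F D a k)) ∧
    φ a = ((Real.Gamma (((m + 1 : ℕ) : ℝ) / 2 + 1) / (2 * ((m + 1).factorial : ℝ)) : ℝ) : ℂ) *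
      ∑ k : Fin (m + 1), (-1 : ℂ) ^ ((k : ℕ) + 1) *
        τ.onTraceClass (contractionOperator ρ χ F D a k)

end Trace

end BreuerFredholm

end

/-! Write `n = m + 1`, let `P(a)` be the product of the commutators `[F,a_j]`, `Q(a)` the
alternating sum of the same products with `D = dF/dt` inserted after one of the commutators, and
`P'` the derivative of `P` in direction `D`.

Algebra. Since `[F,·]` is a derivation, the inner faces of `b` telescope: for `P` only two boundary
terms remain (`sum_commProd_face`), and for `Q` there remains in addition `[F,a₀] P'(a₁,…)`
(`sum_contractionSum_face`). Since `F² = 1`, `F` anticommutes with every `[F,a]` and with `D`, so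
`τ(χY)` vanishes for `Y` of the wrong parity (`onTraceClass_chi_mul_eq_zero`). With the cyclicity of
the trace this gives `b ch = 0` (`trace_commProd_hochschild`) and shows that `b` of the contraction
is the derivative of `ch` (`trace_contractionSum_hochschild`). Both functionals vanish even if their
zeroth argument is a scalar, so `B` kills them; each lives in a single degree, so entireness is
automatic.

Analysis. For `p < 1` the `p`-norm is only a quasi-norm, and constants do not matter, so `p`-norms
are replaced by the gauge `HasSize (1/p) c`, a dyadic sum of the distribution function of `|T|`.
Distribution functions are traces of supports, obtained as limits of traces of `jx(1 + jx)⁻¹`;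
operator monotonicity of this function and the trace property make them behave well under sums and
products, whence Hölder's inequality (`HasSize.mul`). The inequality `p < n` is strict, so
interpolation with the operator norm turns norm convergence and `p`-boundedness of `[F_s,a]` into
convergence in `L^n`. The character contains `n + 1` commutators while `n` of them already give a
trace class operator. Thus one commutator may be estimated, or differentiated, in the operator norm
only, and difference quotients converge in trace norm. A Baire argument (`exists_uniform_hasSize`)
makes all this uniform on the unit ball of `A`.

Homotopy invariance. The given family is merely norm-continuous and its `p`-norms need not be
locally bounded in `t`, so the derivative formula cannot be integrated along it. But two symmetries
`F₀`, `F₁` that are close in norm are joined by the smooth path `U_s F₀ U_s⁻¹` with `U_s = 1 - s (F₀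
- F₁) F₀ / 2`, whose commutators with `a` are controlled by `[F₀,a]` and `[F₁,a]`. Integration along
this path shows that the characters are cohomologous (`exists_hochschildb_of_norm_sub_lt`), and
connectedness of `I` does the rest. -/

namespace BreuerFredholm

/-! ### Resolvents in a C⋆-algebra -/

section Resolvent

/-- The function `t ↦ (1 + t⁺)⁻¹`. -/
noncomputable def resolventFn (t : ℝ) : ℝ := (1 + max t 0)⁻¹

/-- The function `t ↦ t⁺ / (1 + t⁺)`, a continuous version of the indicator of `(0, ∞)`. -/
noncomputable def rampFn (t : ℝ) : ℝ := 1 - resolventFn t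

@[fun_prop]
theorem continuous_resolventFn : Continuous resolventFn := by
  unfold resolventFn
  exact Continuous.inv₀ (by fun_prop) fun t => by positivity

@[fun_prop]
theorem continuous_rampFn : Continuous rampFn := by
  unfold rampFn
  fun_prop

theorem resolventFn_pos (t : ℝ) : 0 < resolventFn t := by unfold resolventFn; positivity

theorem resolventFn_le_one (t : ℝ) : resolventFn t ≤ 1 :=
  inv_le_one_of_one_le₀ (by simp)

theorem rampFn_nonneg (t : ℝ) : 0 ≤ rampFn t := sub_nonneg.2 (resolventFn_le_one t)

theorem rampFn_le_one (t : ℝ) : rampFn t ≤ 1 := sub_le_self _ (resolventFn_pos t).le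

theorem rampFn_of_nonpos {t : ℝ} (ht : t ≤ 0) : rampFn t = 0 := by
  simp [rampFn, resolventFn, ht]

theorem rampFn_mono : Monotone rampFn := by
  intro s t hst
  unfold rampFn resolventFn
  have := max_le_max_right 0 hst
  gcongr

theorem half_le_rampFn {t : ℝ} (ht : 1 ≤ t) : 1 / 2 ≤ rampFn t := by
  refine le_trans ?_ (rampFn_mono ht)
  norm_num [rampFn, resolventFn]

variable {B : Type*} [CStarAlgebra B] [PartialOrder B] [StarOrderedRing B]

theorem isUnit_one_add {x : B} (hx : 0 ≤ x) : IsUnit (1 + x) :=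
  (IsStrictlyPositive.add_nonneg isStrictlyPositive_one hx).isUnit

theorem cfc_resolventFn_mul {x : B} (hx : 0 ≤ x) : cfc resolventFn x * (1 + x) = 1 := by
  have hs : IsSelfAdjoint x := .of_nonneg hx
  have h : cfc (fun t : ℝ => 1 + t) x = 1 + x := by
    rw [cfc_add x (fun _ => (1 : ℝ)) (fun t => t), cfc_const_one ℝ x, cfc_id' ℝ x]
  rw [← h, ← cfc_mul resolventFn (fun t => 1 + t) x]
  rw [cfc_congr (g := fun _ => (1 : ℝ)), cfc_const_one ℝ x]
  intro t ht
  have ht : 0 ≤ t := spectrum_nonneg_of_nonneg hx ht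
  have : 1 + t ≠ 0 := by positivity
  simp [resolventFn, ht, this]

theorem mul_cfc_resolventFn {x : B} (hx : 0 ≤ x) : (1 + x) * cfc resolventFn x = 1 := by
  have hc : Commute (1 + x) (cfc resolventFn x) :=
    ((Commute.cfc_real ((Commute.one_right x).add_right (Commute.refl x)) _)).symm
  rw [hc.eq, cfc_resolventFn_mul hx]

theorem cfc_resolventFn {x : B} (hx : 0 ≤ x) : cfc resolventFn x = Ring.inverse (1 + x) := by
  have := isUnit_one_add hx
  calc cfc resolventFn x = cfc resolventFn x * ((1 + x) * Ring.inverse (1 + x)) := by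
        rw [Ring.mul_inverse_cancel _ this, mul_one]
    _ = Ring.inverse (1 + x) := by rw [← mul_assoc, cfc_resolventFn_mul hx, one_mul]

/-- Inversion is operator antitone. This dictates the choice of the ramp function: a cut-off such as
`min t 1` is not operator monotone. -/
theorem cfc_resolventFn_anti {x y : B} (hx : 0 ≤ x) (hxy : x ≤ y) :
    cfc resolventFn y ≤ cfc resolventFn x := by
  rw [cfc_resolventFn hx, cfc_resolventFn (hx.trans hxy)]
  exact CStarAlgebra.ringInverse_le_ringInverse (by gcongr)
    (IsStrictlyPositive.add_nonneg isStrictlyPositive_one hx)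

theorem cfc_rampFn {x : B} (hx : 0 ≤ x) : cfc rampFn x = 1 - cfc resolventFn x := by
  have hs : IsSelfAdjoint x := .of_nonneg hx
  rw [show rampFn = fun t => 1 - resolventFn t from rfl, cfc_sub (fun _ => 1) resolventFn x,
    cfc_const_one ℝ x]

theorem cfc_rampFn_mono {x y : B} (hx : 0 ≤ x) (hxy : x ≤ y) : cfc rampFn x ≤ cfc rampFn y := by
  rw [cfc_rampFn hx, cfc_rampFn (hx.trans hxy)]
  have := cfc_resolventFn_anti hx hxy
  gcongr

theorem cfc_rampFn_eq_mul {x : B} (hx : 0 ≤ x) : cfc rampFn x = x * cfc resolventFn x := by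
  rw [cfc_rampFn hx, ← mul_cfc_resolventFn hx]
  noncomm_ring

/-- Multiply `(1 + a a⋆) a = a (1 + a⋆ a)` by the two resolvents. -/
theorem mul_cfc_resolventFn_star_mul (a : B) :
    a * cfc resolventFn (star a * a) = cfc resolventFn (a * star a) * a := by
  have h1 := star_mul_self_nonneg a
  have h2 := mul_star_self_nonneg a
  calc a * cfc resolventFn (star a * a)
      = cfc resolventFn (a * star a) * (1 + a * star a) * a * cfc resolventFn (star a * a) := by
        rw [cfc_resolventFn_mul h2, one_mul]
    _ = cfc resolventFn (a * star a) * a * ((1 + star a * a) * cfc resolventFn (star a * a)) := by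
        noncomm_ring
    _ = _ := by rw [mul_cfc_resolventFn h1, mul_one]

/-- The square root of the resolvent. -/
noncomputable def sqrtResolventFn (t : ℝ) : ℝ := √(resolventFn t)

@[fun_prop]
theorem continuous_sqrtResolventFn : Continuous sqrtResolventFn := by
  unfold sqrtResolventFn
  fun_prop

theorem cfc_sqrtResolventFn_mul_self {x : B} (hx : 0 ≤ x) :
    cfc sqrtResolventFn x * cfc sqrtResolventFn x = cfc resolventFn x := by
  have hs : IsSelfAdjoint x := .of_nonneg hx
  rw [← cfc_mul sqrtResolventFn sqrtResolventFn x]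
  refine cfc_congr fun t _ => ?_
  exact Real.mul_self_sqrt (resolventFn_pos t).le

/-- In this symmetric form the middle factor is linear in `x`: for a sum of positive operators the
conjugation splits into positive summands, to each of which the trace property applies. -/
theorem cfc_rampFn_eq_conj {x : B} (hx : 0 ≤ x) :
    cfc rampFn x = cfc sqrtResolventFn x * x * cfc sqrtResolventFn x := by
  have hc : Commute (cfc sqrtResolventFn x) x := (Commute.refl x).cfc_real _
  rw [cfc_rampFn_eq_mul hx, hc.eq, mul_assoc, cfc_sqrtResolventFn_mul_self hx]

end Resolvent

end BreuerFredholm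

namespace BreuerFredholm

variable {H : Type*} [NormedAddCommGroup H] [InnerProductSpace ℂ H] [CompleteSpace H]

/-! ### Von Neumann algebras are closed under the usual operations -/

section VonNeumann

variable {N : VonNeumannAlgebra H}

/-- By the bicommutant property, every construction whose result commutes with whatever its input
commutes with stays inside `N`. -/
theorem mem_of_forall_commute {x : H →L[ℂ] H} (h : ∀ y ∈ N.commutant, Commute x y) : x ∈ N := by
  rw [← VonNeumannAlgebra.commutant_commutant N, VonNeumannAlgebra.mem_commutant_iff]
  exact fun g hg => (h g hg).symm.eq

theorem commute_of_mem {x y : H →L[ℂ] H} (hx : x ∈ N) (hy : y ∈ N.commutant) : Commute x y :=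
  VonNeumannAlgebra.mem_commutant_iff.1 hy x hx

theorem cfc_mem {x : H →L[ℂ] H} (hx : x ∈ N) (f : ℝ → ℝ) : cfc f x ∈ N :=
  mem_of_forall_commute fun _ hy => (commute_of_mem hx hy).cfc_real f

theorem cfc_nnreal_mem {x : H →L[ℂ] H} (hx : x ∈ N) (f : NNReal → NNReal) : cfc f x ∈ N :=
  mem_of_forall_commute fun _ hy => (commute_of_mem hx hy).cfc_nnreal f

theorem commute_ringInverse {R : Type*} [Ring R] {x y : R} (h : Commute x y) :
    Commute (Ring.inverse x) y := by
  by_cases hu : IsUnit x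
  · obtain ⟨u, rfl⟩ := hu
    rw [Ring.inverse_unit]
    exact h.units_inv_left
  · rw [Ring.inverse_non_unit _ hu]
    exact Commute.zero_left _

theorem ringInverse_mem {x : H →L[ℂ] H} (hx : x ∈ N) : Ring.inverse x ∈ N :=
  mem_of_forall_commute fun _ hy => commute_ringInverse (commute_of_mem hx hy)

theorem complex_smul_mem {x : H →L[ℂ] H} (hx : x ∈ N) (c : ℂ) : c • x ∈ N :=
  N.toStarSubalgebra.smul_mem hx c

theorem real_smul_mem {x : H →L[ℂ] H} (hx : x ∈ N) (c : ℝ) : c • x ∈ N := by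
  simpa using complex_smul_mem hx (c : ℂ)

theorem isClosed_coe : IsClosed (N : Set (H →L[ℂ] H)) := by
  rw [← VonNeumannAlgebra.centralizer_centralizer]
  exact Set.isClosed_centralizer _

end VonNeumann

namespace FSNTrace

variable {N : VonNeumannAlgebra H} (τ : FSNTrace N)

/-! ### The trace of positive operators -/

theorem val_zero : τ.val 0 = 0 := by
  simpa using τ.val_smul 0 (zero_mem N) le_rfl 0 le_rfl

theorem val_mono {x y : H →L[ℂ] H} (hx : x ∈ N) (hy : y ∈ N) (h0 : 0 ≤ x) (hxy : x ≤ y) :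
    τ.val x ≤ τ.val y := by
  have := τ.val_add x hx (y - x) (sub_mem hy hx) h0 (sub_nonneg.2 hxy)
  rw [add_sub_cancel] at this
  rw [this]
  exact le_self_add

theorem val_sum {ι : Type*} (s : Finset ι) (x : ι → H →L[ℂ] H) (hx : ∀ i ∈ s, x i ∈ N)
    (h0 : ∀ i ∈ s, 0 ≤ x i) : τ.val (∑ i ∈ s, x i) = ∑ i ∈ s, τ.val (x i) := by
  classical
  induction s using Finset.induction_on with
  | empty => simp [τ.val_zero]
  | insert i s hi ih =>
    simp only [Finset.mem_insert, forall_eq_or_imp] at hx h0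
    rw [Finset.sum_insert hi, Finset.sum_insert hi, τ.val_add _ hx.1 _ (sum_mem hx.2) h0.1
      (Finset.sum_nonneg h0.2), ih hx.2 h0.2]

/-- The trace axiom concerns only `x⋆x` and `xx⋆`; it is applied to `√y a`. The root is returned as
a witness because later arguments need a square root inside `N`. -/
theorem val_star_mul_mul {a y : H →L[ℂ] H} (ha : a ∈ N) (hy : y ∈ N) (h0 : 0 ≤ y) :
    ∃ s ∈ N, 0 ≤ s ∧ s * s = y ∧ τ.val (star a * y * a) = τ.val (s * (a * star a) * s) := by
  have hs : IsSelfAdjoint y := .of_nonneg h0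
  have hss : star (cfc Real.sqrt y) = cfc Real.sqrt y := (cfc_predicate Real.sqrt y).star_eq
  have hq : cfc Real.sqrt y * cfc Real.sqrt y = y := by
    rw [← cfc_mul Real.sqrt Real.sqrt y]
    conv_rhs => rw [← cfc_id' ℝ y]
    exact cfc_congr fun t ht => Real.mul_self_sqrt (spectrum_nonneg_of_nonneg h0 ht)
  refine ⟨cfc Real.sqrt y, cfc_mem hy _, cfc_nonneg fun t _ => Real.sqrt_nonneg t, hq, ?_⟩
  have h := τ.tracial (cfc Real.sqrt y * a) (mul_mem (cfc_mem hy _) ha)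
  rw [star_mul, hss] at h
  calc _ = τ.val (star a * cfc Real.sqrt y * (cfc Real.sqrt y * a)) := by
        rw [show star a * cfc Real.sqrt y * (cfc Real.sqrt y * a)
          = star a * (cfc Real.sqrt y * cfc Real.sqrt y) * a by simp only [mul_assoc], hq]
    _ = _ := by rw [h]; simp only [mul_assoc]

/-! ### Ranks of operators -/

/-- The trace of the support of a positive operator. -/
noncomputable def rank (x : H →L[ℂ] H) : ℝ≥0∞ := ⨆ j : ℕ, τ.val (cfc rampFn ((j : ℝ) • x))

theorem val_rampFn_mono {x y : H →L[ℂ] H} (hx : x ∈ N) (hy : y ∈ N) (h0 : 0 ≤ x) (hxy : x ≤ y) :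
    τ.val (cfc rampFn x) ≤ τ.val (cfc rampFn y) :=
  τ.val_mono (cfc_mem hx _) (cfc_mem hy _) (cfc_nonneg fun t _ => rampFn_nonneg t)
    (cfc_rampFn_mono h0 hxy)

theorem monotone_val_rampFn {x : H →L[ℂ] H} (hx : x ∈ N) (h0 : 0 ≤ x) :
    Monotone fun j : ℕ => τ.val (cfc rampFn ((j : ℝ) • x)) := by
  intro i j hij
  refine τ.val_rampFn_mono (real_smul_mem hx _) (real_smul_mem hx _)
    (smul_nonneg (by positivity) h0) (smul_le_smul_of_nonneg_right (by exact_mod_cast hij) h0)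

theorem val_rampFn_le_rank {x : H →L[ℂ] H} (hx : x ∈ N) (h0 : 0 ≤ x) {c : ℝ} (hc : 0 ≤ c) :
    τ.val (cfc rampFn (c • x)) ≤ τ.rank x := by
  obtain ⟨j, hj⟩ := exists_nat_ge c
  refine le_trans ?_ (le_iSup _ j)
  exact τ.val_rampFn_mono (real_smul_mem hx _) (real_smul_mem hx _)
    (smul_nonneg hc h0) (smul_le_smul_of_nonneg_right hj h0)

theorem rank_mono {x y : H →L[ℂ] H} (hx : x ∈ N) (hy : y ∈ N) (h0 : 0 ≤ x) (hxy : x ≤ y) :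
    τ.rank x ≤ τ.rank y := by
  refine iSup_mono fun j => ?_
  exact τ.val_rampFn_mono (real_smul_mem hx _) (real_smul_mem hy _)
    (smul_nonneg (by positivity) h0) (smul_le_smul_of_nonneg_left hxy (by positivity))

theorem rank_smul_le {x : H →L[ℂ] H} (hx : x ∈ N) (h0 : 0 ≤ x) {c : ℝ} (hc : 0 ≤ c) :
    τ.rank (c • x) ≤ τ.rank x := by
  refine iSup_le fun j => ?_
  rw [smul_smul]
  exact τ.val_rampFn_le_rank hx h0 (by positivity)

theorem rank_zero : τ.rank 0 = 0 := by
  simp [rank, rampFn_of_nonpos, τ.val_zero]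

/-- With `g` the root of the resolvent of `a⋆a`, the left operator is `(ag)⋆(ag)`, and `(ag)(ag)⋆`
is the right one by the intertwining relation for resolvents. -/
theorem val_rampFn_star_mul_self {a : H →L[ℂ] H} (ha : a ∈ N) :
    τ.val (cfc rampFn (star a * a)) = τ.val (cfc rampFn (a * star a)) := by
  have h1 := star_mul_self_nonneg a
  have h2 := mul_star_self_nonneg a
  have hN : star a * a ∈ N := mul_mem (star_mem ha) ha
  have hs : star (cfc sqrtResolventFn (star a * a)) = cfc sqrtResolventFn (star a * a) :=
    (cfc_predicate (R := ℝ) sqrtResolventFn (star a * a)).star_eq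
  have h := τ.tracial (a * cfc sqrtResolventFn (star a * a)) (mul_mem ha (cfc_mem hN _))
  rw [star_mul, hs] at h
  calc τ.val (cfc rampFn (star a * a))
      = τ.val (cfc sqrtResolventFn (star a * a) * star a *
          (a * cfc sqrtResolventFn (star a * a))) := by
        rw [cfc_rampFn_eq_conj h1]; simp only [mul_assoc]
    _ = τ.val (a * cfc sqrtResolventFn (star a * a) *
          (cfc sqrtResolventFn (star a * a) * star a)) := h
    _ = τ.val (a * (cfc sqrtResolventFn (star a * a) * cfc sqrtResolventFn (star a * a)) *
          star a) := by simp only [mul_assoc]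
    _ = τ.val (a * star a * cfc resolventFn (a * star a)) := by
        have hc : Commute (cfc resolventFn (a * star a)) (a * star a) :=
          (Commute.refl _).cfc_real _
        rw [cfc_sqrtResolventFn_mul_self h1, mul_cfc_resolventFn_star_mul, mul_assoc, hc.eq]
    _ = _ := by rw [cfc_rampFn_eq_mul h2]

theorem sqrt_smul_star_mul_self (a : H →L[ℂ] H) {c : ℝ} (hc : 0 ≤ c) :
    star (√c • a) * (√c • a) = c • (star a * a) ∧ √c • a * star (√c • a) = c • (a * star a) := by
  simp [star_smul, smul_smul, Real.mul_self_sqrt hc]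

theorem rank_star_mul_self {a : H →L[ℂ] H} (ha : a ∈ N) :
    τ.rank (star a * a) = τ.rank (a * star a) := by
  refine iSup_congr fun j => ?_
  have h := sqrt_smul_star_mul_self a (c := (j : ℝ)) (by positivity)
  rw [← h.1, ← h.2]
  exact τ.val_rampFn_star_mul_self (real_smul_mem ha _)

/-- The trace property turns the conjugation of `x` by the root of the resolvent of `z` into a
conjugation of that resolvent by `√x`. There it may be replaced by the larger resolvent of `x`,
which commutes with `√x`. Subadditivity of the rank rests on this. -/
theorem val_conj_sqrtResolventFn_le {x z : H →L[ℂ] H} (hx : x ∈ N) (hz : z ∈ N) (h0 : 0 ≤ x)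
    (hxz : x ≤ z) :
    τ.val (cfc sqrtResolventFn z * x * cfc sqrtResolventFn z) ≤ τ.val (cfc rampFn x) := by
  have hs : star (cfc sqrtResolventFn z) = cfc sqrtResolventFn z :=
    (cfc_predicate (R := ℝ) sqrtResolventFn z).star_eq
  obtain ⟨s, hsN, hs0, hss, h⟩ := τ.val_star_mul_mul (cfc_mem hz sqrtResolventFn) hx h0
  have hz0 : 0 ≤ z := h0.trans hxz
  have hsa : star s = s := (IsSelfAdjoint.of_nonneg hs0).star_eq
  rw [hs, cfc_sqrtResolventFn_mul_self hz0] at h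
  have hc : Commute (cfc resolventFn x) s := by
    refine Commute.cfc_real ?_ _
    rw [← hss]
    exact (Commute.refl s).mul_left (Commute.refl s)
  have hk : 0 ≤ cfc resolventFn z := cfc_nonneg fun t _ => (resolventFn_pos t).le
  have hle : s * cfc resolventFn z * s ≤ s * cfc resolventFn x * s := by
    simpa only [hsa] using
      star_left_conjugate_le_conjugate (cfc_resolventFn_anti h0 hxz) s
  have h0' : 0 ≤ s * cfc resolventFn z * s := by
    simpa only [hsa] using star_left_conjugate_nonneg hk s
  calc _ = τ.val (s * cfc resolventFn z * s) := h
    _ ≤ τ.val (s * cfc resolventFn x * s) :=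
        τ.val_mono (mul_mem (mul_mem hsN (cfc_mem hz _)) hsN)
          (mul_mem (mul_mem hsN (cfc_mem hx _)) hsN) h0' hle
    _ = τ.val (cfc rampFn x) := by rw [cfc_rampFn_eq_mul h0, mul_assoc, hc.eq, ← mul_assoc, hss]

theorem val_rampFn_add_le {x y : H →L[ℂ] H} (hx : x ∈ N) (hy : y ∈ N) (hx0 : 0 ≤ x) (hy0 : 0 ≤ y) :
    τ.val (cfc rampFn (x + y)) ≤ τ.val (cfc rampFn x) + τ.val (cfc rampFn y) := by
  have hz := add_mem hx hy
  have hs : star (cfc sqrtResolventFn (x + y)) = cfc sqrtResolventFn (x + y) :=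
    (cfc_predicate (R := ℝ) sqrtResolventFn (x + y)).star_eq
  have hsN := cfc_mem hz sqrtResolventFn
  have hpos : ∀ w : H →L[ℂ] H, 0 ≤ w →
      0 ≤ cfc sqrtResolventFn (x + y) * w * cfc sqrtResolventFn (x + y) := fun w hw => by
    simpa only [hs] using star_left_conjugate_nonneg hw (cfc sqrtResolventFn (x + y))
  rw [cfc_rampFn_eq_conj (add_nonneg hx0 hy0), mul_add, add_mul,
    τ.val_add _ (mul_mem (mul_mem hsN hx) hsN) _ (mul_mem (mul_mem hsN hy) hsN) (hpos x hx0)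
      (hpos y hy0)]
  exact add_le_add (τ.val_conj_sqrtResolventFn_le hx hz hx0 (le_add_of_nonneg_right hy0))
    (τ.val_conj_sqrtResolventFn_le hy hz hy0 (le_add_of_nonneg_left hx0))

theorem rank_add_le {x y : H →L[ℂ] H} (hx : x ∈ N) (hy : y ∈ N) (hx0 : 0 ≤ x) (hy0 : 0 ≤ y) :
    τ.rank (x + y) ≤ τ.rank x + τ.rank y := by
  refine iSup_le fun j => ?_
  rw [smul_add]
  refine (τ.val_rampFn_add_le (real_smul_mem hx _) (real_smul_mem hy _)
    (smul_nonneg (by positivity) hx0) (smul_nonneg (by positivity) hy0)).trans ?_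
  exact add_le_add (le_iSup (fun j : ℕ => τ.val (cfc rampFn ((j : ℝ) • x))) j)
    (le_iSup (fun j : ℕ => τ.val (cfc rampFn ((j : ℝ) • y))) j)

/-- The trace of the right support of an operator. -/
noncomputable def opRank (T : H →L[ℂ] H) : ℝ≥0∞ := τ.rank (star T * T)

theorem opRank_star {T : H →L[ℂ] H} (hT : T ∈ N) : τ.opRank (star T) = τ.opRank T := by
  rw [opRank, opRank, star_star, τ.rank_star_mul_self hT]

theorem opRank_mul_le_right {S T : H →L[ℂ] H} (hS : S ∈ N) (hT : T ∈ N) :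
    τ.opRank (S * T) ≤ τ.opRank T := by
  have h1 : star (S * T) * (S * T) ≤ ‖star S * S‖ • (star T * T) := by
    have := CStarAlgebra.star_left_conjugate_le_norm_smul (a := T) (b := star S * S)
      (IsSelfAdjoint.star_mul_self S)
    simpa only [star_mul, mul_assoc] using this
  refine (τ.rank_mono (mul_mem (star_mem (mul_mem hS hT)) (mul_mem hS hT))
    (real_smul_mem (mul_mem (star_mem hT) hT) _) (star_mul_self_nonneg _) h1).trans ?_
  exact τ.rank_smul_le (mul_mem (star_mem hT) hT) (star_mul_self_nonneg _) (norm_nonneg _)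

theorem opRank_mul_le_left {S T : H →L[ℂ] H} (hS : S ∈ N) (hT : T ∈ N) :
    τ.opRank (S * T) ≤ τ.opRank S := by
  rw [← τ.opRank_star (mul_mem hS hT), ← τ.opRank_star hS, star_mul]
  exact τ.opRank_mul_le_right (star_mem hT) (star_mem hS)

theorem star_add_mul_add_le (S T : H →L[ℂ] H) :
    star (S + T) * (S + T) ≤ (2 : ℝ) • (star S * S) + (2 : ℝ) • (star T * T) := by
  have h := star_mul_self_nonneg (S - T)
  rw [← sub_nonneg]
  convert h using 1
  simp only [star_add, star_sub, two_smul]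
  noncomm_ring

theorem opRank_add_le {S T : H →L[ℂ] H} (hS : S ∈ N) (hT : T ∈ N) :
    τ.opRank (S + T) ≤ τ.opRank S + τ.opRank T := by
  have hS' := mul_mem (star_mem hS) hS
  have hT' := mul_mem (star_mem hT) hT
  have h2 : (0 : ℝ) ≤ 2 := by norm_num
  refine (τ.rank_mono (mul_mem (star_mem (add_mem hS hT)) (add_mem hS hT))
    (add_mem (real_smul_mem hS' 2) (real_smul_mem hT' 2)) (star_mul_self_nonneg _)
    (star_add_mul_add_le S T)).trans ?_
  refine (τ.rank_add_le (real_smul_mem hS' 2) (real_smul_mem hT' 2)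
    (smul_nonneg h2 (star_mul_self_nonneg _)) (smul_nonneg h2 (star_mul_self_nonneg _))).trans ?_
  exact add_le_add (τ.rank_smul_le hS' (star_mul_self_nonneg _) h2)
    (τ.rank_smul_le hT' (star_mul_self_nonneg _) h2)

end FSNTrace

end BreuerFredholm

namespace BreuerFredholm

/-! ### Truncations of operators -/

section Truncation

variable {B : Type*} [CStarAlgebra B] [PartialOrder B] [StarOrderedRing B]

omit [PartialOrder B] [StarOrderedRing B] in
theorem star_mul_cfc_mul_mul_cfc (T : B) {f : ℝ → ℝ} (hf : Continuous f) :
    star (T * cfc f (star T * T)) * (T * cfc f (star T * T)) =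
      cfc (fun u => f u ^ 2 * u) (star T * T) := by
  have hs : star (cfc f (star T * T)) = cfc f (star T * T) :=
    (cfc_predicate (R := ℝ) f (star T * T)).star_eq
  have hsa : IsSelfAdjoint (star T * T) := .star_mul_self T
  have hc : Commute (cfc f (star T * T)) (star T * T) := (Commute.refl _).cfc_real _
  calc _ = cfc f (star T * T) * (star T * T) * cfc f (star T * T) := by
        rw [star_mul, hs]; simp only [mul_assoc]
    _ = cfc f (star T * T) * cfc f (star T * T) * (star T * T) := by
        rw [mul_assoc, ← hc.eq, mul_assoc]
    _ = cfc f (star T * T) * cfc f (star T * T) * cfc (fun u : ℝ => u) (star T * T) := by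
        rw [cfc_id' ℝ (star T * T)]
    _ = _ := by
        rw [← cfc_mul f f (star T * T), ← cfc_mul (fun u => f u * f u) (fun u => u) (star T * T)]
        simp only [sq]

omit [PartialOrder B] [StarOrderedRing B] in
theorem sub_mul_cfc (T : B) {f : ℝ → ℝ} (hf : Continuous f) :
    T - T * cfc f (star T * T) = T * cfc (fun u => 1 - f u) (star T * T) := by
  have hsa : IsSelfAdjoint (star T * T) := .star_mul_self T
  rw [cfc_sub (fun _ => (1 : ℝ)) f (star T * T), cfc_const_one ℝ (star T * T), mul_sub, mul_one]

theorem le_of_mem_spectrum_star_mul_self {T : B} {u : ℝ} (hu : u ∈ spectrum ℝ (star T * T)) :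
    u ≤ ‖T‖ ^ 2 := by
  rcases subsingleton_or_nontrivial B with hB | hB
  · simp [spectrum.of_subsingleton] at hu
  · have h0 : 0 ≤ u := spectrum_nonneg_of_nonneg (star_mul_self_nonneg T) hu
    simpa [CStarRing.norm_star_mul_self, abs_of_nonneg h0, ← sq] using
      spectrum.norm_le_norm_mul_of_mem hu

theorem norm_mul_cfc_le (T : B) {f : ℝ → ℝ} (hf : Continuous f) {c : ℝ} (hc : 0 ≤ c)
    (h : ∀ u, 0 ≤ u → u ≤ ‖T‖ ^ 2 → f u ^ 2 * u ≤ c ^ 2) : ‖T * cfc f (star T * T)‖ ≤ c := by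
  refine abs_le_of_sq_le_sq' ?_ hc |>.2
  rw [sq, ← CStarRing.norm_star_mul_self, star_mul_cfc_mul_mul_cfc T hf]
  refine norm_cfc_le (sq_nonneg c) fun u hu => ?_
  have h0 : 0 ≤ u := spectrum_nonneg_of_nonneg (star_mul_self_nonneg T) hu
  rw [Real.norm_of_nonneg (by positivity)]
  exact h u h0 (le_of_mem_spectrum_star_mul_self hu)

/-- The function `u ↦ (u - l²)⁺ / max(u, l²)`, continuous for `l ≠ 0`. -/
noncomputable def truncFn (l : ℝ) (u : ℝ) : ℝ := max (u - l ^ 2) 0 / max u (l ^ 2)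

theorem continuous_truncFn {l : ℝ} (hl : 0 < l) : Continuous (truncFn l) := by
  unfold truncFn
  exact Continuous.div (by fun_prop) (by fun_prop) fun u => by positivity

theorem truncFn_nonneg {l : ℝ} (hl : 0 < l) (u : ℝ) : 0 ≤ truncFn l u := by
  unfold truncFn; positivity

theorem truncFn_le_one {l : ℝ} (hl : 0 < l) (u : ℝ) : truncFn l u ≤ 1 := by
  unfold truncFn
  rw [div_le_one (by positivity)]
  exact max_le ((sub_le_self _ (by positivity)).trans (le_max_left _ _)) (by positivity)

theorem one_sub_truncFn_sq_mul_le {l : ℝ} (hl : 0 < l) (u : ℝ) :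
    (1 - truncFn l u) ^ 2 * u ≤ l ^ 2 := by
  rcases le_total u (l ^ 2) with h | h
  · simp [truncFn, h]
  · have hu' : 0 < u := lt_of_lt_of_le (by positivity) h
    have : 1 - truncFn l u = l ^ 2 / u := by
      rw [truncFn, max_eq_left h, max_eq_left (sub_nonneg.2 h)]
      field_simp
      ring
    rw [this, div_pow, sq u, div_mul_eq_mul_div, mul_div_mul_right _ _ hu'.ne', div_le_iff₀ hu',
      sq (l ^ 2)]
    gcongr

theorem truncFn_sq_mul_le {l : ℝ} (hl : 0 < l) {u : ℝ} (hu : 0 ≤ u) :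
    truncFn l u ^ 2 * u ≤ max (u - l ^ 2) 0 := by
  have hm : 0 < max u (l ^ 2) := by positivity
  have h1 : truncFn l u * max u (l ^ 2) = max (u - l ^ 2) 0 := div_mul_cancel₀ _ hm.ne'
  have h2 := truncFn_nonneg hl u
  have h3 := truncFn_le_one hl u
  rw [← h1, sq, mul_assoc]
  gcongr
  exact (mul_le_of_le_one_left hu h3).trans (le_max_left _ _)

/-- The truncation of `T` at level `l`: the part of `T` where `|T|` exceeds `l`. -/
noncomputable def truncation (l : ℝ) (T : B) : B := T * cfc (truncFn l) (star T * T)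

theorem norm_sub_truncation_le {l : ℝ} (hl : 0 < l) (T : B) : ‖T - truncation l T‖ ≤ l := by
  have hf := continuous_truncFn hl
  rw [truncation, sub_mul_cfc T hf]
  exact norm_mul_cfc_le T (by fun_prop) hl.le fun u _ _ => one_sub_truncFn_sq_mul_le hl u

/-- The right-hand side is the operator whose rank defines the distribution function, so the
truncation splits `T` into a part of controlled rank and a part of norm at most `l`. -/
theorem star_mul_self_truncation_le {l : ℝ} (hl : 0 < l) (T : B) :
    star (truncation l T) * truncation l T ≤ cfc (fun u => max (u - l ^ 2) 0) (star T * T) := by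
  have hf := continuous_truncFn hl
  rw [truncation, star_mul_cfc_mul_mul_cfc T hf]
  exact cfc_mono fun u hu =>
    truncFn_sq_mul_le hl (spectrum_nonneg_of_nonneg (star_mul_self_nonneg T) hu)

/-- A continuous cut-off function that vanishes on `u ≤ 2 l²` and is `1` on `4 l² ≤ u`. -/
noncomputable def cutoffFn (l : ℝ) (u : ℝ) : ℝ := max 0 (min 1 ((u - 2 * l ^ 2) / (2 * l ^ 2)))

theorem continuous_cutoffFn (l : ℝ) : Continuous (cutoffFn l) := by
  unfold cutoffFn; fun_prop

/-- The gap between `2 l²` and `4 l²` leaves room for a continuous cut-off in place of a spectral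
projection; in the transition zone the left-hand side is zero. -/
theorem sub_le_cutoffFn {l : ℝ} (hl : 0 < l) (u : ℝ) :
    max (u - (2 * l) ^ 2) 0 ≤ cutoffFn l u ^ 2 * (u - 2 * l ^ 2) := by
  rcases le_total u (2 * l ^ 2) with h | h
  · have : cutoffFn l u = 0 := by
      refine max_eq_left (min_le_of_right_le ?_)
      exact div_nonpos_of_nonpos_of_nonneg (by linarith) (by positivity)
    rw [this, max_eq_right (by nlinarith [sq_nonneg l])]
    simp
  · refine max_le ?_ (mul_nonneg (sq_nonneg _) (by linarith))
    rcases le_total u (4 * l ^ 2) with h' | h'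
    · exact le_trans (by linarith) (mul_nonneg (sq_nonneg (cutoffFn l u)) (by linarith))
    · have : cutoffFn l u = 1 := by
        unfold cutoffFn
        rw [min_eq_left, max_eq_right zero_le_one]
        rw [le_div_iff₀ (by positivity)]
        linarith
      rw [this]
      nlinarith [sq_nonneg l]

/-- One has `T⋆T ≤ 2 (T-R)⋆(T-R) + 2 R⋆R ≤ 2 l² + 2 R⋆R`. Compressed by the cut-off of `T⋆T`, this
dominates the part of `T⋆T` above `4 l²` by a compression of `R⋆R`. -/
theorem cfc_sub_le_conj {l : ℝ} (hl : 0 < l) {T R : B} (h : ‖T - R‖ ≤ l) :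
    cfc (fun u => max (u - (2 * l) ^ 2) 0) (star T * T) ≤
      (2 : ℝ) • (star (R * cfc (cutoffFn l) (star T * T)) *
        (R * cfc (cutoffFn l) (star T * T))) := by
  have hf := continuous_cutoffFn l
  set x := star T * T with hx
  set F := cfc (cutoffFn l) x with hF
  have hxs : IsSelfAdjoint x := .star_mul_self T
  have hFs : star F = F := (cfc_predicate (R := ℝ) (cutoffFn l) x).star_eq
  have h1 : x ≤ (2 : ℝ) • (l ^ 2 • (1 : B)) + (2 : ℝ) • (star R * R) := by
    have h2 : star (T - R) * (T - R) ≤ l ^ 2 • (1 : B) := by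
      refine CStarAlgebra.star_mul_le_algebraMap_norm_sq.trans ?_
      rw [Algebra.algebraMap_eq_smul_one]
      gcongr
    have h3 := star_mul_self_nonneg ((T - R) - R)
    have h4 : x ≤ (2 : ℝ) • (star (T - R) * (T - R)) + (2 : ℝ) • (star R * R) := by
      rw [← sub_nonneg]
      convert h3 using 1
      simp only [star_sub, two_smul, hx]
      noncomm_ring
    exact h4.trans (by gcongr)
  have h5 : cfc (fun u => cutoffFn l u ^ 2 * (u - 2 * l ^ 2)) x =
      F * (x - (2 : ℝ) • (l ^ 2 • (1 : B))) * F := by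
    have hc : Commute F (x - (2 : ℝ) • (l ^ 2 • (1 : B))) := by
      refine Commute.cfc_real ?_ _
      exact (Commute.refl x).sub_right (((Commute.one_right x).smul_right _).smul_right _)
    have h6 : cfc (fun u : ℝ => u - 2 * l ^ 2) x = x - (2 : ℝ) • (l ^ 2 • (1 : B)) := by
      rw [cfc_sub (fun u : ℝ => u) (fun _ => 2 * l ^ 2) x, cfc_id' ℝ x, cfc_const _ x,
        Algebra.algebraMap_eq_smul_one, smul_smul]
    rw [mul_assoc, ← hc.eq, ← mul_assoc, ← h6, hF, ← cfc_mul (cutoffFn l) (cutoffFn l) x,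
      ← cfc_mul (fun u => cutoffFn l u * cutoffFn l u) (fun u => u - 2 * l ^ 2) x]
    simp only [sq]
  refine (cfc_mono (a := x) (fun u _ => sub_le_cutoffFn hl u)).trans ?_
  rw [h5]
  have h7 : x - (2 : ℝ) • (l ^ 2 • (1 : B)) ≤ (2 : ℝ) • (star R * R) := by
    rw [sub_le_iff_le_add']; exact h1
  have h8 := star_left_conjugate_le_conjugate h7 F
  rw [hFs] at h8
  refine h8.trans_eq ?_
  rw [star_mul, hFs]
  simp only [mul_smul_comm, smul_mul_assoc, mul_assoc]

end Truncation

variable {H : Type*} [NormedAddCommGroup H] [InnerProductSpace ℂ H] [CompleteSpace H]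

/-! ### Distribution functions -/

namespace FSNTrace

variable {N : VonNeumannAlgebra H} (τ : FSNTrace N)

/-- The distribution function of `|T|`: the trace of the spectral projection of `|T|` for the
interval `(l, ∞)`. -/
noncomputable def distrib (l : ℝ) (T : H →L[ℂ] H) : ℝ≥0∞ :=
  τ.rank (cfc (fun u => max (u - l ^ 2) 0) (star T * T))

theorem cfc_pos_nonneg (l : ℝ) (x : H →L[ℂ] H) : 0 ≤ cfc (fun u => max (u - l ^ 2) 0) x :=
  cfc_nonneg fun _ _ => le_max_right _ _

theorem distrib_anti {T : H →L[ℂ] H} (hT : T ∈ N) {l l' : ℝ} (hl : 0 ≤ l) (h : l ≤ l') :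
    τ.distrib l' T ≤ τ.distrib l T := by
  have hN := mul_mem (star_mem hT) hT
  refine τ.rank_mono (cfc_mem hN _) (cfc_mem hN _) (cfc_pos_nonneg _ _) ?_
  exact cfc_mono fun u _ => by gcongr

theorem distrib_of_norm_le {T : H →L[ℂ] H} {l : ℝ} (h : ‖T‖ ≤ l) : τ.distrib l T = 0 := by
  have h0 : cfc (fun u => max (u - l ^ 2) 0) (star T * T) = 0 := by
    rw [cfc_congr (g := fun _ => (0 : ℝ)), cfc_const_zero ℝ (star T * T)]
    intro u hu
    refine max_eq_right (sub_nonpos.2 ?_)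
    have h2 := le_of_mem_spectrum_star_mul_self hu
    exact h2.trans (by gcongr)
  rw [distrib, h0, τ.rank_zero]

theorem truncation_mem {T : H →L[ℂ] H} (hT : T ∈ N) (l : ℝ) : truncation l T ∈ N :=
  mul_mem hT (cfc_mem (mul_mem (star_mem hT) hT) _)

theorem opRank_truncation_le {T : H →L[ℂ] H} (hT : T ∈ N) {l : ℝ} (hl : 0 < l) :
    τ.opRank (truncation l T) ≤ τ.distrib l T :=
  τ.rank_mono (mul_mem (star_mem (truncation_mem hT l)) (truncation_mem hT l))
    (cfc_mem (mul_mem (star_mem hT) hT) _) (star_mul_self_nonneg _)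
    (star_mul_self_truncation_le hl T)

/-- The approximation principle behind all estimates of distribution functions: it is applied with
`R` built from truncations. The factor `2` comes from using squares and is harmless, since only the
order of magnitude of the gauge matters. -/
theorem distrib_two_mul_le {T R : H →L[ℂ] H} (hT : T ∈ N) (hR : R ∈ N) {l : ℝ} (hl : 0 < l)
    (h : ‖T - R‖ ≤ l) : τ.distrib (2 * l) T ≤ τ.opRank R := by
  have hN := mul_mem (star_mem hT) hT
  have hRF : R * cfc (cutoffFn l) (star T * T) ∈ N := mul_mem hR (cfc_mem hN _)
  refine (τ.rank_mono (cfc_mem hN _) (real_smul_mem (mul_mem (star_mem hRF) hRF) 2)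
    (cfc_pos_nonneg _ _) (cfc_sub_le_conj hl h)).trans ?_
  refine (τ.rank_smul_le (mul_mem (star_mem hRF) hRF) (star_mul_self_nonneg _)
    (by norm_num)).trans ?_
  exact τ.opRank_mul_le_left hR (cfc_mem hN _)

theorem distrib_add_le {S T : H →L[ℂ] H} (hS : S ∈ N) (hT : T ∈ N) {l l' : ℝ} (hl : 0 < l)
    (hl' : 0 < l') : τ.distrib (2 * (l + l')) (S + T) ≤ τ.distrib l S + τ.distrib l' T := by
  have hR := truncation_mem hS l
  have hQ := truncation_mem hT l'
  refine (τ.distrib_two_mul_le (add_mem hS hT) (add_mem hR hQ) (by positivity) ?_).trans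
    ((τ.opRank_add_le hR hQ).trans
      (add_le_add (τ.opRank_truncation_le hS hl) (τ.opRank_truncation_le hT hl')))
  rw [add_sub_add_comm]
  exact (norm_add_le _ _).trans
    (add_le_add (norm_sub_truncation_le hl S) (norm_sub_truncation_le hl' T))

theorem distrib_mul_le {S T : H →L[ℂ] H} (hS : S ∈ N) (hT : T ∈ N) {l l' : ℝ} (hl : 0 < l)
    (hl' : 0 < l') : τ.distrib (2 * (l * l')) (S * T) ≤ τ.distrib l S + τ.distrib l' T := by
  have hR := truncation_mem hS l
  have hQ := truncation_mem hT l'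
  have h1 := mul_mem hR hT
  have h2 := mul_mem (sub_mem hS hR) hQ
  refine (τ.distrib_two_mul_le (mul_mem hS hT) (add_mem h1 h2) (by positivity) ?_).trans
    ((τ.opRank_add_le h1 h2).trans (add_le_add
      ((τ.opRank_mul_le_left hR hT).trans (τ.opRank_truncation_le hS hl))
      ((τ.opRank_mul_le_right (sub_mem hS hR) hQ).trans (τ.opRank_truncation_le hT hl'))))
  -- The error factors into the two remainders, so its norm is at most `l * l'`, while each summand
  -- of the approximation contains a truncation and so has controlled rank.
  have : S * T - (truncation l S * T + (S - truncation l S) * truncation l' T) =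
      (S - truncation l S) * (T - truncation l' T) := by noncomm_ring
  rw [this]
  exact (norm_mul_le _ _).trans (mul_le_mul (norm_sub_truncation_le hl S)
    (norm_sub_truncation_le hl' T) (norm_nonneg _) hl.le)

theorem distrib_star_le {T : H →L[ℂ] H} (hT : T ∈ N) {l : ℝ} (hl : 0 < l) :
    τ.distrib (2 * l) (star T) ≤ τ.distrib l T := by
  have hR := truncation_mem hT l
  refine (τ.distrib_two_mul_le (star_mem hT) (star_mem hR) hl ?_).trans
    ((τ.opRank_star hR).trans_le (τ.opRank_truncation_le hT hl))
  rw [← star_sub, norm_star]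
  exact norm_sub_truncation_le hl T

theorem distrib_four_mul_le {S T : H →L[ℂ] H} (hS : S ∈ N) (hT : T ∈ N) {l : ℝ} (hl : 0 < l)
    (h : ‖T - S‖ ≤ l) : τ.distrib (4 * l) T ≤ τ.distrib l S := by
  have hR := truncation_mem hS l
  rw [show 4 * l = 2 * (2 * l) by ring]
  refine (τ.distrib_two_mul_le hT hR (by positivity) ?_).trans (τ.opRank_truncation_le hS hl)
  calc ‖T - truncation l S‖ = ‖(T - S) + (S - truncation l S)‖ := by rw [sub_add_sub_cancel]
    _ ≤ l + l := (norm_add_le _ _).trans (add_le_add h (norm_sub_truncation_le hl S))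
    _ = 2 * l := by ring

end FSNTrace

end BreuerFredholm

/-! ### Gauges of `L^p` type: dyadic sums of distribution functions -/

namespace BreuerFredholm

variable {H : Type*} [NormedAddCommGroup H] [InnerProductSpace ℂ H] [CompleteSpace H]

namespace FSNTrace

variable {N : VonNeumannAlgebra H} (τ : FSNTrace N)

/-- `T ∈ N` is bounded by `c` in a gauge that is equivalent, up to constants, to the norm of
`L^{1/e}` for `e > 0` and to the operator norm for `e = 0`. -/
def HasSize (e c : ℝ) (T : H →L[ℂ] H) : Prop :=
  T ∈ N ∧ 0 < c ∧
    ∑' k : ℤ, (2 : ℝ≥0∞) ^ k * τ.distrib (c * (2 : ℝ) ^ ((k : ℝ) * e)) T ≤ 1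

namespace HasSize

variable {τ}

theorem mem {e c : ℝ} {T : H →L[ℂ] H} (h : τ.HasSize e c T) : T ∈ N := h.1

theorem pos {e c : ℝ} {T : H →L[ℂ] H} (h : τ.HasSize e c T) : 0 < c := h.2.1

theorem mono {e c c' : ℝ} {T : H →L[ℂ] H} (h : τ.HasSize e c T) (hc : c ≤ c') :
    τ.HasSize e c' T := by
  have hc0 := h.pos
  refine ⟨h.mem, hc0.trans_le hc, le_trans (ENNReal.tsum_le_tsum fun k => ?_) h.2.2⟩
  gcongr
  exact τ.distrib_anti h.mem (by positivity) (by gcongr)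

/-- Shifting the dyadic index by one halves the weights, so that two sums bounded by `1` combine to
a sum bounded by `1`. At exponent `e` the shift costs a factor `2 ^ e` in the constants. -/
theorem tsum_shift_le_one {a b z : ℤ → ℝ≥0∞} (ha : ∑' k, a k ≤ 1) (hb : ∑' k, b k ≤ 1)
    (h : ∀ k, z k ≤ 2⁻¹ * (a (k + 1) + b (k + 1))) : ∑' k, z k ≤ 1 := by
  calc ∑' k, z k ≤ ∑' k, 2⁻¹ * (a (k + 1) + b (k + 1)) := ENNReal.tsum_le_tsum h
    _ = 2⁻¹ * (∑' k, a k + ∑' k, b k) := by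
        rw [ENNReal.tsum_mul_left, ENNReal.tsum_add, (Equiv.addRight (1 : ℤ)).tsum_eq a |>.symm,
          (Equiv.addRight (1 : ℤ)).tsum_eq b |>.symm]
        rfl
    _ ≤ 2⁻¹ * (1 + 1) := by gcongr
    _ = 1 := by rw [one_add_one_eq_two, ENNReal.inv_mul_cancel (by simp) (by simp)]

theorem two_zpow_eq (k : ℤ) : (2 : ℝ≥0∞) ^ k = 2⁻¹ * 2 ^ (k + 1) := by
  rw [ENNReal.zpow_add (by simp) (by simp), zpow_one, mul_comm, mul_assoc,
    ENNReal.mul_inv_cancel (by simp) (by simp), mul_one]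

theorem rpow_shift (k : ℤ) (e : ℝ) :
    (2 : ℝ) ^ (((k + 1 : ℤ) : ℝ) * e) = 2 ^ e * 2 ^ ((k : ℝ) * e) := by
  rw [← Real.rpow_add two_pos]
  push_cast
  ring_nf

/-- Hölder's inequality: the exponents are reciprocals of the usual ones and therefore add. One
factor `2` comes from `distrib_mul_le`, the factor `2 ^ (e + f)` from the dyadic shift. -/
theorem mul {e f c d : ℝ} {S T : H →L[ℂ] H} (hS : τ.HasSize e c S) (hT : τ.HasSize f d T) :
    τ.HasSize (e + f) (2 ^ (1 + e + f) * (c * d)) (S * T) := by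
  have hc := hS.pos
  have hd := hT.pos
  refine ⟨mul_mem hS.mem hT.mem, by positivity, tsum_shift_le_one hS.2.2 hT.2.2 fun k => ?_⟩
  rw [two_zpow_eq k, mul_assoc, ← mul_add]
  gcongr
  refine le_trans (le_of_eq ?_) (τ.distrib_mul_le hS.mem hT.mem (by positivity) (by positivity))
  congr 1
  rw [rpow_shift, rpow_shift, Real.rpow_add two_pos, Real.rpow_add two_pos, Real.rpow_one, mul_add,
    Real.rpow_add two_pos]
  ring

theorem add {e c d : ℝ} {S T : H →L[ℂ] H} (hS : τ.HasSize e c S) (hT : τ.HasSize e d T) :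
    τ.HasSize e (2 ^ (1 + e) * (c + d)) (S + T) := by
  have hc := hS.pos
  have hd := hT.pos
  refine ⟨add_mem hS.mem hT.mem, by positivity, tsum_shift_le_one hS.2.2 hT.2.2 fun k => ?_⟩
  rw [two_zpow_eq k, mul_assoc, ← mul_add]
  gcongr
  refine le_trans (le_of_eq ?_) (τ.distrib_add_le hS.mem hT.mem (by positivity) (by positivity))
  congr 1
  rw [rpow_shift, Real.rpow_add two_pos, Real.rpow_one]
  ring

protected theorem star {e c : ℝ} {T : H →L[ℂ] H} (hT : τ.HasSize e c T) : τ.HasSize e (2 * c) (star T) := by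
  have hc := hT.pos
  refine ⟨star_mem hT.mem, by positivity, le_trans (ENNReal.tsum_le_tsum fun k => ?_) hT.2.2⟩
  gcongr
  rw [mul_assoc]
  exact τ.distrib_star_le hT.mem (by positivity)

theorem of_norm_le {c : ℝ} {T : H →L[ℂ] H} (hT : T ∈ N) (hc : 0 < c) (h : ‖T‖ ≤ c) :
    τ.HasSize 0 c T := by
  refine ⟨hT, hc, ?_⟩
  simp [τ.distrib_of_norm_le h]

theorem zero (e : ℝ) {c : ℝ} (hc : 0 < c) : τ.HasSize e c 0 := by
  refine ⟨zero_mem N, hc, ?_⟩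
  have : ∀ k : ℤ, τ.distrib (c * (2 : ℝ) ^ ((k : ℝ) * e)) 0 = 0 := fun k =>
    τ.distrib_of_norm_le (by rw [norm_zero]; positivity)
  simp [this]

theorem smul {e c r : ℝ} {T : H →L[ℂ] H} (hT : τ.HasSize e c T) {z : ℂ} (hr : 0 < r)
    (hz : ‖z‖ ≤ r) : τ.HasSize e (2 ^ (1 + e) * (r * c)) (z • T) := by
  have h1 : τ.HasSize 0 r (z • (1 : H →L[ℂ] H)) := by
    refine of_norm_le (complex_smul_mem (one_mem N) z) hr ?_
    rw [norm_smul]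
    exact (mul_le_of_le_one_right (norm_nonneg _) ContinuousLinearMap.norm_id_le).trans hz
  have := h1.mul hT
  simpa using this

theorem neg {e c : ℝ} {T : H →L[ℂ] H} (hT : τ.HasSize e c T) :
    τ.HasSize e (2 ^ (1 + e) * c) (-T) := by
  simpa using hT.smul (z := -1) one_pos (by simp)

theorem sub {e c d : ℝ} {S T : H →L[ℂ] H} (hS : τ.HasSize e c S) (hT : τ.HasSize e d T) :
    τ.HasSize e (2 ^ (1 + e) * (c + 2 ^ (1 + e) * d)) (S - T) := by
  rw [sub_eq_add_neg]
  exact hS.add hT.neg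

/-- The distribution function vanishes from `d` on, so only levels below `d` count. For these `x = c
2^{ke}` is at most `d`, hence at most the geometric mean of `x` and `d` with weights `f/e` and `1 -
f/e`, which is the level at exponent `f`. -/
theorem interpolate {e f c d : ℝ} {T : H →L[ℂ] H} (hT : τ.HasSize e c T) (hd : 0 < d)
    (h : ‖T‖ ≤ d) (hf : 0 < f) (hfe : f < e) :
    τ.HasSize f (c ^ (f / e) * d ^ (1 - f / e)) T := by
  have hc := hT.pos
  have he : 0 < e := hf.trans hfe
  refine ⟨hT.mem, by positivity, le_trans (ENNReal.tsum_le_tsum fun k => ?_) hT.2.2⟩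
  gcongr
  set c' := c ^ (f / e) * d ^ (1 - f / e) with hc'
  rcases le_or_gt d (c' * (2 : ℝ) ^ ((k : ℝ) * f)) with h1 | h1
  · rw [τ.distrib_of_norm_le (h.trans h1)]
    exact zero_le
  · refine τ.distrib_anti hT.mem (by positivity) ?_
    set x := c * (2 : ℝ) ^ ((k : ℝ) * e) with hx
    have hx0 : 0 < x := by positivity
    have hθ : 0 < 1 - f / e := sub_pos.2 ((div_lt_one he).2 hfe)
    have hθ' : 0 < f / e := by positivity
    have h2 : c' * (2 : ℝ) ^ ((k : ℝ) * f) = x ^ (f / e) * d ^ (1 - f / e) := by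
      rw [hx, Real.mul_rpow hc.le (by positivity), ← Real.rpow_mul two_pos.le, hc',
        show (k : ℝ) * e * (f / e) = k * f by field_simp]
      ring
    have h3 : d = d ^ (f / e) * d ^ (1 - f / e) := by
      rw [← Real.rpow_add hd]; simp
    have h4 : x ≤ d := by
      have h5 : x ^ (f / e) < d ^ (f / e) := by
        refine lt_of_mul_lt_mul_right ?_ (Real.rpow_nonneg hd.le (1 - f / e))
        rwa [← h3, ← h2]
      exact ((Real.rpow_lt_rpow_iff hx0.le hd.le hθ').1 h5).le
    rw [h2]
    calc x = x ^ (f / e) * x ^ (1 - f / e) := by rw [← Real.rpow_add hx0]; simp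
      _ ≤ _ := by gcongr

/-- A partial sum involves finitely many levels, and for these a sufficiently good norm
approximation changes the level only by a factor `4`. -/
theorem of_tendsto {ι : Type*} {l : Filter ι} [l.NeBot] {e c : ℝ} {S : ι → H →L[ℂ] H}
    {T : H →L[ℂ] H} (hS : ∃ᶠ i in l, τ.HasSize e c (S i)) (h : Tendsto S l (𝓝 T)) :
    τ.HasSize e (4 * c) T := by
  obtain ⟨i, hi⟩ := hS.exists
  have hc := hi.pos
  have hT : T ∈ N := by
    have := mem_closure_of_frequently_of_tendsto (hS.mono fun i hi => hi.mem) h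
    rwa [isClosed_coe.closure_eq] at this
  refine ⟨hT, by positivity, ?_⟩
  rw [ENNReal.tsum_eq_iSup_sum]
  refine iSup_le fun s => ?_
  have h1 : ∀ᶠ i in l, ∀ k ∈ s, ‖T - S i‖ ≤ c * (2 : ℝ) ^ ((k : ℝ) * e) := by
    rw [Filter.eventually_all_finset]
    intro k _
    have h2 : Tendsto (fun i => ‖T - S i‖) l (𝓝 0) := by
      rw [← norm_zero (E := H →L[ℂ] H), ← sub_self T]
      exact (h.const_sub T).norm
    exact h2.eventually_le_const (by positivity)
  obtain ⟨i, hi, h2⟩ := (hS.and_eventually h1).exists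
  refine le_trans (Finset.sum_le_sum fun k hk => ?_) ((ENNReal.sum_le_tsum s).trans hi.2.2)
  gcongr
  rw [mul_assoc]
  exact τ.distrib_four_mul_le hi.mem hT (by positivity) (h2 k hk)

end HasSize

/-! ### Comparison with the trace of powers of the absolute value -/

theorem abs_mem {T : H →L[ℂ] H} (hT : T ∈ N) : CFC.abs T ∈ N := by
  rw [CFC.abs, CFC.sqrt_eq_cfc]
  exact cfc_nnreal_mem (mul_mem (star_mem hT) hT) _

theorem abs_eq_cfc (T : H →L[ℂ] H) : CFC.abs T = cfc Real.sqrt (star T * T) := by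
  rw [CFC.abs, CFC.sqrt_eq_real_sqrt _ (star_mul_self_nonneg T), cfcₙ_eq_cfc]

theorem abs_rpow_eq_cfc (T : H →L[ℂ] H) {p : ℝ} (hp : 0 < p) :
    CFC.abs T ^ p = cfc (fun u => √u ^ p) (star T * T) := by
  have h0 : 0 ≤ cfc Real.sqrt (star T * T) := cfc_nonneg fun u _ => Real.sqrt_nonneg u
  have hc : Continuous fun u : ℝ => u ^ p := Real.continuous_rpow_const hp.le
  rw [abs_eq_cfc, CFC.rpow_eq_cfc_real h0, ← cfc_comp' (fun u : ℝ => u ^ p) Real.sqrt (star T * T)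
    hc.continuousOn]

/-- A finite sum of powers `2 ^ k ≤ y` with distinct integral exponents is at most `2 y`. -/
theorem sum_two_zpow_le (s : Finset ℤ) {y : ℝ} (hy : 0 < y) (hs : ∀ k ∈ s, (2 : ℝ) ^ k ≤ y) :
    ∑ k ∈ s, (2 : ℝ) ^ k ≤ 2 * y := by
  rcases s.eq_empty_or_nonempty with rfl | hne
  · simp [hy.le]
  obtain ⟨M, hM, hmax⟩ := s.exists_max_image id hne
  have h1 : ∀ k ∈ s, (2 : ℝ) ^ k = 2 ^ M * (1 / 2) ^ (M - k).toNat := by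
    intro k hk
    have h2 : ((M - k).toNat : ℤ) = M - k := Int.toNat_of_nonneg (sub_nonneg.2 (hmax k hk))
    rw [one_div, inv_pow, ← zpow_natCast, h2, ← zpow_neg, ← zpow_add₀ two_ne_zero]
    congr 1
    ring
  have hinj : Set.InjOn (fun k : ℤ => (M - k).toNat) s := by
    intro k hk k' hk' h
    have h2 := hmax k hk
    have h3 := hmax k' hk'
    simp only [id] at h h2 h3
    omega
  rw [Finset.sum_congr rfl h1, ← Finset.mul_sum,
    ← Finset.sum_image (f := fun i : ℕ => ((1 : ℝ) / 2) ^ i) hinj, mul_comm]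
  refine mul_le_mul ?_ (hs M hM) (by positivity) (by norm_num)
  refine le_trans ?_ tsum_geometric_two.le
  exact summable_geometric_two.sum_le_tsum _ fun i _ => by positivity

theorem sum_val_cfc {ι : Type*} (s : Finset ι) (w : ι → ℝ) (f : ι → ℝ → ℝ)
    (hw : ∀ i, 0 ≤ w i) (hf : ∀ i, Continuous (f i)) (hf0 : ∀ i u, 0 ≤ f i u) {x : H →L[ℂ] H}
    (hx : x ∈ N) :
    ∑ i ∈ s, ENNReal.ofReal (w i) * τ.val (cfc (f i) x) =
      τ.val (cfc (fun u => ∑ i ∈ s, w i * f i u) x) := by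
  have h0 : ∀ i, 0 ≤ cfc (f i) x := fun i => cfc_nonneg fun u _ => hf0 i u
  have h1 : cfc (fun u => ∑ i ∈ s, w i * f i u) x = ∑ i ∈ s, w i • cfc (f i) x := by
    rw [show (fun u => ∑ i ∈ s, w i * f i u) = ∑ i ∈ s, fun u => w i * f i u by
      ext u; simp, cfc_sum _ x s fun i _ => by have := hf i; fun_prop]
    refine Finset.sum_congr rfl fun i _ => ?_
    have := hf i
    rw [cfc_const_mul (w i) (f i) x]
  rw [h1, τ.val_sum s _ (fun i _ => real_smul_mem (cfc_mem hx _) _)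
    (fun i _ => smul_nonneg (hw i) (h0 i))]
  exact Finset.sum_congr rfl fun i _ => (τ.val_smul _ (cfc_mem hx _) (h0 i) _ (hw i)).symm

theorem cfc_rampFn_smul_pos (c l : ℝ) {x : H →L[ℂ] H} (hx : IsSelfAdjoint x) :
    cfc rampFn (c • cfc (fun u => max (u - l ^ 2) 0) x) =
      cfc (fun u => rampFn (c * max (u - l ^ 2) 0)) x := by
  rw [← cfc_const_mul c (fun u => max (u - l ^ 2) 0) x,
    ← cfc_comp' rampFn (fun u => c * max (u - l ^ 2) 0) x]

theorem ofReal_two_zpow (k : ℤ) : ENNReal.ofReal ((2 : ℝ) ^ k) = 2 ^ k := by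
  have h : ((2 : ℝ) ^ k) = ((2 ^ k : NNReal) : ℝ) := by push_cast; rfl
  rw [h, ENNReal.ofReal_coe_nnreal, ENNReal.coe_zpow two_ne_zero]
  rfl

/-- Finite partial sums, with the rank replaced by one of its stages, reduce the claim to an
inequality of functions on the spectrum of `T⋆T`: the powers `2^k` with `c 2^{k/p} < √u` sum up to
at most `2 (√u / c)^p`, and `c` is chosen so that this is `√u^p / K`. -/
theorem HasSize.of_val_le {p K : ℝ} (hp : 0 < p) (hK : 0 < K) {T : H →L[ℂ] H} (hT : T ∈ N)
    (h : τ.val (CFC.abs T ^ p) ≤ ENNReal.ofReal K) :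
    τ.HasSize (1 / p) ((2 * K) ^ (1 / p)) T := by
  have hN := mul_mem (star_mem hT) hT
  have hsa : IsSelfAdjoint (star T * T) := .star_mul_self T
  set c := (2 * K) ^ (1 / p) with hc
  have hc0 : 0 < c := by positivity
  have hcp : c ^ p = 2 * K := by
    rw [hc, ← Real.rpow_mul (by positivity), one_div_mul_cancel hp.ne', Real.rpow_one]
  refine ⟨hT, hc0, ?_⟩
  rw [ENNReal.tsum_eq_iSup_sum]
  refine iSup_le fun s => ?_
  simp only [distrib, rank, ENNReal.mul_iSup]
  -- The stages of the rank increase with `j`, so one `j` can serve for all `k` of the finite set.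
  rw [ENNReal.finsetSum_iSup_of_monotone fun k i j hij => ?_]
  swap
  · exact mul_le_mul_right (τ.monotone_val_rampFn (cfc_mem hN _) (cfc_pos_nonneg _ _) hij) _
  refine iSup_le fun j => ?_
  simp only [cfc_rampFn_smul_pos _ _ hsa, ← ofReal_two_zpow]
  rw [τ.sum_val_cfc s _ _ (fun k => by positivity) (fun k => by fun_prop)
    (fun k u => rampFn_nonneg _) hN]
  have hcont : Continuous fun u : ℝ => √u ^ p :=
    (Real.continuous_rpow_const hp.le).comp Real.continuous_sqrt
  have h1 : cfc (fun u => ∑ k ∈ s, (2 : ℝ) ^ k *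
      rampFn (j * max (u - (c * 2 ^ ((k : ℝ) * (1 / p))) ^ 2) 0)) (star T * T) ≤
      (1 / K) • CFC.abs T ^ p := by
    rw [abs_rpow_eq_cfc T hp, ← cfc_const_mul (1 / K) _ _ hcont.continuousOn]
    refine cfc_mono (fun u hu => ?_) (by fun_prop) (hcont.const_mul _).continuousOn
    have hu0 : 0 ≤ u := spectrum_nonneg_of_nonneg (star_mul_self_nonneg T) hu
    rcases hu0.eq_or_lt with rfl | hu0
    · rw [Finset.sum_eq_zero fun k _ => ?_]
      · positivity
      · rw [rampFn_of_nonpos, mul_zero]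
        exact mul_nonpos_of_nonneg_of_nonpos (by positivity)
          (max_le (sub_nonpos.2 (by positivity)) le_rfl)
    have hsu : 0 < √u := Real.sqrt_pos.2 hu0
    calc _ ≤ ∑ k ∈ s, if (2 : ℝ) ^ k ≤ (√u / c) ^ p then (2 : ℝ) ^ k else 0 := by
          refine Finset.sum_le_sum fun k _ => ?_
          split_ifs with hk
          · exact mul_le_of_le_one_right (by positivity) (rampFn_le_one _)
          · rw [rampFn_of_nonpos, mul_zero]
            refine mul_nonpos_of_nonneg_of_nonpos (by positivity)
              (max_le (sub_nonpos.2 ?_) le_rfl)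
            rw [not_le] at hk
            rw [← Real.sqrt_le_left (by positivity)]
            rw [← div_le_iff₀' hc0]
            have h2 : ((√u / c) ^ p) ^ (1 / p) ≤ ((2 : ℝ) ^ (k : ℝ)) ^ (1 / p) := by
              rw [Real.rpow_intCast]
              gcongr
            rwa [← Real.rpow_mul (by positivity), ← Real.rpow_mul two_pos.le,
              mul_one_div_cancel hp.ne', Real.rpow_one] at h2
      _ ≤ 2 * (√u / c) ^ p := by
          rw [← Finset.sum_filter]
          exact sum_two_zpow_le _ (by positivity) fun k hk => (Finset.mem_filter.1 hk).2
      _ = 1 / K * √u ^ p := by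
          rw [Real.div_rpow hsu.le hc0.le, hcp]
          field_simp
  have hap : CFC.abs T ^ p ∈ N := by
    rw [abs_rpow_eq_cfc T hp]
    exact cfc_mem hN _
  refine (τ.val_mono (cfc_mem hN _) (real_smul_mem hap _) (cfc_nonneg fun u _ =>
    Finset.sum_nonneg fun k _ => mul_nonneg (by positivity) (rampFn_nonneg _)) h1).trans ?_
  rw [τ.val_smul _ hap CFC.rpow_nonneg _ (by positivity)]
  calc _ ≤ ENNReal.ofReal (1 / K) * ENNReal.ofReal K := by gcongr
    _ = 1 := by rw [← ENNReal.ofReal_mul (by positivity), one_div_mul_cancel hK.ne']; simp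

theorem val_eq_iSup_of_monotone {x : ℕ → H →L[ℂ] H} {y : H →L[ℂ] H} (hx : ∀ n, x n ∈ N)
    (h0 : ∀ n, 0 ≤ x n) (hmono : Monotone x) (hy : y ∈ N) (h : Tendsto x atTop (𝓝 y)) :
    τ.val y = ⨆ n, τ.val (x n) := by
  rw [τ.normal (Set.range x) (Set.range_nonempty x) (directedOn_range.2 hmono.directed_le)
    (by rintro _ ⟨n, rfl⟩; exact ⟨hx n, h0 n⟩) y hy (isLUB_of_tendsto_atTop hmono h), iSup_range]

/-- The layer-cake estimate in the opposite direction. Finitely many levels suffice to dominate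
`(|T| - δ)⁺`, and normality of the trace lets `δ` tend to `0`. -/
theorem val_le_of_hasSize {c : ℝ} {T : H →L[ℂ] H} (h : τ.HasSize 1 c T) :
    τ.val (CFC.abs T) ≤ ENNReal.ofReal (8 * c) := by
  have hT := h.mem
  have hc := h.pos
  have hN := mul_mem (star_mem hT) hT
  have hsa : IsSelfAdjoint (star T * T) := .star_mul_self T
  have hmem : ∀ n : ℕ, cfc (fun u => max (√u - 1 / ((n : ℝ) + 1)) 0) (star T * T) ∈ N :=
    fun n => cfc_mem hN _
  have hmono : Monotone fun n : ℕ =>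
      cfc (fun u => max (√u - 1 / ((n : ℝ) + 1)) 0) (star T * T) := fun m n hmn =>
    cfc_mono fun u _ => by
      have : (m : ℝ) ≤ n := by exact_mod_cast hmn
      gcongr
  rw [τ.val_eq_iSup_of_monotone hmem (fun n => cfc_nonneg fun u _ => le_max_right _ _)
    hmono (abs_mem hT) ?_]
  · refine iSup_le fun n => ?_
    set δ := 1 / ((n : ℝ) + 1) with hδ
    have hδ0 : 0 < δ := by positivity
    obtain ⟨K₁, hK₁⟩ := pow_unbounded_of_one_lt (‖T‖ / c) one_lt_two
    obtain ⟨K₂, hK₂⟩ := pow_unbounded_of_one_lt (c / δ) one_lt_two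
    have h1 : cfc (fun u => max (√u - δ) 0) (star T * T) ≤
        cfc (fun u => ∑ k ∈ Finset.Icc (-(K₂ : ℤ) - 2) K₁, (8 * c * (2 : ℝ) ^ k) *
          rampFn (1 / (c * 2 ^ k) ^ 2 * max (u - (c * 2 ^ k) ^ 2) 0)) (star T * T) := by
      refine cfc_mono (fun u hu => ?_)
      have hpos : ∀ k ∈ Finset.Icc (-(K₂ : ℤ) - 2) K₁, 0 ≤ (8 * c * (2 : ℝ) ^ k) *
          rampFn (1 / (c * 2 ^ k) ^ 2 * max (u - (c * 2 ^ k) ^ 2) 0) := fun k _ =>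
        mul_nonneg (by positivity) (rampFn_nonneg _)
      refine max_le ?_ (Finset.sum_nonneg hpos)
      rcases le_or_gt (√u) δ with hu1 | hu1
      · exact (sub_nonpos.2 hu1).trans (Finset.sum_nonneg hpos)
      have hu2 : 0 < √u := hδ0.trans hu1
      have hu3 : √u ≤ ‖T‖ := Real.sqrt_le_iff.2 ⟨norm_nonneg _, le_of_mem_spectrum_star_mul_self hu⟩
      obtain ⟨k, hk1, hk2⟩ := exists_mem_Ioc_zpow (x := √u / c) (by positivity) one_lt_two
      have hk3 : k < K₁ := by
        have : (2 : ℝ) ^ k < 2 ^ (K₁ : ℤ) := by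
          rw [zpow_natCast]
          exact hk1.trans_le ((div_le_div_of_nonneg_right hu3 hc.le).trans hK₁.le)
        exact (zpow_lt_zpow_iff_right₀ one_lt_two).1 this
      have hk4 : -(K₂ : ℤ) < k + 1 := by
        have : (2 : ℝ) ^ (-(K₂ : ℤ)) < 2 ^ (k + 1) := by
          refine lt_of_lt_of_le ?_ hk2
          rw [zpow_neg, zpow_natCast, inv_lt_comm₀ (by positivity) (by positivity), inv_div]
          refine lt_of_le_of_lt ?_ hK₂
          gcongr
        exact (zpow_lt_zpow_iff_right₀ one_lt_two).1 this
      -- For `a = c 2^{k-1}` one has `2a < √u ≤ 4a`. The ramp at level `a` is then at least `1/2`,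
      -- and the single summand `8a · 1/2` dominates `√u`; this is the origin of the constant `8`.
      refine le_trans ?_ (Finset.single_le_sum hpos (a := k - 1)
        (Finset.mem_Icc.2 ⟨by omega, by omega⟩))
      have hkk : (2 : ℝ) ^ k = 2 * 2 ^ (k - 1) := by
        rw [← zpow_one_add₀ two_ne_zero]; congr 1; ring
      have hkk' : (2 : ℝ) ^ (k + 1) = 4 * 2 ^ (k - 1) := by
        rw [zpow_add_one₀ two_ne_zero, hkk]; ring
      rw [lt_div_iff₀ hc, hkk] at hk1
      rw [div_le_iff₀ hc, hkk'] at hk2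
      set a := c * (2 : ℝ) ^ (k - 1) with ha
      have ha0 : 0 < a := by positivity
      have hsq : √u ^ 2 = u := Real.sq_sqrt (Real.sqrt_pos.1 hu2).le
      have h5 : 1 / 2 ≤ rampFn (1 / a ^ 2 * max (u - a ^ 2) 0) := by
        refine half_le_rampFn ?_
        rw [one_div, ← div_eq_inv_mul, le_div_iff₀ (by positivity), one_mul]
        exact le_trans (by nlinarith) (le_max_left _ _)
      nlinarith
    refine (τ.val_mono (hmem n) (cfc_mem hN _) (cfc_nonneg fun u _ => le_max_right _ _) h1).trans ?_
    rw [← τ.sum_val_cfc _ _ _ (fun k => by positivity) (fun k => by fun_prop)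
      (fun k u => rampFn_nonneg _) hN]
    calc _ ≤ ∑ k ∈ Finset.Icc (-(K₂ : ℤ) - 2) K₁, ENNReal.ofReal (8 * c) *
          (2 ^ k * τ.distrib (c * (2 : ℝ) ^ ((k : ℝ) * 1)) T) := by
          refine Finset.sum_le_sum fun k _ => ?_
          rw [ENNReal.ofReal_mul (by positivity), ofReal_two_zpow, mul_assoc, mul_one,
            Real.rpow_intCast, ← cfc_rampFn_smul_pos _ _ hsa]
          gcongr
          exact τ.val_rampFn_le_rank (cfc_mem hN _) (cfc_pos_nonneg _ _) (by positivity)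
      _ ≤ ENNReal.ofReal (8 * c) * 1 := by
          rw [← Finset.mul_sum]
          gcongr
          exact (ENNReal.sum_le_tsum _).trans h.2.2
      _ = _ := mul_one _
  · rw [abs_eq_cfc, tendsto_iff_norm_sub_tendsto_zero]
    refine squeeze_zero (fun n => norm_nonneg _) (fun n => ?_) tendsto_one_div_add_atTop_nhds_zero_nat
    rw [← cfc_sub (fun u => max (√u - 1 / ((n : ℝ) + 1)) 0) Real.sqrt (star T * T)]
    refine norm_cfc_le (by positivity) fun u _ => ?_
    have h1 := Real.sqrt_nonneg u
    have h2 : 0 < 1 / ((n : ℝ) + 1) := by positivity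
    rw [Real.norm_eq_abs, abs_le]
    constructor
    · linarith [le_max_left (√u - 1 / ((n : ℝ) + 1)) 0]
    · rcases max_cases (√u - 1 / ((n : ℝ) + 1)) 0 with h3 | h3 <;> linarith

end FSNTrace

end BreuerFredholm

namespace BreuerFredholm

variable {H : Type*} [NormedAddCommGroup H] [InnerProductSpace ℂ H] [CompleteSpace H]

namespace FSNTrace

variable {N : VonNeumannAlgebra H} (τ : FSNTrace N)

/-! ### The trace on trace class operators -/

theorem posPart_mem {x : H →L[ℂ] H} (hx : x ∈ N) : x⁺ ∈ N := by
  rw [CFC.posPart_def, cfcₙ_eq_cfc]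
  exact cfc_mem hx _

theorem negPart_mem {x : H →L[ℂ] H} (hx : x ∈ N) : x⁻ ∈ N := by
  rw [CFC.negPart_def, cfcₙ_eq_cfc]
  exact cfc_mem hx _

theorem val_posPart_le {x : H →L[ℂ] H} (hs : IsSelfAdjoint x) {c : ℝ} (h : τ.HasSize 1 c x) :
    τ.val x⁺ ≤ ENNReal.ofReal (8 * c) ∧ τ.val x⁻ ≤ ENNReal.ofReal (8 * c) := by
  have h1 := τ.val_le_of_hasSize h
  have h2 := CFC.posPart_add_negPart x hs
  have hp := CFC.posPart_nonneg x
  have hn := CFC.negPart_nonneg x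
  refine ⟨(τ.val_mono (posPart_mem h.mem) (abs_mem h.mem) hp ?_).trans h1,
    (τ.val_mono (negPart_mem h.mem) (abs_mem h.mem) hn ?_).trans h1⟩
  · rw [← h2]; exact le_add_of_nonneg_right hn
  · rw [← h2]; exact le_add_of_nonneg_left hp

/-- `x⁺ + b = a + x⁻` is an identity between positive operators of finite trace, so any
decomposition gives the same value. Additivity on self-adjoint operators follows. -/
theorem onSelfAdjoint_eq {x a b : H →L[ℂ] H} (hs : IsSelfAdjoint x) (hx : x ∈ N) (ha : a ∈ N)
    (hb : b ∈ N) (ha0 : 0 ≤ a) (hb0 : 0 ≤ b) (hp : τ.val x⁺ ≠ ∞) (hn : τ.val x⁻ ≠ ∞)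
    (ha' : τ.val a ≠ ∞) (hb' : τ.val b ≠ ∞) (h : x = a - b) :
    τ.onSelfAdjoint x = (τ.val a).toReal - (τ.val b).toReal := by
  have h1 : x⁺ + b = a + x⁻ := by
    have := CFC.posPart_sub_negPart x hs
    rw [h] at this ⊢
    rw [← sub_eq_sub_iff_add_eq_add, this]
  have h2 := congrArg τ.val h1
  rw [τ.val_add _ (posPart_mem hx) _ hb (CFC.posPart_nonneg x) hb0,
    τ.val_add _ ha _ (negPart_mem hx) ha0 (CFC.negPart_nonneg x)] at h2
  have h3 := congrArg ENNReal.toReal h2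
  rw [ENNReal.toReal_add hp hb', ENNReal.toReal_add ha' hn] at h3
  rw [onSelfAdjoint]
  linarith

/-- The trace class operators of `N`. -/
def traceClass : Submodule ℂ (H →L[ℂ] H) where
  carrier := {T | ∃ c, τ.HasSize 1 c T}
  zero_mem' := ⟨1, HasSize.zero 1 one_pos⟩
  add_mem' := fun ⟨_, hc⟩ ⟨_, hd⟩ => ⟨_, hc.add hd⟩
  smul_mem' := fun z _ ⟨_, hc⟩ =>
    ⟨_, hc.smul (z := z) (r := ‖z‖ + 1) (by positivity) (by linarith)⟩

variable {τ}

theorem HasSize.mem_traceClass {c : ℝ} {T : H →L[ℂ] H} (h : τ.HasSize 1 c T) :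
    T ∈ τ.traceClass := ⟨c, h⟩

theorem HasSize.realPart {c : ℝ} {T : H →L[ℂ] H} (h : τ.HasSize 1 c T) :
    τ.HasSize 1 (48 * c) (ℜ T : H →L[ℂ] H) := by
  rw [realPart_apply_coe]
  -- At exponent `1` a sum and a scalar multiple cost a factor `4` each, and the adjoint a factor
  -- `2`: `4 · 4 · (c + 2c) = 48 c`.
  have h1 := (h.add h.star).smul (z := ((2⁻¹ : ℝ) : ℂ)) one_pos (by norm_num)
  rw [Complex.coe_smul] at h1
  refine h1.mono (le_of_eq ?_)
  norm_num
  ring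

theorem imaginaryPart_eq (T : H →L[ℂ] H) : ℑ T = ℜ ((-Complex.I) • T) := by
  rw [neg_smul, map_neg, realPart_I_smul, neg_neg]

theorem HasSize.imaginaryPart {c : ℝ} {T : H →L[ℂ] H} (h : τ.HasSize 1 c T) :
    τ.HasSize 1 (192 * c) (ℑ T : H →L[ℂ] H) := by
  rw [imaginaryPart_eq]
  have h1 := (h.smul (z := -Complex.I) one_pos (by simp)).realPart
  refine h1.mono (le_of_eq ?_)
  norm_num
  ring

theorem val_ne_top {x : H →L[ℂ] H} (hs : IsSelfAdjoint x) {c : ℝ} (h : τ.HasSize 1 c x) :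
    τ.val x⁺ ≠ ∞ ∧ τ.val x⁻ ≠ ∞ :=
  ⟨ne_top_of_le_ne_top ENNReal.ofReal_ne_top (τ.val_posPart_le hs h).1,
    ne_top_of_le_ne_top ENNReal.ofReal_ne_top (τ.val_posPart_le hs h).2⟩

theorem onSelfAdjoint_add {x y : H →L[ℂ] H} (hxs : IsSelfAdjoint x) (hys : IsSelfAdjoint y)
    {c d : ℝ} (hx : τ.HasSize 1 c x) (hy : τ.HasSize 1 d y) :
    τ.onSelfAdjoint (x + y) = τ.onSelfAdjoint x + τ.onSelfAdjoint y := by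
  have h1 := val_ne_top hxs hx
  have h2 := val_ne_top hys hy
  have h3 := val_ne_top (hxs.add hys) (hx.add hy)
  have h4 := τ.val_add _ (posPart_mem hx.mem) _ (posPart_mem hy.mem) (CFC.posPart_nonneg x)
    (CFC.posPart_nonneg y)
  have h5 := τ.val_add _ (negPart_mem hx.mem) _ (negPart_mem hy.mem) (CFC.negPart_nonneg x)
    (CFC.negPart_nonneg y)
  rw [τ.onSelfAdjoint_eq (hxs.add hys) (add_mem hx.mem hy.mem)
    (add_mem (posPart_mem hx.mem) (posPart_mem hy.mem))
    (add_mem (negPart_mem hx.mem) (negPart_mem hy.mem))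
    (add_nonneg (CFC.posPart_nonneg x) (CFC.posPart_nonneg y))
    (add_nonneg (CFC.negPart_nonneg x) (CFC.negPart_nonneg y)) h3.1 h3.2
    (by rw [h4]; exact ENNReal.add_ne_top.2 ⟨h1.1, h2.1⟩)
    (by rw [h5]; exact ENNReal.add_ne_top.2 ⟨h1.2, h2.2⟩), h4, h5,
    ENNReal.toReal_add h1.1 h2.1, ENNReal.toReal_add h1.2 h2.2, onSelfAdjoint, onSelfAdjoint]
  · ring
  · conv_lhs => rw [← CFC.posPart_sub_negPart x hxs, ← CFC.posPart_sub_negPart y hys]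
    abel

theorem onSelfAdjoint_neg (x : H →L[ℂ] H) : τ.onSelfAdjoint (-x) = -τ.onSelfAdjoint x := by
  simp [onSelfAdjoint]

theorem onSelfAdjoint_smul {x : H →L[ℂ] H} (hx : x ∈ N) (r : ℝ) :
    τ.onSelfAdjoint (r • x) = r * τ.onSelfAdjoint x := by
  have key : ∀ r : ℝ, 0 ≤ r → τ.onSelfAdjoint (r • x) = r * τ.onSelfAdjoint x := by
    intro r hr
    rw [onSelfAdjoint, onSelfAdjoint, CFC.posPart_smul_of_nonneg hr,
      CFC.negPart_smul_of_nonneg hr,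
      τ.val_smul _ (posPart_mem hx) (CFC.posPart_nonneg x) r hr,
      τ.val_smul _ (negPart_mem hx) (CFC.negPart_nonneg x) r hr, ENNReal.toReal_mul,
      ENNReal.toReal_mul, ENNReal.toReal_ofReal hr]
    ring
  rcases le_total 0 r with hr | hr
  · exact key r hr
  · have := key (-r) (neg_nonneg.2 hr)
    rw [neg_smul, onSelfAdjoint_neg] at this
    linarith

theorem onTraceClass_add {S T : H →L[ℂ] H} (hS : S ∈ τ.traceClass) (hT : T ∈ τ.traceClass) :
    τ.onTraceClass (S + T) = τ.onTraceClass S + τ.onTraceClass T := by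
  obtain ⟨c, hS⟩ := hS
  obtain ⟨d, hT⟩ := hT
  simp only [onTraceClass, map_add, AddSubgroup.coe_add]
  rw [onSelfAdjoint_add (ℜ S).2 (ℜ T).2 hS.realPart hT.realPart,
    onSelfAdjoint_add (ℑ S).2 (ℑ T).2 hS.imaginaryPart hT.imaginaryPart]
  push_cast
  ring

theorem onTraceClass_real_smul {T : H →L[ℂ] H} (hT : T ∈ τ.traceClass) (r : ℝ) :
    τ.onTraceClass (r • T) = r * τ.onTraceClass T := by
  obtain ⟨d, hT⟩ := hT
  simp only [onTraceClass, map_smul, selfAdjoint.val_smul]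
  rw [onSelfAdjoint_smul hT.realPart.mem, onSelfAdjoint_smul hT.imaginaryPart.mem]
  push_cast
  ring

theorem onTraceClass_I_smul (T : H →L[ℂ] H) :
    τ.onTraceClass (Complex.I • T) = Complex.I * τ.onTraceClass T := by
  simp only [onTraceClass, realPart_I_smul, imaginaryPart_I_smul, AddSubgroup.coe_neg,
    onSelfAdjoint_neg]
  push_cast
  linear_combination (-(τ.onSelfAdjoint (ℑ T : H →L[ℂ] H) : ℂ)) * Complex.I_mul_I

theorem onTraceClass_smul {T : H →L[ℂ] H} (hT : T ∈ τ.traceClass) (z : ℂ) :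
    τ.onTraceClass (z • T) = z * τ.onTraceClass T := by
  have h : z • T = z.re • T + z.im • (Complex.I • T) := by
    conv_lhs => rw [← Complex.re_add_im z]
    rw [add_smul, mul_smul, Complex.coe_smul, Complex.coe_smul]
  have hI := τ.traceClass.smul_mem Complex.I hT
  rw [h, onTraceClass_add (by simpa using τ.traceClass.smul_mem (z.re : ℂ) hT)
    (by simpa using τ.traceClass.smul_mem (z.im : ℂ) hI), onTraceClass_real_smul hT,
    onTraceClass_real_smul hI, onTraceClass_I_smul]
  conv_rhs => rw [← Complex.re_add_im z]
  ring

variable (τ) in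
/-- The trace as a linear functional on the trace class operators. -/
noncomputable def trace : τ.traceClass →ₗ[ℂ] ℂ where
  toFun T := τ.onTraceClass T
  map_add' S T := onTraceClass_add S.2 T.2
  map_smul' z T := onTraceClass_smul T.2 z

theorem onTraceClass_neg {T : H →L[ℂ] H} (hT : T ∈ τ.traceClass) :
    τ.onTraceClass (-T) = -τ.onTraceClass T := by
  have := onTraceClass_smul hT (-1)
  rwa [neg_one_smul, neg_one_mul] at this

theorem onTraceClass_sub {S T : H →L[ℂ] H} (hS : S ∈ τ.traceClass) (hT : T ∈ τ.traceClass) :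
    τ.onTraceClass (S - T) = τ.onTraceClass S - τ.onTraceClass T := by
  rw [sub_eq_add_neg, onTraceClass_add hS (τ.traceClass.neg_mem hT), onTraceClass_neg hT,
    sub_eq_add_neg]

theorem onTraceClass_zero : τ.onTraceClass 0 = 0 := by
  simpa using onTraceClass_smul (zero_mem τ.traceClass) 0

theorem onTraceClass_sum {ι : Type*} (s : Finset ι) (T : ι → H →L[ℂ] H)
    (hT : ∀ i, T i ∈ τ.traceClass) :
    τ.onTraceClass (∑ i ∈ s, T i) = ∑ i ∈ s, τ.onTraceClass (T i) := by
  classical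
  induction s using Finset.induction_on with
  | empty => simp [onTraceClass_zero]
  | insert i s hi ih =>
    rw [Finset.sum_insert hi, Finset.sum_insert hi,
      onTraceClass_add (hT i) (Submodule.sum_mem _ fun i _ => hT i), ih]

theorem abs_onSelfAdjoint_le {x : H →L[ℂ] H} (hs : IsSelfAdjoint x) {c : ℝ}
    (h : τ.HasSize 1 c x) : |τ.onSelfAdjoint x| ≤ 8 * c := by
  have h1 := τ.val_posPart_le hs h
  have hc := h.pos
  rw [onSelfAdjoint, abs_le]
  have h2 := ENNReal.toReal_le_of_le_ofReal (by positivity) h1.1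
  have h3 := ENNReal.toReal_le_of_le_ofReal (by positivity) h1.2
  have h4 : 0 ≤ (τ.val x⁺).toReal := ENNReal.toReal_nonneg
  have h5 : 0 ≤ (τ.val x⁻).toReal := ENNReal.toReal_nonneg
  constructor <;> linarith

theorem norm_onTraceClass_le {T : H →L[ℂ] H} {c : ℝ} (h : τ.HasSize 1 c T) :
    ‖τ.onTraceClass T‖ ≤ 2000 * c := by
  have h1 := abs_onSelfAdjoint_le (ℜ T).2 h.realPart
  have h2 := abs_onSelfAdjoint_le (ℑ T).2 h.imaginaryPart
  have hc := h.pos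
  refine (norm_add_le _ _).trans ?_
  rw [norm_mul, Complex.norm_I, one_mul, Complex.norm_real, Complex.norm_real, Real.norm_eq_abs,
    Real.norm_eq_abs]
  -- `8 · 48 + 8 · 192 = 1920`.
  linarith

theorem isSummable_of_mem_traceClass {T : H →L[ℂ] H} (h : T ∈ τ.traceClass) :
    τ.IsSummable 1 T := by
  obtain ⟨c, h⟩ := h
  refine ⟨h.mem, ?_⟩
  rw [CFC.rpow_one _ (CFC.abs_nonneg T)]
  exact (τ.val_le_of_hasSize h).trans_lt ENNReal.ofReal_lt_top

theorem IsSummable.exists_hasSize {p : ℝ} (hp : 0 < p) {T : H →L[ℂ] H} (h : τ.IsSummable p T) :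
    ∃ c, τ.HasSize (1 / p) c T :=
  ⟨_, HasSize.of_val_le τ hp (K := (τ.val (CFC.abs T ^ p)).toReal + 1) (by positivity) h.1 <| by
    rw [← ENNReal.ofReal_toReal h.2.ne]
    exact ENNReal.ofReal_le_ofReal (by simp)⟩

theorem mem_traceClass_of_nonneg {x : H →L[ℂ] H} (hx : x ∈ N) (h0 : 0 ≤ x) (h : τ.val x ≠ ∞) :
    x ∈ τ.traceClass := by
  have h1 : τ.IsSummable 1 x := by
    refine ⟨hx, ?_⟩
    rw [CFC.rpow_one _ (CFC.abs_nonneg x), CFC.abs_of_nonneg x h0]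
    exact h.lt_top
  obtain ⟨c, hc⟩ := h1.exists_hasSize one_pos
  rw [div_one] at hc
  exact ⟨c, hc⟩

theorem onTraceClass_of_nonneg {x : H →L[ℂ] H} (h0 : 0 ≤ x) :
    τ.onTraceClass x = ((τ.val x).toReal : ℂ) := by
  have hs : IsSelfAdjoint x := .of_nonneg h0
  have h1 : (ℜ x : H →L[ℂ] H) = x := hs.coe_realPart
  have h2 : ℑ x = 0 := hs.imaginaryPart
  have h3 : x⁺ = x := (CFC.posPart_eq_self x).2 h0
  have h4 : x⁻ = 0 := (CFC.negPart_eq_zero_iff x hs).2 h0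
  simp [onTraceClass, h1, h2, onSelfAdjoint, h3, h4, τ.val_zero]

theorem val_star_mul_self_add_ne_top {a b : H →L[ℂ] H} (ha : a ∈ N) (hb : b ∈ N)
    (ha' : τ.val (star a * a) ≠ ∞) (hb' : τ.val (star b * b) ≠ ∞) :
    τ.val (star (a + b) * (a + b)) ≠ ∞ := by
  have h1 := mul_mem (star_mem ha) ha
  have h2 := mul_mem (star_mem hb) hb
  have h0 : (0 : ℝ) ≤ 2 := by norm_num
  refine ne_top_of_le_ne_top ?_ (τ.val_mono (mul_mem (star_mem (add_mem ha hb)) (add_mem ha hb))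
    (add_mem (real_smul_mem h1 2) (real_smul_mem h2 2)) (star_mul_self_nonneg _)
    (star_add_mul_add_le a b))
  rw [τ.val_add _ (real_smul_mem h1 2) _ (real_smul_mem h2 2)
    (smul_nonneg h0 (star_mul_self_nonneg _)) (smul_nonneg h0 (star_mul_self_nonneg _)),
    τ.val_smul _ h1 (star_mul_self_nonneg _) 2 h0, τ.val_smul _ h2 (star_mul_self_nonneg _) 2 h0]
  exact ENNReal.add_ne_top.2 ⟨ENNReal.mul_ne_top ENNReal.ofReal_ne_top ha',
    ENNReal.mul_ne_top ENNReal.ofReal_ne_top hb'⟩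

theorem onTraceClass_star_mul_self {y : H →L[ℂ] H} (hy : y ∈ N) :
    τ.onTraceClass (star y * y) = τ.onTraceClass (y * star y) := by
  rw [onTraceClass_of_nonneg (star_mul_self_nonneg y),
    onTraceClass_of_nonneg (mul_star_self_nonneg y), τ.tracial y hy]

/-- The trace property for Hilbert-Schmidt operators, by polarization. -/
theorem onTraceClass_star_mul {a b : H →L[ℂ] H} (ha : a ∈ N) (hb : b ∈ N)
    (ha' : τ.val (star a * a) ≠ ∞) (hb' : τ.val (star b * b) ≠ ∞) :
    τ.onTraceClass (star a * b) = τ.onTraceClass (b * star a) := by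
  have hz : ∀ z : ℂ, τ.val (star (z • b) * (z • b)) ≠ ∞ := by
    intro z
    have : star (z • b) * (z • b) = (‖z‖ ^ 2) • (star b * b) := by
      rw [star_smul, smul_mul_smul_comm, ← Complex.coe_smul, ← Complex.normSq_eq_norm_sq,
        Complex.normSq_eq_conj_mul_self]
      rfl
    rw [this, τ.val_smul _ (mul_mem (star_mem hb) hb) (star_mul_self_nonneg _) _ (by positivity)]
    exact ENNReal.mul_ne_top ENNReal.ofReal_ne_top hb'
  have hy : ∀ z : ℂ, a + z • b ∈ N := fun z => add_mem ha (complex_smul_mem hb z)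
  have h1 : ∀ z : ℂ, star (a + z • b) * (a + z • b) ∈ τ.traceClass := fun z =>
    mem_traceClass_of_nonneg (mul_mem (star_mem (hy z)) (hy z)) (star_mul_self_nonneg _)
      (val_star_mul_self_add_ne_top ha (complex_smul_mem hb z) ha' (hz z))
  have h2 : ∀ z : ℂ, (a + z • b) * star (a + z • b) ∈ τ.traceClass := fun z =>
    mem_traceClass_of_nonneg (mul_mem (hy z) (star_mem (hy z))) (mul_star_self_nonneg _)
      (by rw [← τ.tracial _ (hy z)]
          exact val_star_mul_self_add_ne_top ha (complex_smul_mem hb z) ha' (hz z))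
  have h3 : star a * b = (4⁻¹ : ℂ) • (star (a + (1 : ℂ) • b) * (a + (1 : ℂ) • b) -
      star (a + (-1 : ℂ) • b) * (a + (-1 : ℂ) • b) -
      Complex.I • (star (a + Complex.I • b) * (a + Complex.I • b)) +
      Complex.I • (star (a + (-Complex.I) • b) * (a + (-Complex.I) • b))) := by
    simp only [star_add, star_smul, add_mul, mul_add, smul_mul_assoc, mul_smul_comm, star_one,
      star_neg, Complex.star_def, Complex.conj_I]
    match_scalars <;> ring_nf <;> simp [Complex.I_sq] <;> norm_num
  have h4 : b * star a = (4⁻¹ : ℂ) • ((a + (1 : ℂ) • b) * star (a + (1 : ℂ) • b) -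
      (a + (-1 : ℂ) • b) * star (a + (-1 : ℂ) • b) -
      Complex.I • ((a + Complex.I • b) * star (a + Complex.I • b)) +
      Complex.I • ((a + (-Complex.I) • b) * star (a + (-Complex.I) • b))) := by
    simp only [star_add, star_smul, add_mul, mul_add, smul_mul_assoc, mul_smul_comm, star_one,
      star_neg, Complex.star_def, Complex.conj_I]
    match_scalars <;> ring_nf <;> simp [Complex.I_sq] <;> norm_num
  have key : ∀ {x y z w : H →L[ℂ] H}, x ∈ τ.traceClass → y ∈ τ.traceClass → z ∈ τ.traceClass →
      w ∈ τ.traceClass → τ.onTraceClass ((4⁻¹ : ℂ) • (x - y - Complex.I • z + Complex.I • w)) =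
      4⁻¹ * (τ.onTraceClass x - τ.onTraceClass y - Complex.I * τ.onTraceClass z +
        Complex.I * τ.onTraceClass w) := by
    intro x y z w hx hy hz hw
    have hz' := τ.traceClass.smul_mem Complex.I hz
    have hw' := τ.traceClass.smul_mem Complex.I hw
    have hxy := τ.traceClass.sub_mem hx hy
    rw [onTraceClass_smul (τ.traceClass.add_mem (τ.traceClass.sub_mem hxy hz') hw'),
      onTraceClass_add (τ.traceClass.sub_mem hxy hz') hw', onTraceClass_sub hxy hz',
      onTraceClass_sub hx hy, onTraceClass_I_smul, onTraceClass_I_smul]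
  rw [h3, h4, key (h1 _) (h1 _) (h1 _) (h1 _), key (h2 _) (h2 _) (h2 _) (h2 _),
    onTraceClass_star_mul_self (hy _), onTraceClass_star_mul_self (hy _),
    onTraceClass_star_mul_self (hy _), onTraceClass_star_mul_self (hy _)]

/-- Hilbert–Schmidt operators form a right ideal: by the trace property it suffices to bound `s T T⋆
s⋆` by `‖T T⋆‖ s s⋆`. -/
theorem val_conj_ne_top {s T : H →L[ℂ] H} (hs : s ∈ N) (hT : T ∈ N)
    (h : τ.val (star s * s) ≠ ∞) : τ.val (star (s * T) * (s * T)) ≠ ∞ := by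
  have h0 := τ.tracial s hs
  have hsN := star_mem hs
  have h1 : s * T * star (s * T) ≤ ‖T * star T‖ • (s * star s) := by
    have := CStarAlgebra.star_right_conjugate_le_norm_smul (a := s) (b := T * star T)
      (IsSelfAdjoint.mul_star_self T)
    simpa only [star_mul, mul_assoc] using this
  rw [τ.tracial _ (mul_mem hs hT)]
  refine ne_top_of_le_ne_top ?_ (τ.val_mono (mul_mem (mul_mem hs hT) (star_mem (mul_mem hs hT)))
    (real_smul_mem (mul_mem hs hsN) _) (mul_star_self_nonneg _) h1)
  rw [τ.val_smul _ (mul_mem hs hsN) (mul_star_self_nonneg _) _ (norm_nonneg _), ← h0]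
  exact ENNReal.mul_ne_top ENNReal.ofReal_ne_top h

theorem HasSize.mul_bounded {e c : ℝ} {S T : H →L[ℂ] H} (hS : τ.HasSize e c S) (hT : T ∈ N) :
    ∃ d, τ.HasSize e d (S * T) := by
  have := hS.mul (HasSize.of_norm_le (τ := τ) hT (c := ‖T‖ + 1) (by positivity) (by simp))
  rw [add_zero] at this
  exact ⟨_, this⟩

theorem HasSize.bounded_mul {e c : ℝ} {S T : H →L[ℂ] H} (hS : τ.HasSize e c S) (hT : T ∈ N) :
    ∃ d, τ.HasSize e d (T * S) := by
  have := (HasSize.of_norm_le (τ := τ) hT (c := ‖T‖ + 1) (by positivity) (by simp)).mul hS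
  rw [zero_add] at this
  exact ⟨_, this⟩

theorem mul_mem_traceClass {S T : H →L[ℂ] H} (hS : S ∈ τ.traceClass) (hT : T ∈ N) :
    S * T ∈ τ.traceClass := hS.elim fun _ h => h.mul_bounded hT

theorem mul_mem_traceClass' {S T : H →L[ℂ] H} (hS : S ∈ τ.traceClass) (hT : T ∈ N) :
    T * S ∈ τ.traceClass := hS.elim fun _ h => h.bounded_mul hT

/-- With `s = √x`, a Hilbert–Schmidt operator, both sides equal `τ(s T s)`. -/
theorem onTraceClass_mul_comm_of_nonneg {x T : H →L[ℂ] H} (hx : x ∈ N) (h0 : 0 ≤ x)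
    (h : τ.val x ≠ ∞) (hT : T ∈ N) : τ.onTraceClass (x * T) = τ.onTraceClass (T * x) := by
  obtain ⟨s, hs, hs0, hss, -⟩ := τ.val_star_mul_mul (one_mem N) hx h0
  have hsa : star s = s := (IsSelfAdjoint.of_nonneg hs0).star_eq
  have hs1 : τ.val (star s * s) ≠ ∞ := by rwa [hsa, hss]
  have h1 := onTraceClass_star_mul hs (mul_mem hs hT) hs1 (val_conj_ne_top hs hT hs1)
  have h2 := onTraceClass_star_mul (mul_mem hs (star_mem hT)) hs
    (val_conj_ne_top hs (star_mem hT) hs1) hs1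
  simp only [hsa, star_mul, star_star] at h1 h2
  rw [← hss, mul_assoc, h1, mul_assoc, ← h2, mul_assoc]

theorem onTraceClass_mul_comm_of_isSelfAdjoint {x T : H →L[ℂ] H} (hx : x ∈ τ.traceClass)
    (hxs : IsSelfAdjoint x) (hT : T ∈ N) :
    τ.onTraceClass (x * T) = τ.onTraceClass (T * x) := by
  obtain ⟨c, h⟩ := hx
  have h1 := val_ne_top hxs h
  have hp := mem_traceClass_of_nonneg (posPart_mem h.mem) (CFC.posPart_nonneg x) h1.1
  have hn := mem_traceClass_of_nonneg (negPart_mem h.mem) (CFC.negPart_nonneg x) h1.2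
  rw [← CFC.posPart_sub_negPart x hxs, sub_mul, mul_sub,
    onTraceClass_sub (mul_mem_traceClass hp hT) (mul_mem_traceClass hn hT),
    onTraceClass_sub (mul_mem_traceClass' hp hT) (mul_mem_traceClass' hn hT),
    onTraceClass_mul_comm_of_nonneg (posPart_mem h.mem) (CFC.posPart_nonneg x) h1.1 hT,
    onTraceClass_mul_comm_of_nonneg (negPart_mem h.mem) (CFC.negPart_nonneg x) h1.2 hT]

theorem onTraceClass_mul_comm {S T : H →L[ℂ] H} (hS : S ∈ τ.traceClass) (hT : T ∈ N) :
    τ.onTraceClass (S * T) = τ.onTraceClass (T * S) := by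
  obtain ⟨c, h⟩ := hS
  have hr := h.realPart.mem_traceClass
  have hi := h.imaginaryPart.mem_traceClass
  rw [← realPart_add_I_smul_imaginaryPart S, add_mul, mul_add, smul_mul_assoc, mul_smul_comm,
    onTraceClass_add (mul_mem_traceClass hr hT)
      (τ.traceClass.smul_mem _ (mul_mem_traceClass hi hT)),
    onTraceClass_add (mul_mem_traceClass' hr hT)
      (τ.traceClass.smul_mem _ (mul_mem_traceClass' hi hT)),
    onTraceClass_smul (mul_mem_traceClass hi hT), onTraceClass_smul (mul_mem_traceClass' hi hT),
    onTraceClass_mul_comm_of_isSelfAdjoint hr (ℜ S).2 hT,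
    onTraceClass_mul_comm_of_isSelfAdjoint hi (ℑ S).2 hT]

/-! ### The trace property for products of summable operators -/

/-- For `e > 0` the levels tend to `0` as `k → -∞`, and a single summand of the gauge already bounds
the distribution function at its level. -/
theorem HasSize.distrib_ne_top {e c l : ℝ} (he : 0 < e) {T : H →L[ℂ] H} (h : τ.HasSize e c T)
    (hl : 0 < l) : τ.distrib l T ≠ ∞ := by
  have hc := h.pos
  have h1 : Tendsto (fun n : ℕ => c * (2 : ℝ) ^ (((-n : ℤ) : ℝ) * e)) atTop (𝓝 0) := by
    have h2 : ∀ n : ℕ, (2 : ℝ) ^ (((-n : ℤ) : ℝ) * e) = ((2 : ℝ) ^ (-e)) ^ n := by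
      intro n
      rw [← Real.rpow_natCast, ← Real.rpow_mul two_pos.le]
      push_cast
      ring_nf
    simp only [h2]
    simpa using (tendsto_pow_atTop_nhds_zero_of_lt_one (by positivity)
      (Real.rpow_lt_one_of_one_lt_of_neg one_lt_two (neg_lt_zero.2 he))).const_mul c
  obtain ⟨n, hn⟩ := (h1.eventually_le_const hl).exists
  refine ne_top_of_le_ne_top ?_ (τ.distrib_anti h.mem (by positivity) hn)
  have h2 : (2 : ℝ≥0∞) ^ (-n : ℤ) * τ.distrib (c * (2 : ℝ) ^ (((-n : ℤ) : ℝ) * e)) T ≠ ∞ :=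
    ne_top_of_le_ne_top ENNReal.one_ne_top ((ENNReal.le_tsum (f := fun k : ℤ =>
      (2 : ℝ≥0∞) ^ k * τ.distrib (c * (2 : ℝ) ^ ((k : ℝ) * e)) T) (-n : ℤ)).trans h.2.2)
  intro h3
  rw [h3, ENNReal.mul_top (ENNReal.zpow_pos two_ne_zero ENNReal.ofNat_ne_top _).ne'] at h2
  exact h2 rfl

theorem distrib_le_opRank {T : H →L[ℂ] H} (hT : T ∈ N) (l : ℝ) : τ.distrib l T ≤ τ.opRank T := by
  have hN := mul_mem (star_mem hT) hT
  refine τ.rank_mono (cfc_mem hN _) hN (cfc_pos_nonneg _ _) ?_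
  conv_rhs => rw [← cfc_id' ℝ (star T * T)]
  refine cfc_mono fun u hu => ?_
  have : 0 ≤ u := spectrum_nonneg_of_nonneg (star_mul_self_nonneg T) hu
  exact max_le (sub_le_self _ (sq_nonneg l)) this

/-- The distribution function is at most the rank and vanishes above `‖T‖`, so the dyadic sum is
dominated by a geometric series. -/
theorem mem_traceClass_of_opRank_ne_top {T : H →L[ℂ] H} (hT : T ∈ N) (h : τ.opRank T ≠ ∞) :
    T ∈ τ.traceClass := by
  set M := (τ.opRank T).toReal with hM
  have hM' : τ.opRank T = ENNReal.ofReal M := (ENNReal.ofReal_toReal h).symm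
  have hM0 : 0 ≤ M := ENNReal.toReal_nonneg
  have hc : 0 < 2 * ((‖T‖ + 1) * (M + 1)) := by positivity
  refine ⟨2 * ((‖T‖ + 1) * (M + 1)), hT, hc, ?_⟩
  set c := 2 * ((‖T‖ + 1) * (M + 1)) with hcdef
  rw [ENNReal.tsum_eq_iSup_sum]
  refine iSup_le fun s => ?_
  calc _ ≤ ∑ k ∈ s, if (2 : ℝ) ^ k ≤ (‖T‖ + 1) / c then ENNReal.ofReal (2 ^ k) * ENNReal.ofReal M
        else 0 := by
        refine Finset.sum_le_sum fun k _ => ?_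
        rw [mul_one, Real.rpow_intCast]
        split_ifs with hk
        · rw [ofReal_two_zpow, ← hM']
          gcongr
          exact distrib_le_opRank hT _
        · rw [τ.distrib_of_norm_le, mul_zero]
          rw [not_le, div_lt_iff₀' hc] at hk
          linarith
    _ ≤ ENNReal.ofReal (2 * ((‖T‖ + 1) / c)) * ENNReal.ofReal M := by
        rw [← Finset.sum_filter, ← Finset.sum_mul,
          ← ENNReal.ofReal_sum_of_nonneg fun _ _ => by positivity]
        gcongr
        exact sum_two_zpow_le _ (by positivity) fun k hk => (Finset.mem_filter.1 hk).2
    _ ≤ 1 := by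
        rw [← ENNReal.ofReal_mul (by positivity), ← ENNReal.ofReal_one]
        refine ENNReal.ofReal_le_ofReal ?_
        rw [hcdef, mul_div_assoc', div_mul_eq_mul_div, div_le_one (by positivity)]
        nlinarith [norm_nonneg T]

theorem norm_cfc_one_sub_truncFn_le {l : ℝ} (hl : 0 < l) (x : H →L[ℂ] H) :
    ‖cfc (fun u => 1 - truncFn l u) x‖ ≤ 1 := by
  refine norm_cfc_le zero_le_one fun u _ => ?_
  rw [Real.norm_of_nonneg (sub_nonneg.2 (truncFn_le_one hl u))]
  exact sub_le_self _ (truncFn_nonneg hl u)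

/-- The truncation of `T` has finite rank, so it is trace class and may be moved. The remainder has
norm at most `l` and stays bounded at exponent `g`; because `f < g`, interpolation makes it `O(l^{1
- f/g})` at exponent `f`, and by Hölder its contribution disappears as `l → 0`. -/
theorem onTraceClass_mul_comm_of_hasSize {e f g c d : ℝ} {S T : H →L[ℂ] H}
    (hS : τ.HasSize e c S) (hT : τ.HasSize g d T) (hf : 0 < f) (hfg : f < g) (hef : e + f = 1) :
    τ.onTraceClass (S * T) = τ.onTraceClass (T * S) := by
  have hg := hf.trans hfg
  have hc := hS.pos
  have hd := hT.pos
  set C := 2 ^ (1 + g + 0) * (d * 1) with hC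
  have hC0 : 0 < C := by positivity
  have hθ : 0 < 1 - f / g := sub_pos.2 ((div_lt_one hg).2 hfg)
  have key : ∀ l : ℝ, 0 < l → ‖τ.onTraceClass (S * T) - τ.onTraceClass (T * S)‖ ≤
      (2000 * (2 ^ (1 + e + f) * (c * C ^ (f / g))) +
        2000 * (2 ^ (1 + f + e) * (C ^ (f / g) * c))) * l ^ (1 - f / g) := by
    intro l hl
    have hR : truncation l T ∈ τ.traceClass :=
      mem_traceClass_of_opRank_ne_top (truncation_mem hT.mem l)
        (ne_top_of_le_ne_top (hT.distrib_ne_top hg hl) (τ.opRank_truncation_le hT.mem hl))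
    have hD : τ.HasSize g C (T - truncation l T) := by
      rw [truncation, sub_mul_cfc T (continuous_truncFn hl)]
      have := hT.mul (HasSize.of_norm_le (τ := τ)
        (cfc_mem (mul_mem (star_mem hT.mem) hT.mem) (fun u => 1 - truncFn l u)) one_pos
        (norm_cfc_one_sub_truncFn_le hl _))
      rwa [add_zero] at this
    have hD' := hD.interpolate hl (norm_sub_truncation_le hl T) hf hfg
    have h1 := hS.mul hD'
    have h2 := hD'.mul hS
    rw [hef] at h1
    rw [add_comm f e, hef] at h2
    have h3 := onTraceClass_mul_comm hR hS.mem
    have h4 : τ.onTraceClass (S * T) = τ.onTraceClass (S * truncation l T) +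
        τ.onTraceClass (S * (T - truncation l T)) := by
      rw [← onTraceClass_add (mul_mem_traceClass' hR hS.mem) h1.mem_traceClass]
      congr 1
      noncomm_ring
    have h5 : τ.onTraceClass (T * S) = τ.onTraceClass (truncation l T * S) +
        τ.onTraceClass ((T - truncation l T) * S) := by
      rw [← onTraceClass_add (mul_mem_traceClass hR hS.mem) h2.mem_traceClass]
      congr 1
      noncomm_ring
    rw [h4, h5, h3, add_sub_add_left_eq_sub]
    refine (norm_sub_le _ _).trans ((add_le_add (norm_onTraceClass_le h1)
      (norm_onTraceClass_le h2)).trans (le_of_eq ?_))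
    ring
  have hlim : Tendsto (fun l : ℝ => (2000 * (2 ^ (1 + e + f) * (c * C ^ (f / g))) +
        2000 * (2 ^ (1 + f + e) * (C ^ (f / g) * c))) * l ^ (1 - f / g)) (𝓝[>] 0) (𝓝 0) := by
    have h1 := (Real.continuousAt_rpow_const 0 (1 - f / g) (Or.inr hθ.le)).tendsto
    rw [Real.zero_rpow hθ.ne'] at h1
    simpa using (h1.mono_left nhdsWithin_le_nhds).const_mul
      (2000 * (2 ^ (1 + e + f) * (c * C ^ (f / g))) + 2000 * (2 ^ (1 + f + e) * (C ^ (f / g) * c)))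
  have h0 := ge_of_tendsto hlim (eventually_mem_nhdsWithin.mono key)
  exact sub_eq_zero.1 (norm_le_zero_iff.1 h0)

end FSNTrace

end BreuerFredholm

/-! ### The uniform boundedness principle -/

namespace BreuerFredholm

variable {H : Type*} [NormedAddCommGroup H] [InnerProductSpace ℂ H] [CompleteSpace H]

namespace FSNTrace

variable {N : VonNeumannAlgebra H} {τ : FSNTrace N}

/-- A uniform boundedness principle: a family of bounded operators that is pointwise bounded in
the gauge of exponent `e`, eventually along a filter, is so uniformly on the unit ball. -/
theorem exists_uniform_hasSize {E ι : Type*} [NormedAddCommGroup E] [NormedSpace ℂ E]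
    [CompleteSpace E] {l : Filter ι} [l.IsCountablyGenerated] (L : ι → E →L[ℂ] (H →L[ℂ] H)) {e : ℝ}
    (h : ∀ x, ∃ c, ∀ᶠ s in l, τ.HasSize e c (L s x)) :
    ∃ C, ∀ᶠ s in l, ∀ x, ‖x‖ ≤ 1 → τ.HasSize e C (L s x) := by
  obtain ⟨U, hU⟩ := l.exists_antitone_basis
  -- These sets are not claimed to be closed, the gauge being controlled under norm limits only up
  -- to a factor `4`. Baire's theorem is applied to their closures and the factor is paid in `hS`.
  let S : ℕ → Set E := fun n => {x | ∀ s ∈ U n, τ.HasSize e (n + 1) (L s x)}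
  have hcover : ⋃ n, closure (S n) = Set.univ := by
    refine Set.eq_univ_of_forall fun x => ?_
    obtain ⟨c, hc⟩ := h x
    obtain ⟨i, hi⟩ := hU.mem_iff.1 hc
    obtain ⟨j, hj⟩ := exists_nat_ge c
    refine Set.mem_iUnion.2 ⟨max i j, subset_closure fun s hs => ?_⟩
    refine HasSize.mono (hi (hU.antitone (le_max_left i j) hs)) (hj.trans ?_)
    push_cast
    exact (le_max_right _ _).trans (le_add_of_nonneg_right zero_le_one)
  obtain ⟨n, x₀, hx₀⟩ := nonempty_interior_of_iUnion_of_closed (fun n => isClosed_closure) hcover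
  obtain ⟨r, hr, hball⟩ := Metric.isOpen_iff.1 isOpen_interior x₀ hx₀
  have hS : ∀ x ∈ Metric.ball x₀ r, ∀ s ∈ U n, τ.HasSize e (4 * (n + 1)) (L s x) := by
    intro x hx s hs
    obtain ⟨u, hu, hux⟩ := mem_closure_iff_seq_limit.1 (interior_subset (hball hx))
    exact HasSize.of_tendsto (S := fun i => L s (u i)) (l := atTop)
      (Eventually.frequently (Eventually.of_forall fun i => hu i s hs))
      (((L s).continuous.tendsto x).comp hux)
  -- A vector of the unit ball is `2 / r` times the difference of two points of the ball around
  -- `x₀`; the constant collects the costs of `sub` and `smul`.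
  have hscale : ∀ s ∈ U n, ∀ x : E, ‖x‖ ≤ 1 → τ.HasSize e (2 ^ (1 + e) * (2 / r *
      (2 ^ (1 + e) * (4 * (n + 1) + 2 ^ (1 + e) * (4 * (n + 1)))))) (L s x) := ?_
  · exact ⟨_, mem_of_superset (hU.mem n) hscale⟩
  intro s hs x hx
  have h1 : x₀ + ((r / 2 : ℝ) : ℂ) • x ∈ Metric.ball x₀ r := by
    rw [mem_ball_iff_norm, add_sub_cancel_left, norm_smul, Complex.norm_real,
      Real.norm_of_nonneg (by positivity)]
    nlinarith
  have h2 := ((hS _ h1 s hs).sub (hS _ (Metric.mem_ball_self hr) s hs)).smul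
    (z := ((2 / r : ℝ) : ℂ)) (r := 2 / r) (by positivity)
    (by rw [Complex.norm_real, Real.norm_of_nonneg (by positivity)])
  have h3 : ((2 / r : ℝ) : ℂ) • (L s (x₀ + ((r / 2 : ℝ) : ℂ) • x) - L s x₀) = L s x := by
    rw [← map_sub, add_sub_cancel_left, map_smul, smul_smul, ← Complex.ofReal_mul,
      div_mul_div_cancel₀ hr.ne', div_self two_ne_zero, Complex.ofReal_one, one_smul]
  rw [h3] at h2
  exact h2

end FSNTrace

end BreuerFredholm

namespace BreuerFredholm

/-! ### Products of commutators -/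

section CommutatorAlgebra

variable {A R : Type*} [Ring R] [Algebra ℂ R]

/-- The product `[F,a₀] ⋯ [F,a_{n-1}]`. -/
def commProd (r : A → R) (F : R) : ∀ {n : ℕ}, (Fin n → A) → R
  | 0, _ => 1
  | _ + 1, a => ⁅F, r (a 0)⁆ * commProd r F (Fin.tail a)

/-- The sum `∑_k (-1)^{k+1} [F,a₀] ⋯ [F,a_k] D [F,a_{k+1}] ⋯ [F,a_{n-1}]`. -/
def contractionSum (r : A → R) (F D : R) : ∀ {n : ℕ}, (Fin n → A) → R
  | 0, _ => 0
  | _ + 1, a => -(⁅F, r (a 0)⁆ * (D * commProd r F (Fin.tail a) + contractionSum r F D (Fin.tail a)))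

/-- The sum `∑_k [F,a₀] ⋯ [D,a_k] ⋯ [F,a_{n-1}]`, the derivative of `commProd` in direction `D`. -/
def commProdDeriv (r : A → R) (F D : R) : ∀ {n : ℕ}, (Fin n → A) → R
  | 0, _ => 0
  | _ + 1, a => ⁅D, r (a 0)⁆ * commProd r F (Fin.tail a) +
      ⁅F, r (a 0)⁆ * commProdDeriv r F D (Fin.tail a)

variable (r : A → R) (F D : R)

omit [Algebra ℂ R] in
theorem commProd_zero (a : Fin 0 → A) : commProd r F a = 1 := rfl

omit [Algebra ℂ R] in
theorem commProd_succ {n : ℕ} (a : Fin (n + 1) → A) :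
    commProd r F a = ⁅F, r (a 0)⁆ * commProd r F (Fin.tail a) := rfl

omit [Algebra ℂ R] in
theorem contractionSum_zero (a : Fin 0 → A) : contractionSum r F D a = 0 := rfl

omit [Algebra ℂ R] in
theorem contractionSum_succ {n : ℕ} (a : Fin (n + 1) → A) : contractionSum r F D a =
    -(⁅F, r (a 0)⁆ * (D * commProd r F (Fin.tail a) + contractionSum r F D (Fin.tail a))) := rfl

omit [Algebra ℂ R] in
theorem commProdDeriv_zero (a : Fin 0 → A) : commProdDeriv r F D a = 0 := rfl

omit [Algebra ℂ R] in
theorem commProdDeriv_succ {n : ℕ} (a : Fin (n + 1) → A) : commProdDeriv r F D a =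
    ⁅D, r (a 0)⁆ * commProd r F (Fin.tail a) + ⁅F, r (a 0)⁆ * commProdDeriv r F D (Fin.tail a) :=
  rfl

omit [Algebra ℂ R] in
theorem prod_ofFn_commutator {n : ℕ} (a : Fin n → A) :
    (List.ofFn fun j => ⁅F, r (a j)⁆).prod = commProd r F a := by
  induction n with
  | zero => simp [commProd_zero]
  | succ n ih => rw [List.ofFn_succ, List.prod_cons, commProd_succ, ← ih]; rfl

theorem sum_prod_ofFn_contraction {n : ℕ} (a : Fin n → A) :
    ∑ k : Fin n, (-1 : ℂ) ^ ((k : ℕ) + 1) •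
      (List.ofFn fun j => if j = k then ⁅F, r (a j)⁆ * D else ⁅F, r (a j)⁆).prod =
      contractionSum r F D a := by
  induction n with
  | zero => simp [contractionSum_zero]
  | succ n ih =>
    have h0 : (List.ofFn fun j : Fin (n + 1) =>
        if j = 0 then ⁅F, r (a j)⁆ * D else ⁅F, r (a j)⁆).prod =
        ⁅F, r (a 0)⁆ * D * commProd r F (Fin.tail a) := by
      rw [List.ofFn_succ, List.prod_cons, ← prod_ofFn_commutator]
      simp [Fin.tail, Fin.succ_ne_zero]
    have h1 : ∀ k : Fin n, (List.ofFn fun j : Fin (n + 1) =>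
        if j = k.succ then ⁅F, r (a j)⁆ * D else ⁅F, r (a j)⁆).prod =
        ⁅F, r (a 0)⁆ * (List.ofFn fun j : Fin n =>
          if j = k then ⁅F, r (Fin.tail a j)⁆ * D else ⁅F, r (Fin.tail a j)⁆).prod := by
      intro k
      rw [List.ofFn_succ, List.prod_cons]
      simp [Fin.tail, (Fin.succ_ne_zero k).symm]
    rw [Fin.sum_univ_succ, h0, contractionSum_succ, ← ih]
    simp only [h1, Fin.val_succ, Fin.val_zero, zero_add, pow_succ, mul_neg, mul_one, neg_smul,
      pow_zero, one_smul, mul_add, Finset.mul_sum, mul_smul_comm, neg_neg, Finset.sum_neg_distrib,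
      mul_assoc, neg_add]

variable {r F D}

section Anticommute

variable (hF : F * F = 1) (hD : F * D = -(D * F))

include hF

omit [Algebra ℂ R] in
-- `F [F,x] + [F,x] F = [F²,x] = 0`.
theorem mul_commutator (x : R) : F * ⁅F, x⁆ = -(⁅F, x⁆ * F) := by
  simp only [Ring.lie_def, mul_sub, sub_mul]
  rw [← mul_assoc, hF, mul_assoc x F F, hF, mul_assoc]
  noncomm_ring

theorem mul_commProd {n : ℕ} (a : Fin n → A) :
    F * commProd r F a = (-1 : ℂ) ^ n • (commProd r F a * F) := by
  induction n with
  | zero => simp [commProd_zero]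
  | succ n ih =>
    rw [commProd_succ, ← mul_assoc, mul_commutator hF, neg_mul, mul_assoc, ih, mul_smul_comm,
      pow_succ, mul_neg_one, neg_smul, mul_assoc]

include hD

theorem mul_contractionSum {n : ℕ} (a : Fin n → A) :
    F * contractionSum r F D a = (-1 : ℂ) ^ (n + 1) • (contractionSum r F D a * F) := by
  induction n with
  | zero => simp [contractionSum_zero]
  | succ n ih =>
    have h1 : F * (D * commProd r F (Fin.tail a)) =
        (-1 : ℂ) ^ (n + 1) • (D * commProd r F (Fin.tail a) * F) := by
      rw [← mul_assoc, hD, neg_mul, mul_assoc, mul_commProd hF, mul_smul_comm, pow_succ,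
        mul_neg_one, neg_smul, mul_assoc]
    rw [contractionSum_succ, mul_neg, ← mul_assoc, mul_commutator hF, neg_mul, neg_neg, mul_assoc,
      mul_add, h1, ih, ← smul_add, mul_smul_comm, pow_succ (-1 : ℂ) (n + 1), mul_neg_one, neg_smul,
      neg_mul, smul_neg, neg_neg, ← add_mul, mul_assoc]

end Anticommute

omit [Algebra ℂ R] in
theorem commutator_mul [Mul A] (hr : ∀ a b, r (a * b) = r a * r b) (a b : A) :
    ⁅F, r (a * b)⁆ = ⁅F, r a⁆ * r b + r a * ⁅F, r b⁆ := by
  simp only [Ring.lie_def, hr]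
  noncomm_ring

omit [Algebra ℂ R] in
theorem commProd_snoc {n : ℕ} (a : Fin (n + 1) → A) :
    commProd r F a = commProd r F (Fin.init a) * ⁅F, r (a (Fin.last n))⁆ := by
  induction n with
  | zero => simp [commProd_succ, commProd_zero]
  | succ n ih =>
    rw [commProd_succ, ih, commProd_succ r F (Fin.init a), ← Fin.tail_init_eq_init_tail, mul_assoc]
    rfl

/-- The definition recurses on the first factor; rotating the last commutator under the trace
requires the recursion on the last one. -/
theorem contractionSum_snoc {n : ℕ} (a : Fin (n + 1) → A) : contractionSum r F D a =
    contractionSum r F D (Fin.init a) * ⁅F, r (a (Fin.last n))⁆ +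
      (-1 : ℂ) ^ (n + 1) • (commProd r F a * D) := by
  induction n with
  | zero => simp [contractionSum_succ, contractionSum_zero, commProd_succ, commProd_zero]
  | succ n ih =>
    have h0 : (Fin.init a : Fin (n + 1) → A) 0 = a 0 := rfl
    have h1 : Fin.tail a (Fin.last n) = a (Fin.last (n + 1)) := rfl
    rw [contractionSum_succ, ih, commProd_snoc (Fin.tail a), contractionSum_succ r F D (Fin.init a),
      Fin.tail_init_eq_init_tail, h0, h1, commProd_succ r F a, commProd_snoc (Fin.tail a), h1,
      pow_succ (-1 : ℂ) (n + 1), mul_neg_one, neg_smul]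
    simp only [mul_add, mul_smul_comm, neg_mul, add_mul, mul_assoc]
    abel

section Face

variable [NormedRing A]

theorem face_zero_zero {n : ℕ} (a : Fin (n + 2) → A) : face 0 a 0 = a 0 * a 1 := by
  simp [face]

theorem tail_face_zero {n : ℕ} (a : Fin (n + 2) → A) :
    Fin.tail (face 0 a) = Fin.tail (Fin.tail a) := by
  ext i
  simp [face, Fin.tail, Fin.succ_ne_zero]

theorem face_succ_zero {n : ℕ} (j : Fin (n + 1)) (a : Fin (n + 3) → A) :
    face j.succ a 0 = a 0 := by
  simp [face]

theorem tail_face_succ {n : ℕ} (j : Fin (n + 1)) (a : Fin (n + 3) → A) :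
    Fin.tail (face j.succ a) = face j (Fin.tail a) := by
  ext i
  simp only [face, Fin.tail, Fin.succ_lt_succ_iff, Fin.succ_inj, Fin.succ_castSucc]

variable (hr : ∀ a b, r (a * b) = r a * r b)

include hr

/-- By the Leibniz rule each inner face yields two products with some `a_j` standing between
commutators; these cancel in neighbouring faces, and only the two ends survive. -/
theorem sum_commProd_face {n : ℕ} (a : Fin (n + 2) → A) :
    ∑ j : Fin (n + 1), (-1 : ℂ) ^ (j : ℕ) • commProd r F (face j a) =
      r (a 0) * commProd r F (Fin.tail a) +
        (-1 : ℂ) ^ n • (commProd r F (Fin.init a) * r (a (Fin.last (n + 1)))) := by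
  induction n with
  | zero =>
    simp only [Nat.reduceAdd, Finset.univ_unique, Fin.default_eq_zero, Finset.sum_singleton,
      Fin.val_zero, pow_zero, one_smul, commProd_succ, commProd_zero, mul_one, face_zero_zero,
      commutator_mul hr]
    exact add_comm _ _
  | succ n ih =>
    have h0 : (Fin.init a : Fin (n + 2) → A) 0 = a 0 := rfl
    have h1 : Fin.tail a (Fin.last (n + 1)) = a (Fin.last (n + 2)) := rfl
    have h2 : Fin.tail a 0 = a 1 := rfl
    have h3 := ih (Fin.tail a)
    have h4 : ∀ j : Fin (n + 1), (-1 : ℂ) ^ (j.succ : ℕ) • commProd r F (face j.succ a) =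
        -(⁅F, r (a 0)⁆ * ((-1 : ℂ) ^ (j : ℕ) • commProd r F (face j (Fin.tail a)))) := by
      intro j
      rw [commProd_succ, face_succ_zero, tail_face_succ, Fin.val_succ, pow_succ, mul_neg_one,
        neg_smul, mul_smul_comm]
    rw [Fin.sum_univ_succ, Finset.sum_congr rfl fun j _ => h4 j, Finset.sum_neg_distrib,
      ← Finset.mul_sum, h3, commProd_succ r F (face 0 a), face_zero_zero, tail_face_zero,
      commProd_succ r F (Fin.tail a), commProd_succ r F (Fin.init a), commutator_mul hr,
      Fin.tail_init_eq_init_tail, h0, h1, h2, pow_succ (-1 : ℂ) n, mul_neg_one, neg_smul]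
    simp only [Fin.val_zero, pow_zero, one_smul, mul_add, add_mul, mul_smul_comm, mul_assoc]
    abel

/-- The same telescoping, except where the two products that should cancel have `D` on different
sides of `a_j`: there `[D,a_j]` survives. No `[D,a₀]` appears, since `D` never stands to the left of
the first commutator; that term has to come from the last face and the cyclicity of the trace. -/
theorem sum_contractionSum_face {n : ℕ} (a : Fin (n + 2) → A) :
    ∑ j : Fin (n + 1), (-1 : ℂ) ^ (j : ℕ) • contractionSum r F D (face j a) =
      r (a 0) * contractionSum r F D (Fin.tail a) +
        (-1 : ℂ) ^ n • (contractionSum r F D (Fin.init a) * r (a (Fin.last (n + 1)))) +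
        ⁅F, r (a 0)⁆ * commProdDeriv r F D (Fin.tail a) := by
  induction n with
  | zero =>
    have h0 : (Fin.init a : Fin 1 → A) 0 = a 0 := rfl
    have h1 : Fin.tail a 0 = a 1 := rfl
    have h2 : a (Fin.last 1) = a 1 := rfl
    simp only [Nat.reduceAdd, Finset.univ_unique, Fin.default_eq_zero, Finset.sum_singleton,
      Fin.val_zero, pow_zero, one_smul, contractionSum_succ, commProd_zero, contractionSum_zero,
      mul_one, face_zero_zero, commutator_mul hr, commProdDeriv_succ, commProdDeriv_zero, h0, h1,
      h2]
    simp only [Ring.lie_def D]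
    noncomm_ring
  | succ n ih =>
    have h0 : (Fin.init a : Fin (n + 2) → A) 0 = a 0 := rfl
    have h1 : Fin.tail a (Fin.last (n + 1)) = a (Fin.last (n + 2)) := rfl
    have h2 : Fin.tail a 0 = a 1 := rfl
    have h3 := ih (Fin.tail a)
    have h4 := sum_commProd_face (F := F) hr (Fin.tail a)
    have h5 : ∀ j : Fin (n + 1), (-1 : ℂ) ^ (j.succ : ℕ) • contractionSum r F D (face j.succ a) =
        ⁅F, r (a 0)⁆ * (D * ((-1 : ℂ) ^ (j : ℕ) • commProd r F (face j (Fin.tail a))) +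
          (-1 : ℂ) ^ (j : ℕ) • contractionSum r F D (face j (Fin.tail a))) := by
      intro j
      rw [contractionSum_succ, face_succ_zero, tail_face_succ, Fin.val_succ, pow_succ, mul_neg_one,
        neg_smul, smul_neg, neg_neg, mul_smul_comm _ D, ← smul_add, mul_smul_comm]
    rw [Fin.sum_univ_succ, Finset.sum_congr rfl fun j _ => h5 j, ← Finset.mul_sum,
      Finset.sum_add_distrib, ← Finset.mul_sum, h3, h4, contractionSum_succ r F D (face 0 a),
      face_zero_zero, tail_face_zero, contractionSum_succ r F D (Fin.tail a),
      contractionSum_succ r F D (Fin.init a), commutator_mul hr, Fin.tail_init_eq_init_tail,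
      h0, h1, h2, commProdDeriv_succ r F D (Fin.tail a), h2, Ring.lie_def D, pow_succ (-1 : ℂ) n,
      mul_neg_one, neg_smul]
    simp only [Fin.val_zero, pow_zero, one_smul, mul_add, add_mul, mul_smul_comm, mul_assoc,
      neg_mul, mul_neg, smul_neg, smul_add, mul_sub, sub_mul, neg_add, neg_neg]
    abel

end Face

end CommutatorAlgebra

end BreuerFredholm

namespace BreuerFredholm

variable {H : Type*} [NormedAddCommGroup H] [InnerProductSpace ℂ H] [CompleteSpace H]

namespace FSNTrace

variable {N : VonNeumannAlgebra H} {ι Y Z : Type*}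

/-! ### Uniformly bounded and uniformly small families of operators -/

/-- The operators `R s y` are of size `O(1)` to the exponent `e`, uniformly in `y`, along `l`. -/
def UniformBounded (τ : FSNTrace N) (l : Filter ι) (e : ℝ) (R : ι → Y → H →L[ℂ] H) : Prop :=
  ∃ C, ∀ᶠ s in l, ∀ y, τ.HasSize e C (R s y)

/-- The operators `R s y` are of size `o(1)` to the exponent `e`, uniformly in `y`, along `l`. -/
def UniformSmall (τ : FSNTrace N) (l : Filter ι) (e : ℝ) (R : ι → Y → H →L[ℂ] H) : Prop :=
  ∀ ε, 0 < ε → ∀ᶠ s in l, ∀ y, τ.HasSize e ε (R s y)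

variable {τ : FSNTrace N} {l : Filter ι} {e f : ℝ} {R S : ι → Y → H →L[ℂ] H}

namespace UniformBounded

theorem comp (hR : τ.UniformBounded l e R) (g : Z → Y) :
    τ.UniformBounded l e fun s z => R s (g z) := by
  obtain ⟨C, hC⟩ := hR
  exact ⟨C, hC.mono fun s hs z => hs (g z)⟩

theorem tail {X : Type*} {n : ℕ} {R : ι → (Fin n → X) → H →L[ℂ] H}
    (hR : τ.UniformBounded l e R) :
    τ.UniformBounded l e fun s (a : Fin (n + 1) → X) => R s (Fin.tail a) :=
  hR.comp fun a : Fin (n + 1) → X => Fin.tail a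

theorem head {X : Type*} {R : ι → X → H →L[ℂ] H} (hR : τ.UniformBounded l e R) (n : ℕ) :
    τ.UniformBounded l e fun s (a : Fin (n + 1) → X) => R s (a 0) :=
  hR.comp fun a : Fin (n + 1) → X => a 0

theorem exists_pos (hR : τ.UniformBounded l e R) :
    ∃ C, 0 < C ∧ ∀ᶠ s in l, ∀ y, τ.HasSize e C (R s y) := by
  obtain ⟨C, hC⟩ := hR
  exact ⟨max C 1, by positivity, hC.mono fun s hs y => (hs y).mono (le_max_left _ _)⟩

theorem mul (hR : τ.UniformBounded l e R) (hS : τ.UniformBounded l f S) :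
    τ.UniformBounded l (e + f) fun s y => R s y * S s y := by
  obtain ⟨C, hC⟩ := hR
  obtain ⟨D, hD⟩ := hS
  exact ⟨_, (hC.and hD).mono fun s hs y => (hs.1 y).mul (hs.2 y)⟩

theorem add (hR : τ.UniformBounded l e R) (hS : τ.UniformBounded l e S) :
    τ.UniformBounded l e fun s y => R s y + S s y := by
  obtain ⟨C, hC⟩ := hR
  obtain ⟨D, hD⟩ := hS
  exact ⟨_, (hC.and hD).mono fun s hs y => (hs.1 y).add (hs.2 y)⟩

theorem neg (hR : τ.UniformBounded l e R) : τ.UniformBounded l e fun s y => -R s y := by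
  obtain ⟨C, hC⟩ := hR
  exact ⟨_, hC.mono fun s hs y => (hs y).neg⟩

theorem sub (hR : τ.UniformBounded l e R) (hS : τ.UniformBounded l e S) :
    τ.UniformBounded l e fun s y => R s y - S s y := by
  simpa only [sub_eq_add_neg] using hR.add hS.neg

theorem of_norm_le (hN : ∀ᶠ s in l, ∀ y, R s y ∈ N) {C : ℝ} (hR : ∀ᶠ s in l, ∀ y, ‖R s y‖ ≤ C) :
    τ.UniformBounded l 0 R :=
  ⟨max C 1, (hN.and hR).mono fun _ hs y =>
    HasSize.of_norm_le (hs.1 y) (by positivity) ((hs.2 y).trans (le_max_left _ _))⟩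

theorem const {T : H →L[ℂ] H} (hT : T ∈ N) : τ.UniformBounded l 0 fun _ (_ : Y) => T :=
  of_norm_le (.of_forall fun _ _ => hT) (.of_forall fun _ _ => le_rfl)

theorem interpolate (hR : τ.UniformBounded l e R) {C : ℝ} (hn : ∀ᶠ s in l, ∀ y, ‖R s y‖ ≤ C)
    (hf : 0 < f) (hfe : f < e) : τ.UniformBounded l f R := by
  obtain ⟨D, hD⟩ := hR
  exact ⟨_, (hn.and hD).mono fun s hs y => (hs.2 y).interpolate (d := max C 1) (by positivity)
    ((hs.1 y).trans (le_max_left _ _)) hf hfe⟩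

end UniformBounded

namespace UniformSmall

theorem comp (hR : τ.UniformSmall l e R) (g : Z → Y) :
    τ.UniformSmall l e fun s z => R s (g z) :=
  fun ε hε => (hR ε hε).mono fun _ hs z => hs (g z)

theorem tail {X : Type*} {n : ℕ} {R : ι → (Fin n → X) → H →L[ℂ] H}
    (hR : τ.UniformSmall l e R) :
    τ.UniformSmall l e fun s (a : Fin (n + 1) → X) => R s (Fin.tail a) :=
  hR.comp fun a : Fin (n + 1) → X => Fin.tail a

theorem head {X : Type*} {R : ι → X → H →L[ℂ] H} (hR : τ.UniformSmall l e R) (n : ℕ) :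
    τ.UniformSmall l e fun s (a : Fin (n + 1) → X) => R s (a 0) :=
  hR.comp fun a : Fin (n + 1) → X => a 0

theorem uniformBounded (hR : τ.UniformSmall l e R) : τ.UniformBounded l e R := ⟨1, hR 1 one_pos⟩

theorem mul_bounded (hR : τ.UniformSmall l e R) (hS : τ.UniformBounded l f S) :
    τ.UniformSmall l (e + f) fun s y => R s y * S s y := by
  obtain ⟨D, hD0, hD⟩ := hS.exists_pos
  intro ε hε
  refine ((hR (ε / (2 ^ (1 + e + f) * D)) (by positivity)).and hD).mono fun s hs y =>
    ((hs.1 y).mul (hs.2 y)).mono (le_of_eq ?_)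
  have : (2 : ℝ) ^ (1 + e + f) ≠ 0 := by positivity
  field_simp

theorem bounded_mul (hR : τ.UniformSmall l e R) (hS : τ.UniformBounded l f S) :
    τ.UniformSmall l (f + e) fun s y => S s y * R s y := by
  obtain ⟨D, hD0, hD⟩ := hS.exists_pos
  intro ε hε
  refine ((hR (ε / (2 ^ (1 + f + e) * D)) (by positivity)).and hD).mono fun s hs y =>
    ((hs.2 y).mul (hs.1 y)).mono (le_of_eq ?_)
  have : (2 : ℝ) ^ (1 + f + e) ≠ 0 := by positivity
  field_simp

theorem add (hR : τ.UniformSmall l e R) (hS : τ.UniformSmall l e S) :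
    τ.UniformSmall l e fun s y => R s y + S s y := by
  intro ε hε
  have : (2 : ℝ) ^ (1 + e) ≠ 0 := by positivity
  refine ((hR (ε / (2 ^ (1 + e) * 2)) (by positivity)).and
    (hS (ε / (2 ^ (1 + e) * 2)) (by positivity))).mono fun s hs y =>
    ((hs.1 y).add (hs.2 y)).mono (le_of_eq ?_)
  field_simp
  norm_num

theorem neg (hR : τ.UniformSmall l e R) : τ.UniformSmall l e fun s y => -R s y := by
  intro ε hε
  refine (hR (ε / 2 ^ (1 + e)) (by positivity)).mono fun s hs y => (hs y).neg.mono (le_of_eq ?_)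
  have : (2 : ℝ) ^ (1 + e) ≠ 0 := by positivity
  field_simp

theorem of_norm_le (hN : ∀ᶠ s in l, ∀ y, R s y ∈ N) {g : ι → ℝ} (hg : Tendsto g l (𝓝 0))
    (hR : ∀ᶠ s in l, ∀ y, ‖R s y‖ ≤ g s) : τ.UniformSmall l 0 R := fun _ hε =>
  (hN.and (hR.and (hg.eventually (ge_mem_nhds hε)))).mono fun _ hs y =>
    HasSize.of_norm_le (hs.1 y) hε ((hs.2.1 y).trans hs.2.2)

theorem of_tendsto {G : ι → H →L[ℂ] H} {G₀ : H →L[ℂ] H} (hG : Tendsto G l (𝓝 G₀))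
    (hN : ∀ᶠ s in l, G s ∈ N) (h₀ : G₀ ∈ N) : τ.UniformSmall l 0 fun s (_ : Y) => G s - G₀ :=
  of_norm_le (hN.mono fun _ hs _ => sub_mem hs h₀) (tendsto_iff_norm_sub_tendsto_zero.1 hG)
    (.of_forall fun _ _ => le_rfl)

theorem zero (e : ℝ) : τ.UniformSmall l e fun _ (_ : Y) => (0 : H →L[ℂ] H) := fun _ hε =>
  .of_forall fun _ _ => HasSize.zero e hε

/-- With `e = 1/p` and `f = 1/n` this is how `p < n` turns norm convergence together with
`p`-boundedness into convergence in `L^n`. -/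
theorem interpolate (hR : τ.UniformBounded l e R) {g : ι → ℝ} (hg : Tendsto g l (𝓝 0))
    (hn : ∀ᶠ s in l, ∀ y, ‖R s y‖ ≤ g s) (hf : 0 < f) (hfe : f < e) : τ.UniformSmall l f R := by
  obtain ⟨D, hD0, hD⟩ := hR.exists_pos
  intro ε hε
  have h1 : 0 < 1 - f / e := by
    rw [sub_pos, div_lt_one (hf.trans hfe)]
    exact hfe
  have h2 : Tendsto (fun d : ℝ => D ^ (f / e) * d ^ (1 - f / e)) (𝓝[>] 0) (𝓝 0) := by
    have h3 : Tendsto (fun d : ℝ => D ^ (f / e) * d ^ (1 - f / e)) (𝓝 0)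
        (𝓝 (D ^ (f / e) * 0 ^ (1 - f / e))) :=
      ((Real.continuousAt_rpow_const _ _ (.inr h1.le)).tendsto).const_mul _
    rw [Real.zero_rpow h1.ne', mul_zero] at h3
    exact h3.mono_left nhdsWithin_le_nhds
  obtain ⟨d, hd, hd0⟩ := ((h2.eventually (ge_mem_nhds hε)).and self_mem_nhdsWithin).exists
  exact (hn.and ((hg.eventually (ge_mem_nhds hd0)).and hD)).mono fun s hs y =>
    ((hs.2.2 y).interpolate hd0 ((hs.1 y).trans hs.2.1) hf hfe).mono hd

end UniformSmall

theorem UniformBounded.of_sub_small {R₀ : Y → H →L[ℂ] H}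
    (h : τ.UniformSmall l e fun s y => R s y - R₀ y) (h₀ : τ.UniformBounded l e fun _ => R₀) :
    τ.UniformBounded l e R := by
  simpa only [sub_add_cancel] using h.uniformBounded.add h₀

theorem UniformSmall.mul_sub_mul {R₀ S₀ : Y → H →L[ℂ] H}
    (hR : τ.UniformSmall l e fun s y => R s y - R₀ y) (hR₀ : τ.UniformBounded l e fun _ => R₀)
    (hS : τ.UniformSmall l f fun s y => S s y - S₀ y) (hS₀ : τ.UniformBounded l f fun _ => S₀) :
    τ.UniformSmall l (e + f) fun s y => R s y * S s y - R₀ y * S₀ y := by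
  have h1 := (hR.mul_bounded (UniformBounded.of_sub_small hS hS₀)).add (hS.bounded_mul hR₀)
  refine fun ε hε => (h1 ε hε).mono fun s hs y => ?_
  convert hs y using 1
  noncomm_ring

/-! ### Estimates of products of commutators -/

section CommutatorEstimates

variable {X : Type*} {r : X → H →L[ℂ] H} {F D : ι → H →L[ℂ] H} {F₀ D₀ : H →L[ℂ] H}
  (hr : τ.UniformBounded l 0 fun _ => r)
  (hF : τ.UniformSmall l 0 fun s (_ : X) => F s - F₀)
  (hF₀ : τ.UniformBounded l 0 fun _ (_ : X) => F₀)
  (hX : τ.UniformSmall l e fun s x => ⁅F s, r x⁆ - ⁅F₀, r x⁆)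
  (hX₀ : τ.UniformBounded l e fun _ x => ⁅F₀, r x⁆)

include hX hX₀

theorem uniformSmall_commProd (n : ℕ) :
    (τ.UniformSmall l (n * e) fun s (a : Fin n → X) => commProd r (F s) a - commProd r F₀ a) ∧
      τ.UniformBounded l (n * e) fun _ (a : Fin n → X) => commProd r F₀ a := by
  induction n with
  | zero =>
    simp only [commProd_zero, sub_self, Nat.cast_zero, zero_mul]
    exact ⟨.zero 0, .const (one_mem N)⟩
  | succ n ih =>
    have h : ((n + 1 : ℕ) : ℝ) * e = e + n * e := by push_cast; ring
    rw [h]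
    simp only [commProd_succ]
    have h1 := (hX.head n).mul_sub_mul (hX₀.head n) ih.1.tail ih.2.tail
    have h2 := (hX₀.head n).mul ih.2.tail
    exact ⟨h1, h2⟩

theorem uniformSmall_contractionSum (hD : τ.UniformSmall l 0 fun s (_ : X) => D s - D₀)
    (hD₀ : τ.UniformBounded l 0 fun _ (_ : X) => D₀) (n : ℕ) :
    (τ.UniformSmall l (n * e) fun s (a : Fin n → X) =>
      contractionSum r (F s) (D s) a - contractionSum r F₀ D₀ a) ∧
      τ.UniformBounded l (n * e) fun _ (a : Fin n → X) => contractionSum r F₀ D₀ a := by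
  induction n with
  | zero =>
    simp only [contractionSum_zero, sub_self]
    exact ⟨.zero _, (UniformSmall.zero _).uniformBounded⟩
  | succ n ih =>
    have h : ((n + 1 : ℕ) : ℝ) * e = e + n * e := by push_cast; ring
    obtain ⟨h1, h2⟩ := uniformSmall_commProd hX hX₀ n
    have h3 := UniformSmall.mul_sub_mul (hD.head n)
      (hD₀.head n) (h1.tail) (h2.tail)
    have h4 := (hD₀.head n).mul (h2.tail)
    rw [zero_add] at h3 h4
    have h5 := h3.add (ih.1.tail)
    simp only [sub_add_sub_comm] at h5
    have h6 := h4.add (ih.2.tail)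
    have h7 := (UniformSmall.mul_sub_mul (hX.head n)
      (hX₀.head n) h5 h6).neg
    have h8 := ((hX₀.head n).mul h6).neg
    rw [h]
    simp only [contractionSum_succ]
    refine ⟨?_, h8⟩
    simpa only [neg_sub, neg_sub_neg] using h7

include hr

/-- The product rule. In each term one commutator is a difference quotient, which converges only in
the operator norm, and the other `n - 1` are measured at exponent `e`. For `n = 0` the exponent is
`-e`, but the family is zero. -/
theorem uniformSmall_slope_commProd {δ : ι → ℂ}
    (hD : τ.UniformSmall l 0 fun s (_ : X) => δ s • (F s - F₀) - D₀)
    (hD₀ : τ.UniformBounded l 0 fun _ (_ : X) => D₀) (n : ℕ) :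
    τ.UniformSmall l (((n : ℝ) - 1) * e) fun s (a : Fin n → X) =>
      δ s • (commProd r (F s) a - commProd r F₀ a) - commProdDeriv r F₀ D₀ a := by
  induction n with
  | zero =>
    simp only [commProd_zero, commProdDeriv_zero, sub_self, smul_zero]
    exact .zero _
  | succ n ih =>
    obtain ⟨h1, h2⟩ := uniformSmall_commProd hX hX₀ n
    have hc : τ.UniformBounded l 0 fun _ x => ⁅D₀, r x⁆ := by
      have h := (hD₀.mul hr).sub (hr.mul hD₀)
      rwa [zero_add] at h
    have hs : τ.UniformSmall l 0 fun s x => δ s • (⁅F s, r x⁆ - ⁅F₀, r x⁆) - ⁅D₀, r x⁆ := by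
      have h := (hD.mul_bounded hr).add (hD.bounded_mul hr).neg
      rw [zero_add] at h
      refine fun ε hε => (h ε hε).mono fun s hs y => ?_
      convert hs y using 1
      simp only [Ring.lie_def, sub_mul, mul_sub, smul_sub, smul_mul_assoc, mul_smul_comm]
      abel
    have h3 := (hs.head n).mul_bounded
      ((UniformBounded.of_sub_small h1 h2).tail)
    have h4 := (h1.tail).bounded_mul (hc.head n)
    have h5 := (ih.tail).bounded_mul (hX₀.head n)
    rw [show 0 + n * e = (((n + 1 : ℕ) : ℝ) - 1) * e by push_cast; ring] at h3 h4
    rw [show e + ((n : ℝ) - 1) * e = (((n + 1 : ℕ) : ℝ) - 1) * e by push_cast; ring] at h5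
    refine fun ε hε => (((h3.add h4).add h5) ε hε).mono fun s hs y => ?_
    convert hs y using 1
    simp only [commProd_succ, commProdDeriv_succ, sub_mul, mul_sub, smul_sub, smul_mul_assoc,
      mul_smul_comm]
    abel

include hF hF₀

/-- One of the `n + 1` commutators is estimated in the operator norm, so that the product is
measured at the same exponent as its derivative. -/
theorem uniformSmall_commProd_succ (n : ℕ) : (τ.UniformSmall l (n * e) fun s
      (a : Fin (n + 1) → X) => commProd r (F s) a - commProd r F₀ a) ∧
    τ.UniformBounded l (n * e) fun _ (a : Fin (n + 1) → X) => commProd r F₀ a := by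
  obtain ⟨h1, h2⟩ := uniformSmall_commProd hX hX₀ n
  have hs : τ.UniformSmall l 0 fun s x => ⁅F s, r x⁆ - ⁅F₀, r x⁆ := by
    have h := (hF.mul_bounded hr).add (hF.bounded_mul hr).neg
    rw [zero_add] at h
    refine fun ε hε => (h ε hε).mono fun s hs y => ?_
    convert hs y using 1
    simp only [Ring.lie_def, sub_mul, mul_sub]
    abel
  have hc : τ.UniformBounded l 0 fun _ x => ⁅F₀, r x⁆ := by
    have h := (hF₀.mul hr).sub (hr.mul hF₀)
    rwa [zero_add] at h
  have h3 := UniformSmall.mul_sub_mul (hs.head n)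
    (hc.head n) (h1.tail) (h2.tail)
  have h4 := (hc.head n).mul (h2.tail)
  rw [zero_add] at h3 h4
  exact ⟨h3, h4⟩

theorem uniformSmall_slope_mul_commProd {δ : ι → ℂ}
    (hD : τ.UniformSmall l 0 fun s (_ : X) => δ s • (F s - F₀) - D₀)
    (hD₀ : τ.UniformBounded l 0 fun _ (_ : X) => D₀) {χ : H →L[ℂ] H} (hχ : χ ∈ N) (n : ℕ) :
    τ.UniformSmall l (n * e) fun s (a : Fin (n + 1) → X) =>
      δ s • (χ * F s * commProd r (F s) a - χ * F₀ * commProd r F₀ a) -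
        (χ * D₀ * commProd r F₀ a + χ * F₀ * commProdDeriv r F₀ D₀ a) := by
  obtain ⟨h1, h2⟩ := uniformSmall_commProd_succ hr hF hF₀ hX hX₀ n
  have h3 := uniformSmall_slope_commProd hr hX hX₀ hD hD₀ (n + 1)
  rw [show (((n + 1 : ℕ) : ℝ) - 1) * e = n * e by push_cast; ring] at h3
  have h4 := (hD.head n).mul_bounded
    (UniformBounded.of_sub_small h1 h2)
  have h5 := h1.bounded_mul (hD₀.head n)
  have h6 := h3.bounded_mul (hF₀.head n)
  have h7 := ((h4.add h5).add h6).bounded_mul (UniformBounded.const hχ)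
  rw [zero_add, zero_add] at h7
  refine fun ε hε => (h7 ε hε).mono fun s hs y => ?_
  convert hs y using 1
  simp only [sub_mul, mul_sub, smul_sub, smul_mul_assoc, mul_smul_comm, mul_add, mul_assoc]
  abel

end CommutatorEstimates

end FSNTrace

end BreuerFredholm

namespace BreuerFredholm

variable {H : Type*} [NormedAddCommGroup H] [InnerProductSpace ℂ H] [CompleteSpace H]
  {N : VonNeumannAlgebra H} {A : Type*} [NormedRing A] [NormedAlgebra ℂ A] [StarRing A]

/-- The algebraic part of the definitions of odd and even Breuer-Fredholm modules in a form common to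
both parities: `m` is even in the odd case, where `χ = 1`, and odd in the even case. -/
structure IsGradedSymmetry (N : VonNeumannAlgebra H) (ρ : A →⋆ₐ[ℂ] (H →L[ℂ] H)) (m : ℕ)
    (χ F : H →L[ℂ] H) : Prop where
  rho_mem : ∀ a, ρ a ∈ N
  mem : F ∈ N
  sq : F * F = 1
  chi_mem : χ ∈ N
  chi_comm : ∀ a, χ * ρ a = ρ a * χ
  mul_chi : F * χ = (-1 : ℂ) ^ m • (χ * F)

/-- The properties of the derivative of a family of symmetries. -/
structure IsTangent (N : VonNeumannAlgebra H) (m : ℕ) (χ F D : H →L[ℂ] H) : Prop where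
  mem : D ∈ N
  mul_comm : F * D = -(D * F)
  mul_chi : D * χ = (-1 : ℂ) ^ m • (χ * D)

theorem IsTangent.mul_chi_mul {m : ℕ} {χ F D : H →L[ℂ] H} (hD : IsTangent N m χ F D) :
    D * (χ * F) = (-1 : ℂ) ^ (m + 1) • (χ * F * D) := by
  rw [← mul_assoc, hD.mul_chi, smul_mul_assoc, mul_assoc, mul_assoc χ F, hD.mul_comm, pow_succ,
    mul_neg_one, neg_smul, mul_neg, smul_neg, neg_neg]

/-! ### Trace identities -/

theorem commutator_mem {F x : H →L[ℂ] H} (hF : F ∈ N) (hx : x ∈ N) : ⁅F, x⁆ ∈ N :=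
  sub_mem (mul_mem hF hx) (mul_mem hx hF)

namespace FSNTrace

variable {τ : FSNTrace N}

theorem exists_hasSize_prod_ofFn {e : ℝ} {n : ℕ} {T : Fin n → H →L[ℂ] H}
    (h : ∀ j, ∃ c, τ.HasSize e c (T j)) : ∃ c, τ.HasSize (n * e) c (List.ofFn T).prod := by
  induction n with
  | zero =>
    refine ⟨‖(1 : H →L[ℂ] H)‖ + 1, ?_⟩
    simpa using HasSize.of_norm_le (τ := τ) (one_mem N) (by positivity)
      (le_add_of_nonneg_right zero_le_one)
  | succ n ih =>
    obtain ⟨c, hc⟩ := h 0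
    obtain ⟨d, hd⟩ := ih fun j => h j.succ
    have h1 := hc.mul hd
    rw [show e + n * e = ((n + 1 : ℕ) : ℝ) * e by push_cast; ring] at h1
    rw [List.ofFn_succ, List.prod_cons]
    exact ⟨_, h1⟩

theorem exists_hasSize_commProd {X : Type*} {r : X → H →L[ℂ] H} {F : H →L[ℂ] H} {e : ℝ}
    (h : ∀ a, ∃ c, τ.HasSize e c ⁅F, r a⁆) {n : ℕ} (a : Fin n → X) :
    ∃ c, τ.HasSize (n * e) c (commProd r F a) := by
  rw [← prod_ofFn_commutator]
  exact exists_hasSize_prod_ofFn fun j => h _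

theorem exists_hasSize_contractionSum {X : Type*} {r : X → H →L[ℂ] H} {F D : H →L[ℂ] H} {e : ℝ}
    (h : ∀ a, ∃ c, τ.HasSize e c ⁅F, r a⁆) (hD : D ∈ N) {n : ℕ} (a : Fin n → X) :
    ∃ c, τ.HasSize (n * e) c (contractionSum r F D a) := by
  induction n with
  | zero => exact ⟨1, .zero _ one_pos⟩
  | succ n ih =>
    obtain ⟨c, hc⟩ := h (a 0)
    obtain ⟨d, hd⟩ := ih (Fin.tail a)
    obtain ⟨u, hu⟩ := exists_hasSize_commProd h (Fin.tail a)
    obtain ⟨v, hv⟩ := hu.bounded_mul hD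
    have h1 := (hc.mul (hv.add hd)).neg
    rw [show e + n * e = ((n + 1 : ℕ) : ℝ) * e by push_cast; ring] at h1
    exact ⟨_, h1⟩

theorem exists_hasSize_commProdDeriv {X : Type*} {r : X → H →L[ℂ] H} {F D : H →L[ℂ] H} {e : ℝ}
    (h : ∀ a, ∃ c, τ.HasSize e c ⁅F, r a⁆) (hr : ∀ a, r a ∈ N) (hD : D ∈ N) {n : ℕ}
    (a : Fin n → X) : ∃ c, τ.HasSize (((n : ℝ) - 1) * e) c (commProdDeriv r F D a) := by
  induction n with
  | zero => exact ⟨1, .zero _ one_pos⟩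
  | succ n ih =>
    obtain ⟨c, hc⟩ := h (a 0)
    obtain ⟨d, hd⟩ := ih (Fin.tail a)
    obtain ⟨u, hu⟩ := exists_hasSize_commProd h (Fin.tail a)
    obtain ⟨v, hv⟩ := hu.bounded_mul (commutator_mem hD (hr (a 0)))
    have h1 := hc.mul hd
    rw [show e + ((n : ℝ) - 1) * e = n * e by ring] at h1
    have h2 := hv.add h1
    rw [show n * e = (((n + 1 : ℕ) : ℝ) - 1) * e by push_cast; ring] at h2
    exact ⟨_, h2⟩

variable {ρ : A →⋆ₐ[ℂ] (H →L[ℂ] H)} {m : ℕ} {χ F D : H →L[ℂ] H}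

/-- `τ(χY) = τ(χYF·F) = τ(F·χYF)`, and moving the first `F` through `χ` and `Y` produces the signs
`(-1)^m` and `(-1)^{m+1}`, whose product is `-1`. -/
theorem onTraceClass_chi_mul_eq_zero (hS : IsGradedSymmetry N ρ m χ F) {Y : H →L[ℂ] H}
    (hY : Y ∈ τ.traceClass) (h : F * Y = (-1 : ℂ) ^ (m + 1) • (Y * F)) :
    τ.onTraceClass (χ * Y) = 0 := by
  have h1 : χ * Y ∈ τ.traceClass := mul_mem_traceClass' hY hS.chi_mem
  have h2 := onTraceClass_mul_comm (mul_mem_traceClass h1 hS.mem) hS.mem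
  have h3 : F * (χ * Y * F) = -(χ * Y) := by
    rw [mul_assoc, ← mul_assoc, hS.mul_chi, smul_mul_assoc, mul_assoc, ← mul_assoc F, h,
      smul_mul_assoc, mul_assoc Y, hS.sq, mul_one, mul_smul_comm, smul_smul, ← pow_add,
      show m + (m + 1) = 2 * m + 1 by ring, pow_succ, pow_mul]
    simp
  rw [mul_assoc (χ * Y), hS.sq, mul_one, h3, onTraceClass_neg h1] at h2
  exact self_eq_neg.1 h2

/-- `χ` contributes the sign `(-1)^m` and `F` the sign `-1`. This is the sign picked up when a
commutator is carried around the trace. -/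
theorem commutator_mul_chi_mul (hS : IsGradedSymmetry N ρ m χ F) (x : A) :
    ⁅F, ρ x⁆ * (χ * F) = (-1 : ℂ) ^ (m + 1) • (χ * F * ⁅F, ρ x⁆) := by
  have h1 : ⁅F, ρ x⁆ * χ = (-1 : ℂ) ^ m • (χ * ⁅F, ρ x⁆) := by
    rw [Ring.lie_def, sub_mul, mul_assoc, ← hS.chi_comm, mul_assoc, hS.mul_chi, ← mul_assoc,
      hS.mul_chi, mul_smul_comm, ← mul_assoc, ← hS.chi_comm, smul_mul_assoc, ← smul_sub, mul_sub,
      mul_assoc, mul_assoc]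
  have h2 := mul_commutator hS.sq (ρ x)
  rw [← mul_assoc, h1, smul_mul_assoc, mul_assoc, mul_assoc χ F, h2, pow_succ, mul_neg_one,
    neg_smul, mul_neg, smul_neg, neg_neg]

variable {e q : ℝ}

theorem exists_hasSize_of_lt (he : 0 < e) (heq : e < q)
    (h : ∀ a, ∃ c, τ.HasSize q c ⁅F, ρ a⁆) (a : A) : ∃ c, τ.HasSize e c ⁅F, ρ a⁆ := by
  obtain ⟨c, hc⟩ := h a
  exact ⟨_, hc.interpolate (d := ‖⁅F, ρ a⁆‖ + 1) (by positivity) (by simp) he heq⟩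

theorem commProd_mem_traceClass (h : ∀ a, ∃ c, τ.HasSize e c ⁅F, ρ a⁆)
    (hm : ((m + 1 : ℕ) : ℝ) * e = 1) (a : Fin (m + 1) → A) : commProd ρ F a ∈ τ.traceClass := by
  obtain ⟨c, hc⟩ := exists_hasSize_commProd h a
  rw [hm] at hc
  exact hc.mem_traceClass

theorem commProd_mem_traceClass_succ (hS : IsGradedSymmetry N ρ m χ F)
    (h : ∀ a, ∃ c, τ.HasSize e c ⁅F, ρ a⁆) (hm : ((m + 1 : ℕ) : ℝ) * e = 1)
    (a : Fin (m + 2) → A) : commProd ρ F a ∈ τ.traceClass := by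
  rw [commProd_succ]
  exact mul_mem_traceClass' (commProd_mem_traceClass h hm _)
    (commutator_mem hS.mem (hS.rho_mem _))

theorem contractionSum_mem_traceClass (h : ∀ a, ∃ c, τ.HasSize e c ⁅F, ρ a⁆)
    (hm : ((m + 1 : ℕ) : ℝ) * e = 1) (hD : D ∈ N) (a : Fin (m + 1) → A) :
    contractionSum ρ F D a ∈ τ.traceClass := by
  obtain ⟨c, hc⟩ := exists_hasSize_contractionSum h hD a
  rw [hm] at hc
  exact hc.mem_traceClass

theorem commProdDeriv_mem_traceClass (hS : IsGradedSymmetry N ρ m χ F)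
    (h : ∀ a, ∃ c, τ.HasSize e c ⁅F, ρ a⁆) (hm : ((m + 1 : ℕ) : ℝ) * e = 1) (hD : D ∈ N)
    (a : Fin (m + 2) → A) : commProdDeriv ρ F D a ∈ τ.traceClass := by
  obtain ⟨c, hc⟩ := exists_hasSize_commProdDeriv h hS.rho_mem hD a
  rw [show (((m + 2 : ℕ) : ℝ) - 1) * e = ((m + 1 : ℕ) : ℝ) * e by push_cast; ring, hm] at hc
  exact hc.mem_traceClass

/-- The character is a Hochschild cocycle. -/
theorem trace_commProd_hochschild (hS : IsGradedSymmetry N ρ m χ F)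
    (h : ∀ a, ∃ c, τ.HasSize e c ⁅F, ρ a⁆) (hm : ((m + 1 : ℕ) : ℝ) * e = 1)
    (a : Fin (m + 3) → A) :
    ∑ j : Fin (m + 2), (-1 : ℂ) ^ (j : ℕ) • τ.onTraceClass (χ * F * commProd ρ F (face j a)) +
      (-1 : ℂ) ^ (m + 2) * τ.onTraceClass (χ * F * commProd ρ F (lastFace a)) = 0 := by
  have hG : χ * F ∈ N := mul_mem hS.chi_mem hS.mem
  have hP : ∀ b : Fin (m + 2) → A, commProd ρ F b ∈ τ.traceClass :=
    commProd_mem_traceClass_succ hS h hm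
  have hGP : ∀ b : Fin (m + 2) → A, χ * F * commProd ρ F b ∈ τ.traceClass := fun b =>
    mul_mem_traceClass' (hP b) hG
  -- The arguments strictly between the first, `a 0`, and the last, `x`.
  set w : Fin (m + 1) → A := Fin.tail (Fin.init a) with hw
  set x := a (Fin.last (m + 2)) with hx
  have hPw : commProd ρ F w ∈ τ.traceClass := commProd_mem_traceClass h hm w
  have hXN : ⁅F, ρ x⁆ ∈ N := commutator_mem hS.mem (hS.rho_mem x)
  have h1 : ∑ j : Fin (m + 2), (-1 : ℂ) ^ (j : ℕ) •
      τ.onTraceClass (χ * F * commProd ρ F (face j a)) =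
      τ.onTraceClass (χ * F * (ρ (a 0) * commProd ρ F (Fin.tail a) +
        (-1 : ℂ) ^ (m + 1) • (commProd ρ F (Fin.init a) * ρ x))) := by
    rw [← sum_commProd_face (map_mul ρ) a, Finset.mul_sum, onTraceClass_sum]
    · refine Finset.sum_congr rfl fun j _ => ?_
      rw [mul_smul_comm, onTraceClass_smul (hGP _), smul_eq_mul]
    · intro j
      rw [mul_smul_comm]
      exact τ.traceClass.smul_mem _ (hGP _)
  have h2 : commProd ρ F (Fin.tail a) = commProd ρ F w * ⁅F, ρ x⁆ := by
    rw [commProd_snoc, ← Fin.tail_init_eq_init_tail]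
    rfl
  have h3 : commProd ρ F (lastFace a) =
      ⁅F, ρ x⁆ * ρ (a 0) * commProd ρ F w + ρ x * commProd ρ F (Fin.init a) := by
    rw [commProd_succ ρ F (Fin.init a), ← mul_assoc, ← add_mul,
      show (Fin.init a : Fin (m + 2) → A) 0 = a 0 from rfl, ← commutator_mul (map_mul ρ)]
    rfl
  have hu : χ * F * (ρ (a 0) * commProd ρ F w) ∈ τ.traceClass :=
    mul_mem_traceClass' (mul_mem_traceClass' hPw (hS.rho_mem _)) hG
  -- Carrying `[F,x]` from the end to the front makes the first boundary term cancel one half of the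
  -- last face.
  have h4 := onTraceClass_mul_comm hu hXN
  have h5 : ⁅F, ρ x⁆ * (χ * F * (ρ (a 0) * commProd ρ F w)) =
      (-1 : ℂ) ^ (m + 1) • (χ * F * (⁅F, ρ x⁆ * ρ (a 0) * commProd ρ F w)) := by
    rw [← mul_assoc, commutator_mul_chi_mul hS, smul_mul_assoc]
    simp only [mul_assoc]
  have hv : χ * F * (⁅F, ρ x⁆ * ρ (a 0) * commProd ρ F w) ∈ τ.traceClass :=
    mul_mem_traceClass' (mul_mem_traceClass' hPw (mul_mem hXN (hS.rho_mem _))) hG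
  have h6 := onTraceClass_mul_comm (hGP (Fin.init a)) (hS.rho_mem x)
  -- The second boundary term and the other half of the last face differ, up to sign, by this trace,
  -- which vanishes for parity reasons.
  have h7 : τ.onTraceClass (χ * (⁅F, ρ x⁆ * commProd ρ F (Fin.init a))) = 0 := by
    refine onTraceClass_chi_mul_eq_zero hS (mul_mem_traceClass' (hP _) hXN) ?_
    rw [← mul_assoc, mul_commutator hS.sq, neg_mul, mul_assoc, mul_commProd hS.sq, mul_smul_comm,
      pow_succ, mul_neg_one, neg_smul, neg_neg, mul_assoc]
  have h8 : χ * (⁅F, ρ x⁆ * commProd ρ F (Fin.init a)) =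
      χ * F * (ρ x * commProd ρ F (Fin.init a)) - ρ x * (χ * F * commProd ρ F (Fin.init a)) := by
    rw [Ring.lie_def, ← mul_assoc (ρ x), ← mul_assoc (ρ x), ← hS.chi_comm, sub_mul, mul_sub]
    simp only [mul_assoc]
  have hy : χ * F * (ρ x * commProd ρ F (Fin.init a)) ∈ τ.traceClass :=
    mul_mem_traceClass' (mul_mem_traceClass' (hP _) (hS.rho_mem _)) hG
  have hz : ρ x * (χ * F * commProd ρ F (Fin.init a)) ∈ τ.traceClass :=
    mul_mem_traceClass' (hGP _) (hS.rho_mem _)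
  have hz' : χ * F * commProd ρ F (Fin.init a) * ρ x ∈ τ.traceClass :=
    mul_mem_traceClass (hGP _) (hS.rho_mem _)
  rw [h8, onTraceClass_sub hy hz] at h7
  rw [h5, onTraceClass_smul hv] at h4
  rw [h1, h2, h3, mul_add, mul_add, mul_smul_comm, ← mul_assoc (ρ (a 0)), ← mul_assoc,
    ← mul_assoc (χ * F) (commProd ρ F (Fin.init a)),
    onTraceClass_add (mul_mem_traceClass hu hXN) (τ.traceClass.smul_mem _ hz'),
    onTraceClass_smul hz', onTraceClass_add hv hy, h4, h6, sub_eq_zero.1 h7,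
    pow_succ (-1 : ℂ) (m + 1)]
  ring

/-- The trace identity behind the homotopy formula. -/
theorem trace_contractionSum_hochschild (hS : IsGradedSymmetry N ρ m χ F)
    (hD : IsTangent N m χ F D) (he : 0 < e) (heq : e < q)
    (hq : ∀ a, ∃ c, τ.HasSize q c ⁅F, ρ a⁆) (hm : ((m + 1 : ℕ) : ℝ) * e = 1)
    (a : Fin (m + 2) → A) :
    ∑ j : Fin (m + 1), (-1 : ℂ) ^ (j : ℕ) •
        τ.onTraceClass (χ * F * contractionSum ρ F D (face j a)) +
      (-1 : ℂ) ^ (m + 1) * τ.onTraceClass (χ * F * contractionSum ρ F D (lastFace a)) =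
    τ.onTraceClass (χ * D * commProd ρ F a + χ * F * commProdDeriv ρ F D a) := by
  have h := exists_hasSize_of_lt he heq hq
  have hG : χ * F ∈ N := mul_mem hS.chi_mem hS.mem
  have hQ : ∀ b : Fin (m + 1) → A, contractionSum ρ F D b ∈ τ.traceClass :=
    contractionSum_mem_traceClass h hm hD.mem
  have hGQ : ∀ b : Fin (m + 1) → A, χ * F * contractionSum ρ F D b ∈ τ.traceClass := fun b =>
    mul_mem_traceClass' (hQ b) hG
  set w : Fin m → A := Fin.tail (Fin.init a) with hw
  set x := a (Fin.last (m + 1)) with hx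
  have hXN : ⁅F, ρ x⁆ ∈ N := commutator_mem hS.mem (hS.rho_mem x)
  have hPt : commProd ρ F (Fin.tail a) ∈ τ.traceClass := commProd_mem_traceClass h hm _
  have hP' : commProdDeriv ρ F D a ∈ τ.traceClass := commProdDeriv_mem_traceClass hS h hm hD.mem a
  have hPa : commProd ρ F a ∈ τ.traceClass := commProd_mem_traceClass_succ hS h hm a
  have hGr : χ * F * ρ (a 0) ∈ N := mul_mem hG (hS.rho_mem _)
  have hQwX : contractionSum ρ F D w * ⁅F, ρ x⁆ ∈ τ.traceClass := by
    obtain ⟨c, hc⟩ := exists_hasSize_contractionSum h hD.mem w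
    obtain ⟨d, hd⟩ := h x
    have h1 := hc.mul hd
    rw [show m * e + e = ((m + 1 : ℕ) : ℝ) * e by push_cast; ring, hm] at h1
    exact h1.mem_traceClass
  have hXP : ⁅F, ρ (a 0)⁆ * commProdDeriv ρ F D (Fin.tail a) ∈ τ.traceClass := by
    have h1 : commProdDeriv ρ F D a - ⁅D, ρ (a 0)⁆ * commProd ρ F (Fin.tail a) ∈ τ.traceClass :=
      sub_mem hP' (mul_mem_traceClass' hPt (commutator_mem hD.mem (hS.rho_mem _)))
    rwa [commProdDeriv_succ, add_sub_cancel_left] at h1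
  have h1 : ∑ j : Fin (m + 1), (-1 : ℂ) ^ (j : ℕ) •
      τ.onTraceClass (χ * F * contractionSum ρ F D (face j a)) =
      τ.onTraceClass (χ * F * (ρ (a 0) * contractionSum ρ F D (Fin.tail a) +
        (-1 : ℂ) ^ m • (contractionSum ρ F D (Fin.init a) * ρ x) +
          ⁅F, ρ (a 0)⁆ * commProdDeriv ρ F D (Fin.tail a))) := by
    rw [← sum_contractionSum_face (map_mul ρ) a, Finset.mul_sum, onTraceClass_sum]
    · refine Finset.sum_congr rfl fun j _ => ?_
      rw [mul_smul_comm, onTraceClass_smul (hGQ _), smul_eq_mul]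
    · intro j
      rw [mul_smul_comm]
      exact τ.traceClass.smul_mem _ (hGQ _)
  -- `lastFace a` and `Fin.init a` have the same tail `w`, so the same `Z` follows the first
  -- commutator in the contractions of both.
  set Z := D * commProd ρ F w + contractionSum ρ F D w with hZ
  have h2 : contractionSum ρ F D (lastFace a) =
      ρ x * contractionSum ρ F D (Fin.init a) - ⁅F, ρ x⁆ * (ρ (a 0) * Z) := by
    have h3 : contractionSum ρ F D (lastFace a) =
        -((⁅F, ρ x⁆ * ρ (a 0) + ρ x * ⁅F, ρ (a 0)⁆) * Z) := by
      rw [← commutator_mul (map_mul ρ)]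
      rfl
    have h4 : contractionSum ρ F D (Fin.init a) = -(⁅F, ρ (a 0)⁆ * Z) := rfl
    rw [h3, h4]
    noncomm_ring
  have h2' : commProd ρ F (Fin.tail a) = commProd ρ F w * ⁅F, ρ x⁆ := by
    rw [commProd_snoc, ← Fin.tail_init_eq_init_tail]
    rfl
  have h3 : contractionSum ρ F D (Fin.tail a) = contractionSum ρ F D w * ⁅F, ρ x⁆ +
      (-1 : ℂ) ^ (m + 1) • (commProd ρ F (Fin.tail a) * D) := by
    rw [contractionSum_snoc, ← Fin.tail_init_eq_init_tail]
    rfl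
  have hZX : Z * ⁅F, ρ x⁆ =
      D * commProd ρ F (Fin.tail a) + contractionSum ρ F D w * ⁅F, ρ x⁆ := by
    rw [hZ, add_mul, h2', mul_assoc]
  have hDP : D * commProd ρ F (Fin.tail a) ∈ τ.traceClass := mul_mem_traceClass' hPt hD.mem
  have hPD : commProd ρ F (Fin.tail a) * D ∈ τ.traceClass := mul_mem_traceClass hPt hD.mem
  -- the commutator with the last argument is moved to the front
  have h4 : τ.onTraceClass (χ * F * ρ (a 0) * Z * ⁅F, ρ x⁆) =
      τ.onTraceClass (⁅F, ρ x⁆ * (χ * F * ρ (a 0) * Z)) := by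
    obtain ⟨c, hc⟩ := exists_hasSize_contractionSum h hD.mem w
    obtain ⟨d, hd⟩ := exists_hasSize_commProd h w
    obtain ⟨d', hd'⟩ := hd.bounded_mul hD.mem
    obtain ⟨c', hc'⟩ := (hd'.add hc).bounded_mul hGr
    obtain ⟨u, hu⟩ := hq x
    -- The left factor contains only `m` commutators and need not be trace class, so cyclicity is
    -- needed for a pair of Hölder type; `e < q` provides the required room.
    refine onTraceClass_mul_comm_of_hasSize hc' hu he heq ?_
    rw [← hm]
    push_cast
    ring
  have h5 : ⁅F, ρ x⁆ * (χ * F * ρ (a 0) * Z) =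
      (-1 : ℂ) ^ (m + 1) • (χ * F * (⁅F, ρ x⁆ * (ρ (a 0) * Z))) := by
    rw [mul_assoc (χ * F), ← mul_assoc, commutator_mul_chi_mul hS, smul_mul_assoc, mul_assoc]
  have hGQX := mul_mem_traceClass' hQwX hGr
  have hGDP := mul_mem_traceClass' hDP hGr
  have hGPD := mul_mem_traceClass' hPD hGr
  have hneg : ((-1 : ℂ) ^ (m + 1)) * (-1) ^ (m + 1) = 1 := by rw [← mul_pow]; simp
  have hGXZ : χ * F * (⁅F, ρ x⁆ * (ρ (a 0) * Z)) ∈ τ.traceClass := by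
    have h6 : χ * F * contractionSum ρ F D (lastFace a) =
        χ * F * (ρ x * contractionSum ρ F D (Fin.init a)) -
          χ * F * (⁅F, ρ x⁆ * (ρ (a 0) * Z)) := by rw [h2, mul_sub]
    have h7 := sub_mem (mul_mem_traceClass' (mul_mem_traceClass' (hQ (Fin.init a)) (hS.rho_mem x))
      hG) (hGQ (lastFace a))
    rwa [h6, sub_sub_cancel] at h7
  rw [h5, onTraceClass_smul hGXZ, mul_assoc (χ * F * ρ (a 0)), hZX, mul_add,
    onTraceClass_add hGDP hGQX] at h4
  -- In the term of the contraction where `D` stands last, carrying `D` to the front creates `D a₀`.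
  -- The matching `a₀ D` is contained in `Z [F,x]` in `h4`; together they supply the missing
  -- `[D,a₀]`.
  have h6 := onTraceClass_mul_comm (mul_mem_traceClass' hPt hGr) hD.mem
  have h7 : D * (χ * F * ρ (a 0) * commProd ρ F (Fin.tail a)) =
      (-1 : ℂ) ^ (m + 1) • (χ * F * (D * ρ (a 0) * commProd ρ F (Fin.tail a))) := by
    rw [mul_assoc (χ * F), ← mul_assoc, hD.mul_chi_mul, smul_mul_assoc]
    simp only [mul_assoc]
  have hGDr : χ * F * (D * ρ (a 0) * commProd ρ F (Fin.tail a)) ∈ τ.traceClass :=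
    mul_mem_traceClass' (mul_mem_traceClass' hPt (mul_mem hD.mem (hS.rho_mem _))) hG
  rw [h7, onTraceClass_smul hGDr, mul_assoc (χ * F * ρ (a 0))] at h6
  have h8 := onTraceClass_mul_comm (hGQ (Fin.init a)) (hS.rho_mem x)
  have h9 : τ.onTraceClass (χ * (⁅F, ρ x⁆ * contractionSum ρ F D (Fin.init a))) = 0 := by
    refine onTraceClass_chi_mul_eq_zero hS (mul_mem_traceClass' (hQ _) hXN) ?_
    rw [← mul_assoc, mul_commutator hS.sq, neg_mul, mul_assoc,
      mul_contractionSum hS.sq hD.mul_comm, mul_smul_comm, pow_succ, mul_neg_one, neg_smul,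
      neg_neg, mul_assoc]
  have h10 : χ * (⁅F, ρ x⁆ * contractionSum ρ F D (Fin.init a)) =
      χ * F * (ρ x * contractionSum ρ F D (Fin.init a)) -
        ρ x * (χ * F * contractionSum ρ F D (Fin.init a)) := by
    rw [Ring.lie_def, ← mul_assoc (ρ x), ← mul_assoc (ρ x), ← hS.chi_comm, sub_mul, mul_sub]
    simp only [mul_assoc]
  have hy : χ * F * (ρ x * contractionSum ρ F D (Fin.init a)) ∈ τ.traceClass :=
    mul_mem_traceClass' (mul_mem_traceClass' (hQ _) (hS.rho_mem _)) hG
  have hz : ρ x * (χ * F * contractionSum ρ F D (Fin.init a)) ∈ τ.traceClass :=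
    mul_mem_traceClass' (hGQ _) (hS.rho_mem _)
  have hz' : χ * F * contractionSum ρ F D (Fin.init a) * ρ x ∈ τ.traceClass :=
    mul_mem_traceClass (hGQ _) (hS.rho_mem _)
  rw [h10, onTraceClass_sub hy hz] at h9
  -- The derivative of the leading factor `F` does not contribute, again by parity.
  have h11 : τ.onTraceClass (χ * (D * commProd ρ F a)) = 0 := by
    refine onTraceClass_chi_mul_eq_zero hS (mul_mem_traceClass' hPa hD.mem) ?_
    rw [← mul_assoc, hD.mul_comm, neg_mul, mul_assoc, mul_commProd hS.sq, mul_smul_comm,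
      pow_succ, mul_neg_one, neg_smul, neg_neg, mul_assoc]
  have hGXP := mul_mem_traceClass' hXP hG
  have hGDC : χ * F * (ρ (a 0) * D * commProd ρ F (Fin.tail a)) ∈ τ.traceClass :=
    mul_mem_traceClass' (mul_mem_traceClass' hPt (mul_mem (hS.rho_mem _) hD.mem)) hG
  have h12 : τ.onTraceClass (χ * D * commProd ρ F a + χ * F * commProdDeriv ρ F D a) =
      τ.onTraceClass (χ * F * (D * ρ (a 0) * commProd ρ F (Fin.tail a))) -
        τ.onTraceClass (χ * F * ρ (a 0) * (D * commProd ρ F (Fin.tail a))) +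
        τ.onTraceClass (χ * F * (⁅F, ρ (a 0)⁆ * commProdDeriv ρ F D (Fin.tail a))) := by
    have h13 : χ * D * commProd ρ F a + χ * F * commProdDeriv ρ F D a = χ * (D * commProd ρ F a) +
        (χ * F * (D * ρ (a 0) * commProd ρ F (Fin.tail a)) -
          χ * F * ρ (a 0) * (D * commProd ρ F (Fin.tail a)) +
          χ * F * (⁅F, ρ (a 0)⁆ * commProdDeriv ρ F D (Fin.tail a))) := by
      rw [commProdDeriv_succ, Ring.lie_def D]
      noncomm_ring
    rw [h13, onTraceClass_add (mul_mem_traceClass' (mul_mem_traceClass' hPa hD.mem) hS.chi_mem)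
      (add_mem (sub_mem hGDr hGDP) hGXP), h11, zero_add, onTraceClass_add (sub_mem hGDr hGDP) hGXP,
      onTraceClass_sub hGDr hGDP]
  have h13 : χ * F * (ρ (a 0) * contractionSum ρ F D (Fin.tail a) +
        (-1 : ℂ) ^ m • (contractionSum ρ F D (Fin.init a) * ρ x) +
          ⁅F, ρ (a 0)⁆ * commProdDeriv ρ F D (Fin.tail a)) =
      χ * F * ρ (a 0) * (contractionSum ρ F D w * ⁅F, ρ x⁆) +
        (-1 : ℂ) ^ (m + 1) • (χ * F * ρ (a 0) * (commProd ρ F (Fin.tail a) * D)) +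
        (-1 : ℂ) ^ m • (χ * F * contractionSum ρ F D (Fin.init a) * ρ x) +
        χ * F * (⁅F, ρ (a 0)⁆ * commProdDeriv ρ F D (Fin.tail a)) := by
    rw [h3]
    simp only [mul_add, mul_smul_comm, mul_assoc]
  rw [h1, h12, h13, h2, mul_sub, onTraceClass_sub hy hGXZ,
    onTraceClass_add (add_mem (add_mem hGQX (τ.traceClass.smul_mem _ hGPD))
      (τ.traceClass.smul_mem _ hz')) hGXP,
    onTraceClass_add (add_mem hGQX (τ.traceClass.smul_mem _ hGPD)) (τ.traceClass.smul_mem _ hz'),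
    onTraceClass_add hGQX (τ.traceClass.smul_mem _ hGPD), onTraceClass_smul hGPD,
    onTraceClass_smul hz', h6, h8, sub_eq_zero.1 h9]
  linear_combination (exp := 1) (τ.onTraceClass (χ * F * (D * ρ (a 0) *
    commProd ρ F (Fin.tail a)))) * hneg + h4

end FSNTrace

end BreuerFredholm

namespace BreuerFredholm

/-! ### Cochains vanishing on scalars -/

section Normalized

variable {A : Type*} [NormedRing A] [NormedAlgebra ℂ A]

theorem pullback_apply {k n : ℕ} (g : (Fin (k + 1) → A) → (Fin (n + 1) → A)) (hg : Continuous g)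
    (h : ∀ (a : Fin (k + 1) → A) (i : Fin (k + 1)), ∃ (l : Fin (n + 1)) (L : A →ₗ[ℂ] A),
      ∀ x, g (Function.update a i x) = Function.update (g a) l (L x))
    (φ : Cochain A n) (a : Fin (k + 1) → A) : pullback g hg h φ a = φ (g a) := rfl

theorem hochschildb_apply {n : ℕ} (φ : Cochain A n) (a : Fin (n + 2) → A) :
    hochschildb n φ a = ∑ j : Fin (n + 1), (-1 : ℂ) ^ (j : ℕ) • φ (face j a) +
      (-1 : ℂ) ^ (n + 1) * φ (lastFace a) := by
  simp [hochschildb, pullback_apply]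

/-- The functional vanishes if one of the arguments, the first one included, is a scalar. -/
def VanishesOnScalars {n : ℕ} (φ : Cochain A n) : Prop :=
  ∀ (a : Fin (n + 1) → A) (i : Fin (n + 1)), (∃ c : ℂ, a i = algebraMap ℂ A c) → φ a = 0

/-- Every term of `B` has `1` in the zeroth slot. Hence only `b` matters for the character and its
contraction. -/
theorem VanishesOnScalars.connesB_eq_zero {n : ℕ} {φ : Cochain A (n + 1)}
    (h : VanishesOnScalars φ) : connesB n φ = 0 := by
  ext a
  have : ∀ j : Fin (n + 1), φ (rotate j a) = 0 := fun j =>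
    h _ 0 ⟨1, by simp [rotate]⟩
  simp [connesB, pullback_apply, this]

variable {n : ℕ} {φ : Cochain A n}

theorem VanishesOnScalars.single (h : VanishesOnScalars φ) (k : ℕ) :
    VanishesOnScalars ((Pi.single n φ : CochainSeq A) k) := by
  by_cases hk : k = n
  · subst hk
    simpa using h
  · intro a i _
    simp [hk]

theorem VanishesOnScalars.totalbB_single (h : VanishesOnScalars φ) :
    totalbB (Pi.single n φ : CochainSeq A) = Pi.single (n + 1) (hochschildb n φ) := by
  funext k
  match k with
  | 0 =>
    rw [Pi.single_eq_of_ne (by omega)]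
    exact (h.single 1).connesB_eq_zero
  | k + 1 =>
    have h1 : totalbB (Pi.single n φ : CochainSeq A) (k + 1) =
        hochschildb k ((Pi.single n φ : CochainSeq A) k) +
          connesB (k + 1) ((Pi.single n φ : CochainSeq A) (k + 2)) := rfl
    rw [h1, (h.single (k + 2)).connesB_eq_zero, add_zero]
    by_cases hk : k = n
    · subst hk
      simp
    · rw [Pi.single_eq_of_ne hk, Pi.single_eq_of_ne (by omega), map_zero]

theorem VanishesOnScalars.single_mem_entireCochains (h : VanishesOnScalars φ) :
    (Pi.single n φ : CochainSeq A) ∈ entireCochains A := by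
  refine ⟨fun k a i _ hc => h.single k a i hc, fun z => ?_⟩
  refine summable_of_ne_finset_zero (s := {n}) fun k hk => ?_
  rw [Pi.single_eq_of_ne (by simpa using hk)]
  simp

theorem VanishesOnScalars.single_mem_entireCocycles (h : VanishesOnScalars φ)
    (hb : hochschildb n φ = 0) : (Pi.single n φ : CochainSeq A) ∈ entireCocycles A := by
  refine ⟨h.single_mem_entireCochains, ?_⟩
  change totalbB (Pi.single n φ : CochainSeq A) = 0
  rw [h.totalbB_single, hb, Pi.single_zero]

theorem HE.mk_single_eq {φ ψ : Cochain A (n + 1)} {θ : Cochain A n} (hθ : VanishesOnScalars θ)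
    (h : hochschildb n θ = ψ - φ) (hφ : (Pi.single (n + 1) φ : CochainSeq A) ∈ entireCocycles A)
    (hψ : (Pi.single (n + 1) ψ : CochainSeq A) ∈ entireCocycles A) :
    HE.mk _ hφ = HE.mk _ hψ := by
  refine QuotientAddGroup.eq.2 ?_
  rw [AddSubgroup.mem_addSubgroupOf]
  refine ⟨Pi.single n θ, hθ.single_mem_entireCochains, ?_⟩
  change totalbB (Pi.single n θ) = -(Pi.single (n + 1) φ : CochainSeq A) + Pi.single (n + 1) ψ
  rw [hθ.totalbB_single, h, Pi.single_sub]
  abel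

end Normalized

/-! ### Norms of multilinear functionals -/

section Norm

variable {A : Type*} [NormedRing A] [NormedAlgebra ℂ A]

theorem norm_le_mul_prod_of_unit_ball {k : ℕ} (f : MultilinearMap ℂ (fun _ : Fin k => A) ℂ)
    {K : ℝ} (h : ∀ a : Fin k → A, (∀ i, ‖a i‖ ≤ 1) → ‖f a‖ ≤ K) (a : Fin k → A) :
    ‖f a‖ ≤ K * ∏ i, ‖a i‖ := by
  have hK : 0 ≤ K := (norm_nonneg _).trans (h 0 (by simp))
  by_cases h0 : ∃ i, a i = 0
  · obtain ⟨i, hi⟩ := h0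
    rw [f.map_coord_zero i hi, norm_zero]
    exact mul_nonneg hK (Finset.prod_nonneg fun i _ => norm_nonneg _)
  · push Not at h0
    have hn : ∀ i, ((‖a i‖ : ℝ) : ℂ) ≠ 0 := fun i => by simpa using h0 i
    have h1 : a = fun i => ((‖a i‖ : ℝ) : ℂ) • ((‖a i‖ : ℝ) : ℂ)⁻¹ • a i :=
      funext fun i => (smul_inv_smul₀ (hn i) (a i)).symm
    have h2 := h (fun i => ((‖a i‖ : ℝ) : ℂ)⁻¹ • a i) fun i => by
      rw [norm_smul, norm_inv, Complex.norm_real, norm_norm,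
        inv_mul_cancel₀ (norm_ne_zero_iff.2 (h0 i))]
    have h3 : f a = (∏ i, ((‖a i‖ : ℝ) : ℂ)) • f fun i => ((‖a i‖ : ℝ) : ℂ)⁻¹ • a i := by
      rw [← f.map_smul_univ, ← h1]
    rw [h3, norm_smul, norm_prod, mul_comm]
    simp only [Complex.norm_real, norm_norm]
    gcongr

theorem opNorm_le_of_unit_ball {k : ℕ} (φ : ContinuousMultilinearMap ℂ (fun _ : Fin k => A) ℂ)
    {K : ℝ} (h : ∀ a : Fin k → A, (∀ i, ‖a i‖ ≤ 1) → ‖φ a‖ ≤ K) : ‖φ‖ ≤ K :=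
  ContinuousMultilinearMap.opNorm_le_bound ((norm_nonneg _).trans (h 0 (by simp)))
    (norm_le_mul_prod_of_unit_ball φ.toMultilinearMap h)

end Norm

section CommutatorComp

variable {X A R : Type*} [Ring R] (r : A → R) (F D : R) (g : X → A)

/-- The uniform estimates are indexed by tuples in the unit ball, taken as a type; with `g` the
inclusion this leads back to tuples in `A`. -/
theorem commProd_comp {n : ℕ} (a : Fin n → X) :
    commProd (fun x => r (g x)) F a = commProd r F fun i => g (a i) := by
  induction n with
  | zero => rfl
  | succ n ih => rw [commProd_succ, commProd_succ, ih]; rfl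

theorem contractionSum_comp {n : ℕ} (a : Fin n → X) :
    contractionSum (fun x => r (g x)) F D a = contractionSum r F D fun i => g (a i) := by
  induction n with
  | zero => rfl
  | succ n ih => rw [contractionSum_succ, contractionSum_succ, ih, commProd_comp]; rfl

theorem commProdDeriv_comp {n : ℕ} (a : Fin n → X) :
    commProdDeriv (fun x => r (g x)) F D a = commProdDeriv r F D fun i => g (a i) := by
  induction n with
  | zero => rfl
  | succ n ih => rw [commProdDeriv_succ, commProdDeriv_succ, ih, commProd_comp]; rfl

end CommutatorComp

variable {H : Type*} [NormedAddCommGroup H] [InnerProductSpace ℂ H] [CompleteSpace H]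
  {N : VonNeumannAlgebra H} {A : Type*} [NormedRing A] [NormedAlgebra ℂ A] [StarRing A]
  {τ : FSNTrace N} {ρ : A →⋆ₐ[ℂ] (H →L[ℂ] H)} {m : ℕ} {χ F D : H →L[ℂ] H} {e q : ℝ}

namespace FSNTrace

omit [StarRing A] in
theorem exists_cochain {k : ℕ} (M : MultilinearMap ℂ (fun _ : Fin k => A) (H →L[ℂ] H))
    (hM : ∀ a, M a ∈ τ.traceClass) {C : ℝ}
    (h : ∀ a : Fin k → A, (∀ i, ‖a i‖ ≤ 1) → τ.HasSize 1 C (M a)) (z : ℂ) :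
    ∃ φ : ContinuousMultilinearMap ℂ (fun _ : Fin k => A) ℂ, ∀ a,
      φ a = z * τ.onTraceClass (M a) := by
  let f : MultilinearMap ℂ (fun _ : Fin k => A) ℂ :=
    (z • τ.trace).compMultilinearMap (M.codRestrict τ.traceClass hM)
  refine ⟨f.mkContinuous (‖z‖ * (2000 * C)) (norm_le_mul_prod_of_unit_ball f fun a ha => ?_),
    fun a => rfl⟩
  change ‖z * τ.onTraceClass (M a)‖ ≤ _
  rw [norm_mul]
  gcongr
  exact norm_onTraceClass_le (h a ha)

omit [StarRing A] in
theorem tendsto_cochain {ι : Type*} {l : Filter ι} {k : ℕ}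
    {Φ : ι → ContinuousMultilinearMap ℂ (fun _ : Fin k => A) ℂ}
    {φ : ContinuousMultilinearMap ℂ (fun _ : Fin k => A) ℂ}
    {R : ι → (Fin k → {x : A // ‖x‖ ≤ 1}) → H →L[ℂ] H} (hR : τ.UniformSmall l 1 R) {z : ℂ}
    (h : ∀ᶠ s in l, ∀ a, Φ s (fun i => a i) - φ (fun i => a i) = z * τ.onTraceClass (R s a)) :
    Tendsto Φ l (𝓝 φ) := by
  rw [Metric.tendsto_nhds]
  intro ε hε
  -- The size that makes `‖z‖ · 2000 · size` at most `ε / 2`; the `+ 1` covers `z = 0`.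
  have hη : 0 < ε / (2 * (2000 * ‖z‖ + 1)) := by positivity
  refine ((hR _ hη).and h).mono fun s hs => ?_
  rw [dist_eq_norm]
  have h1 : ‖Φ s - φ‖ ≤ ε / 2 := by
    refine opNorm_le_of_unit_ball _ fun a ha => ?_
    have h2 := hs.2 fun i => ⟨a i, ha i⟩
    rw [sub_apply]
    dsimp only at h2
    rw [h2, norm_mul]
    have h3 := norm_onTraceClass_le (hs.1 fun i => ⟨a i, ha i⟩)
    refine (mul_le_mul_of_nonneg_left h3 (norm_nonneg z)).trans ?_
    have h4 : 0 < 2000 * ‖z‖ + 1 := by positivity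
    have h5 : ‖z‖ * (2000 * (ε / (2 * (2000 * ‖z‖ + 1)))) =
        ε / 2 * (2000 * ‖z‖ / (2000 * ‖z‖ + 1)) := by field_simp
    rw [h5]
    refine mul_le_of_le_one_right (by positivity) ((div_le_one h4).2 (by linarith))
  exact h1.trans_lt (half_lt_self hε)

/-- The normalizing factor of the Connes character in degree `n`. -/
noncomputable def characterCoeff (n : ℕ) : ℂ :=
  ((Real.Gamma ((n : ℝ) / 2 + 1) / (2 * (n.factorial : ℝ)) : ℝ) : ℂ)

/-! ### The Connes character and its contraction -/

theorem characterOperator_eq {n : ℕ} (a : Fin (n + 1) → A) :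
    characterOperator ρ χ F a = χ * F * commProd ρ F a := by
  rw [characterOperator, ← prod_ofFn_commutator]

theorem contractionOperator_mem_traceClass (hS : IsGradedSymmetry N ρ m χ F)
    (h : ∀ a, ∃ c, τ.HasSize e c ⁅F, ρ a⁆) (hm : ((m + 1 : ℕ) : ℝ) * e = 1) (hD : D ∈ N)
    (a : Fin (m + 1) → A) (k : Fin (m + 1)) :
    contractionOperator ρ χ F D a k ∈ τ.traceClass := by
  refine mul_mem_traceClass' ?_ (mul_mem hS.chi_mem hS.mem)
  obtain ⟨c, hc⟩ := exists_hasSize_prod_ofFn (τ := τ) (e := e)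
    (T := fun j => if j = k then ⁅F, ρ (a j)⁆ * D else ⁅F, ρ (a j)⁆) (fun j => by
      obtain ⟨c, hc⟩ := h (a j)
      split_ifs
      · exact hc.mul_bounded hD
      · exact ⟨c, hc⟩)
  rw [hm] at hc
  exact hc.mem_traceClass

theorem isConnesCharacter_iff (hS : IsGradedSymmetry N ρ m χ F)
    (h : ∀ a, ∃ c, τ.HasSize e c ⁅F, ρ a⁆) (hm : ((m + 1 : ℕ) : ℝ) * e = 1)
    {φ : Cochain A (m + 1)} : IsConnesCharacter τ ρ χ F φ ↔ ∀ a, φ a =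
      characterCoeff (m + 1) * τ.onTraceClass (χ * F * commProd ρ F a) := by
  simp only [IsConnesCharacter, characterOperator_eq, characterCoeff]
  exact forall_congr' fun a => and_iff_right (isSummable_of_mem_traceClass
    (mul_mem_traceClass' (commProd_mem_traceClass_succ hS h hm a) (mul_mem hS.chi_mem hS.mem)))

theorem isContraction_iff (hS : IsGradedSymmetry N ρ m χ F)
    (h : ∀ a, ∃ c, τ.HasSize e c ⁅F, ρ a⁆) (hm : ((m + 1 : ℕ) : ℝ) * e = 1) (hD : D ∈ N)
    {φ : Cochain A m} : IsContraction τ ρ χ F D φ ↔ ∀ a, φ a =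
      characterCoeff (m + 1) * τ.onTraceClass (χ * F * contractionSum ρ F D a) := by
  refine forall_congr' fun a => ?_
  have h1 := contractionOperator_mem_traceClass hS h hm hD a
  rw [and_iff_right fun k => isSummable_of_mem_traceClass (h1 k)]
  have h2 : ∑ k : Fin (m + 1), (-1 : ℂ) ^ ((k : ℕ) + 1) *
      τ.onTraceClass (contractionOperator ρ χ F D a k) =
      τ.onTraceClass (χ * F * contractionSum ρ F D a) := by
    rw [← sum_prod_ofFn_contraction, Finset.mul_sum, onTraceClass_sum]
    · refine Finset.sum_congr rfl fun k _ => ?_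
      rw [mul_smul_comm]
      exact (onTraceClass_smul (h1 k) _).symm
    · intro k
      rw [mul_smul_comm]
      exact τ.traceClass.smul_mem _ (h1 k)
  rw [h2, characterCoeff]

theorem commutator_eq_zero_of_scalar {x : A} (hx : ∃ c : ℂ, x = algebraMap ℂ A c) :
    ⁅F, ρ x⁆ = 0 := by
  obtain ⟨c, rfl⟩ := hx
  rw [Ring.lie_def, AlgHomClass.commutes ρ c, Algebra.commutes, sub_self]

theorem _root_.BreuerFredholm.IsConnesCharacter.vanishesOnScalars {n : ℕ} {φ : Cochain A n}
    (h : IsConnesCharacter τ ρ χ F φ) : VanishesOnScalars φ := by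
  intro a i hi
  rw [(h a).2, characterOperator, List.prod_eq_zero, mul_zero, onTraceClass_zero, mul_zero]
  exact List.mem_ofFn.2 ⟨i, commutator_eq_zero_of_scalar hi⟩

theorem _root_.BreuerFredholm.IsContraction.vanishesOnScalars {φ : Cochain A m}
    (h : IsContraction τ ρ χ F D φ) : VanishesOnScalars φ := by
  intro a i hi
  rw [(h a).2, Finset.sum_eq_zero, mul_zero]
  intro k _
  rw [contractionOperator, List.prod_eq_zero, mul_zero, onTraceClass_zero, mul_zero]
  refine List.mem_ofFn.2 ⟨i, ?_⟩
  rw [commutator_eq_zero_of_scalar hi, zero_mul, ite_self]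

theorem _root_.BreuerFredholm.IsConnesCharacter.hochschildb_eq_zero
    (hS : IsGradedSymmetry N ρ m χ F) (h : ∀ a, ∃ c, τ.HasSize e c ⁅F, ρ a⁆)
    (hm : ((m + 1 : ℕ) : ℝ) * e = 1) {φ : Cochain A (m + 1)} (hφ : IsConnesCharacter τ ρ χ F φ) :
    hochschildb (m + 1) φ = 0 := by
  rw [isConnesCharacter_iff hS h hm] at hφ
  ext a
  rw [hochschildb_apply]
  have h1 := trace_commProd_hochschild hS h hm a
  simp only [hφ, smul_eq_mul] at h1 ⊢
  simp only [mul_left_comm _ (characterCoeff _), ← Finset.mul_sum, ← mul_add]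
  rw [h1, mul_zero]
  rfl

theorem _root_.BreuerFredholm.IsContraction.hochschildb_apply (hS : IsGradedSymmetry N ρ m χ F)
    (hD : IsTangent N m χ F D) (he : 0 < e) (heq : e < q)
    (hq : ∀ a, ∃ c, τ.HasSize q c ⁅F, ρ a⁆) (hm : ((m + 1 : ℕ) : ℝ) * e = 1)
    {φ : Cochain A m} (hφ : IsContraction τ ρ χ F D φ) (a : Fin (m + 2) → A) :
    hochschildb m φ a =
      characterCoeff (m + 1) *
        τ.onTraceClass (χ * D * commProd ρ F a + χ * F * commProdDeriv ρ F D a) := by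
  rw [isContraction_iff hS (exists_hasSize_of_lt he heq hq) hm hD.mem] at hφ
  rw [BreuerFredholm.hochschildb_apply, ← trace_contractionSum_hochschild hS hD he heq hq hm a]
  simp only [hφ, smul_eq_mul, mul_left_comm _ (characterCoeff _), ← Finset.mul_sum, ← mul_add]

/-! ### Uniform estimates along convergent families -/

section Uniform

variable [CompleteSpace A] {ι : Type*} {l : Filter ι} {G K : ι → H →L[ℂ] H}

omit [CompleteSpace A] in
theorem uniformBounded_rho (hS : IsGradedSymmetry N ρ m χ F) (hρ : Continuous ρ) :
    τ.UniformBounded l 0 fun _ (x : {x : A // ‖x‖ ≤ 1}) => ρ x := by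
  let L : A →L[ℂ] (H →L[ℂ] H) := ⟨(ρ : A →ₗ[ℂ] (H →L[ℂ] H)), hρ⟩
  exact .of_norm_le (.of_forall fun _ x => hS.rho_mem x)
    (.of_forall fun _ x => L.unit_le_opNorm x x.2)

theorem uniformBounded_commutator [l.IsCountablyGenerated] (hρ : Continuous ρ)
    (h : ∀ a, ∃ c, ∀ᶠ s in l, τ.HasSize q c ⁅G s, ρ a⁆) :
    τ.UniformBounded l q fun s (x : {x : A // ‖x‖ ≤ 1}) => ⁅G s, ρ x⁆ := by
  let L : A →L[ℂ] (H →L[ℂ] H) := ⟨(ρ : A →ₗ[ℂ] (H →L[ℂ] H)), hρ⟩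
  obtain ⟨C, hC⟩ := exists_uniform_hasSize (τ := τ) (l := l) (e := q)
    (fun s => (ContinuousLinearMap.mul ℂ (H →L[ℂ] H) (G s) -
      (ContinuousLinearMap.mul ℂ (H →L[ℂ] H)).flip (G s)) ∘L L) h
  exact ⟨C, hC.mono fun s hs x => hs x x.2⟩

/-- The Baire bound at exponent `q` is interpolated with `‖[G s - F, ρ x]‖ ≤ ‖G s - F‖ · 2‖ρ‖`. -/
theorem uniformSmall_commutator [l.IsCountablyGenerated] (hρ : Continuous ρ) (hG : Tendsto G l (𝓝 F)) (he : 0 < e) (heq : e < q)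
    (h : ∀ a, ∃ c, ∀ᶠ s in l, τ.HasSize q c ⁅G s, ρ a⁆)
    (h₀ : ∀ a, ∃ c, τ.HasSize q c ⁅F, ρ a⁆) :
    (τ.UniformSmall l e fun s (x : {x : A // ‖x‖ ≤ 1}) => ⁅G s, ρ x⁆ - ⁅F, ρ x⁆) ∧
      τ.UniformBounded l e fun _ (x : {x : A // ‖x‖ ≤ 1}) => ⁅F, ρ x⁆ := by
  let L : A →L[ℂ] (H →L[ℂ] H) := ⟨(ρ : A →ₗ[ℂ] (H →L[ℂ] H)), hρ⟩
  have hL : ∀ x : {x : A // ‖x‖ ≤ 1}, ‖ρ x‖ ≤ ‖L‖ := fun x => L.unit_le_opNorm x x.2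
  have hn : ∀ (T : H →L[ℂ] H) (x : {x : A // ‖x‖ ≤ 1}), ‖⁅T, ρ x⁆‖ ≤ ‖T‖ * (2 * ‖L‖) := by
    intro T x
    rw [Ring.lie_def]
    refine (norm_sub_le _ _).trans ((add_le_add (norm_mul_le _ _) (norm_mul_le _ _)).trans ?_)
    have h1 := mul_le_mul_of_nonneg_left (hL x) (norm_nonneg T)
    linarith
  have h1 := uniformBounded_commutator (l := l) hρ h
  have h2 := uniformBounded_commutator (τ := τ) (l := l) (G := fun _ => F) hρ
    fun a => (h₀ a).imp fun c hc => .of_forall fun _ => hc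
  refine ⟨.interpolate (h1.sub h2) (g := fun s => ‖G s - F‖ * (2 * ‖L‖)) ?_
    (.of_forall fun s x => ?_) he heq, h2.interpolate (.of_forall fun _ => hn F) he heq⟩
  · simpa using (tendsto_iff_norm_sub_tendsto_zero.1 hG).mul_const (2 * ‖L‖)
  · have h3 : ⁅G s, ρ x⁆ - ⁅F, ρ x⁆ = ⁅G s - F, ρ x⁆ := by
      simp only [Ring.lie_def]
      noncomm_ring
    rw [h3]
    exact hn _ x

theorem exists_isConnesCharacter (hS : IsGradedSymmetry N ρ m χ F) (hρ : Continuous ρ)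
    (he : 0 < e) (heq : e < q) (hq : ∀ a, ∃ c, τ.HasSize q c ⁅F, ρ a⁆)
    (hm : ((m + 1 : ℕ) : ℝ) * e = 1) : ∃ φ : Cochain A (m + 1), IsConnesCharacter τ ρ χ F φ := by
  have h := exists_hasSize_of_lt he heq hq
  have hG := mul_mem hS.chi_mem hS.mem
  -- For a constant family and a trivial filter, the uniform estimates reduce to boundedness of one
  -- multilinear map on the unit ball.
  obtain ⟨h1, h2⟩ := uniformSmall_commutator (l := pure ()) (G := fun _ => F) hρ
    tendsto_const_nhds he heq (fun a => (hq a).imp fun c hc => .of_forall fun _ => hc) hq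
  have h3 := (uniformSmall_commProd_succ (F := fun _ => F) (uniformBounded_rho hS hρ)
    (by simpa only [sub_self] using UniformSmall.zero 0) (.const hS.mem) h1 h2 (m + 1)).2
  rw [hm] at h3
  have h4 := (UniformBounded.const (τ := τ) hG).mul h3
  rw [zero_add] at h4
  obtain ⟨C, hC⟩ := h4
  let M : MultilinearMap ℂ (fun _ : Fin (m + 2) => A) (H →L[ℂ] H) :=
    (LinearMap.mulLeft ℂ (χ * F)).compMultilinearMap
      ((MultilinearMap.mkPiAlgebraFin ℂ (m + 2) (H →L[ℂ] H)).compLinearMap fun _ =>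
        (LinearMap.mulLeft ℂ F - LinearMap.mulRight ℂ F) ∘ₗ (ρ : A →ₗ[ℂ] (H →L[ℂ] H)))
  have hM : ∀ a, M a = χ * F * commProd ρ F a := by
    intro a
    rw [← prod_ofFn_commutator]
    rfl
  obtain ⟨φ, hφ⟩ := exists_cochain (τ := τ) M (fun a => by
    rw [hM]
    exact mul_mem_traceClass' (commProd_mem_traceClass_succ hS h hm a) hG) (C := C) (fun a ha => by
    have h5 : τ.HasSize 1 C (χ * F * commProd (fun x : {x : A // ‖x‖ ≤ 1} => ρ x) F
      fun i => ⟨a i, ha i⟩) := hC _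
    rw [commProd_comp ρ (g := Subtype.val)] at h5
    rw [hM]
    exact h5) _
  refine ⟨φ, (isConnesCharacter_iff hS h hm).2 fun a => ?_⟩
  rw [hφ, hM]

theorem exists_isContraction (hS : IsGradedSymmetry N ρ m χ F) (hρ : Continuous ρ) (hD : D ∈ N)
    (he : 0 < e) (heq : e < q) (hq : ∀ a, ∃ c, τ.HasSize q c ⁅F, ρ a⁆)
    (hm : ((m + 1 : ℕ) : ℝ) * e = 1) : ∃ φ : Cochain A m, IsContraction τ ρ χ F D φ := by
  have h := exists_hasSize_of_lt he heq hq
  have hG := mul_mem hS.chi_mem hS.mem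
  obtain ⟨h1, h2⟩ := uniformSmall_commutator (l := pure ()) (G := fun _ => F) hρ
    tendsto_const_nhds he heq (fun a => (hq a).imp fun c hc => .of_forall fun _ => hc) hq
  have h3 := (uniformSmall_contractionSum (F := fun _ => F) (D := fun _ => D) (D₀ := D) h1 h2
    (by simpa only [sub_self] using UniformSmall.zero 0) (.const hD) (m + 1)).2
  rw [hm] at h3
  have h4 := (UniformBounded.const (τ := τ) hG).mul h3
  rw [zero_add] at h4
  obtain ⟨C, hC⟩ := h4
  let E : A →ₗ[ℂ] (H →L[ℂ] H) :=
    (LinearMap.mulLeft ℂ F - LinearMap.mulRight ℂ F) ∘ₗ (ρ : A →ₗ[ℂ] (H →L[ℂ] H))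
  let M : MultilinearMap ℂ (fun _ : Fin (m + 1) => A) (H →L[ℂ] H) :=
    (LinearMap.mulLeft ℂ (χ * F)).compMultilinearMap
      (∑ k : Fin (m + 1), (-1 : ℂ) ^ ((k : ℕ) + 1) •
        (MultilinearMap.mkPiAlgebraFin ℂ (m + 1) (H →L[ℂ] H)).compLinearMap fun j =>
          if j = k then LinearMap.mulRight ℂ D ∘ₗ E else E)
  have hM : ∀ a, M a = χ * F * contractionSum ρ F D a := by
    intro a
    have h5 : ∀ k j : Fin (m + 1), (if j = k then LinearMap.mulRight ℂ D ∘ₗ E else E) (a j) =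
        if j = k then ⁅F, ρ (a j)⁆ * D else ⁅F, ρ (a j)⁆ := by
      intro k j
      split_ifs <;> rfl
    rw [← sum_prod_ofFn_contraction]
    simp only [M, LinearMap.compMultilinearMap_apply, sum_apply, smul_apply, h5,
      MultilinearMap.compLinearMap_apply, MultilinearMap.mkPiAlgebraFin_apply,
      LinearMap.mulLeft_apply]
  obtain ⟨φ, hφ⟩ := exists_cochain (τ := τ) M (fun a => by
    rw [hM]
    exact mul_mem_traceClass' (contractionSum_mem_traceClass h hm hD a) hG) (C := C)
    (fun a ha => by
      have h5 : τ.HasSize 1 C (χ * F * contractionSum (fun x : {x : A // ‖x‖ ≤ 1} => ρ x) F D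
        fun i => ⟨a i, ha i⟩) := hC _
      rw [contractionSum_comp ρ (g := Subtype.val)] at h5
      rw [hM]
      exact h5) _
  refine ⟨φ, (isContraction_iff hS h hm hD).2 fun a => ?_⟩
  rw [hφ, hM]

theorem tendsto_contraction [l.IsCountablyGenerated] (hS : IsGradedSymmetry N ρ m χ F)
    (hρ : Continuous ρ) (hD : D ∈ N) (he : 0 < e) (heq : e < q)
    (hm : ((m + 1 : ℕ) : ℝ) * e = 1) (hGS : ∀ s, IsGradedSymmetry N ρ m χ (G s))
    (hKN : ∀ s, K s ∈ N) (hG : Tendsto G l (𝓝 F)) (hK : Tendsto K l (𝓝 D))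
    (hGq : ∀ s a, ∃ c, τ.HasSize q c ⁅G s, ρ a⁆)
    (h : ∀ a, ∃ c, ∀ᶠ s in l, τ.HasSize q c ⁅G s, ρ a⁆)
    (h₀ : ∀ a, ∃ c, τ.HasSize q c ⁅F, ρ a⁆) {i : ι → Cochain A m} {i₀ : Cochain A m}
    (hi : ∀ s, IsContraction τ ρ χ (G s) (K s) (i s)) (hi₀ : IsContraction τ ρ χ F D i₀) :
    Tendsto i l (𝓝 i₀) := by
  have hχ : χ ∈ N := hS.chi_mem
  obtain ⟨h1, h2⟩ := uniformSmall_commutator hρ hG he heq h h₀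
  obtain ⟨h3, h4⟩ := uniformSmall_contractionSum h1 h2
    (.of_tendsto hK (.of_forall hKN) hD) (.const hD) (m + 1)
  rw [hm] at h3 h4
  have hGN : ∀ s, G s ∈ N := fun s => (hGS s).mem
  have h5 : τ.UniformSmall l 0 fun s (_ : Fin (m + 1) → {x : A // ‖x‖ ≤ 1}) =>
      χ * G s - χ * F :=
    .of_tendsto (hG.const_mul χ) (.of_forall fun s => mul_mem hχ (hGN s)) (mul_mem hχ hS.mem)
  have h6 := UniformSmall.mul_sub_mul h5 (.const (mul_mem hχ hS.mem)) h3 h4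
  rw [zero_add] at h6
  refine tendsto_cochain (z := characterCoeff (m + 1)) h6 (.of_forall fun s a => ?_)
  have h7 := exists_hasSize_of_lt he heq (hGq s)
  have h8 := exists_hasSize_of_lt he heq h₀
  rw [(isContraction_iff (hGS s) h7 hm (hKN s)).1 (hi s), (isContraction_iff hS h8 hm hD).1 hi₀,
    contractionSum_comp ρ (g := Subtype.val), contractionSum_comp ρ (g := Subtype.val),
    onTraceClass_sub, mul_sub]
  · exact mul_mem_traceClass' (contractionSum_mem_traceClass h7 hm (hKN s) _)
      (mul_mem hχ (hGN s))
  · exact mul_mem_traceClass' (contractionSum_mem_traceClass h8 hm hD _) (mul_mem hχ hS.mem)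

/-- The slopes of the operators inside the trace converge at exponent `1`, uniformly on the unit
ball, and the trace is bounded by the gauge at that exponent. Only the product rule enters here; the
trace identity that makes the derivative a coboundary is fed in through `hch'`. -/
theorem hasDerivWithinAt_character {I : Set ℝ} {t : ℝ} (ht : t ∈ I) {G : ℝ → H →L[ℂ] H}
    (hS : ∀ s ∈ I, IsGradedSymmetry N ρ m χ (G s)) (hρ : Continuous ρ) (he : 0 < e) (heq : e < q)
    (hm : ((m + 1 : ℕ) : ℝ) * e = 1) (hq : ∀ s ∈ I, ∀ a, ∃ c, τ.HasSize q c ⁅G s, ρ a⁆)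
    (h : ∀ a, ∃ c, ∀ᶠ s in 𝓝[I] t, τ.HasSize q c ⁅G s, ρ a⁆) (hD : D ∈ N)
    (hG : HasDerivWithinAt G D I t) {ch : ℝ → Cochain A (m + 1)} {ch' : Cochain A (m + 1)}
    (hch : ∀ s ∈ I, IsConnesCharacter τ ρ χ (G s) (ch s))
    (hch' : ∀ a, ch' a =
      characterCoeff (m + 1) *
        τ.onTraceClass (χ * D * commProd ρ (G t) a + χ * G t * commProdDeriv ρ (G t) D a)) :
    HasDerivWithinAt ch ch' I t := by
  have hSt := hS t ht
  have hχ : χ ∈ N := hSt.chi_mem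
  rw [hasDerivWithinAt_iff_tendsto_slope]
  have hI : ∀ᶠ s in 𝓝[I \ {t}] t, s ∈ I := eventually_mem_nhdsWithin.mono fun s hs => hs.1
  have hle : 𝓝[I \ {t}] t ≤ 𝓝[I] t := nhdsWithin_mono t Set.sdiff_subset
  have hGt : Tendsto G (𝓝[I \ {t}] t) (𝓝 (G t)) := hG.continuousWithinAt.tendsto.mono_left hle
  obtain ⟨h1, h2⟩ := uniformSmall_commutator hρ hGt he heq
    (fun a => (h a).imp fun c hc => hle hc) (hq t ht)
  have hslope : Tendsto (fun s => (((s - t)⁻¹ : ℝ) : ℂ) • (G s - G t)) (𝓝[I \ {t}] t) (𝓝 D) := by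
    refine (hasDerivWithinAt_iff_tendsto_slope.1 hG).congr fun s => ?_
    rw [slope_def_module, Complex.coe_smul]
  have h3 := uniformSmall_slope_mul_commProd (uniformBounded_rho hSt hρ)
    (.of_tendsto hGt (hI.mono fun s hs => (hS s hs).mem) hSt.mem) (.const hSt.mem) h1 h2
    (.of_tendsto hslope (hI.mono fun s hs => complex_smul_mem
      (sub_mem (hS s hs).mem hSt.mem) _) hD) (.const hD) hχ (m + 1)
  rw [hm] at h3
  refine tendsto_cochain (z := characterCoeff (m + 1)) h3 (hI.mono fun s hs a => ?_)
  have h7 := exists_hasSize_of_lt he heq (hq s hs)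
  have h8 := exists_hasSize_of_lt he heq (hq t ht)
  have h9 : ∀ b, slope ch t s b = (((s - t)⁻¹ : ℝ) : ℂ) * (ch s b - ch t b) := fun b => by
    rw [slope_def_module, ← Complex.real_smul]
    rfl
  have m1 := fun b => mul_mem_traceClass' (commProd_mem_traceClass_succ (hS s hs) h7 hm b)
    (mul_mem hχ (hS s hs).mem)
  have m2 := fun b => mul_mem_traceClass' (commProd_mem_traceClass_succ hSt h8 hm b)
    (mul_mem hχ hSt.mem)
  have m3 := fun b => mul_mem_traceClass' (commProd_mem_traceClass_succ hSt h8 hm b)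
    (mul_mem hχ hD)
  have m4 := fun b => mul_mem_traceClass' (commProdDeriv_mem_traceClass hSt h8 hm hD b)
    (mul_mem hχ hSt.mem)
  rw [h9, hch', (isConnesCharacter_iff (hS s hs) h7 hm).1 (hch s hs),
    (isConnesCharacter_iff hSt h8 hm).1 (hch t ht), commProd_comp ρ (g := Subtype.val),
    commProd_comp ρ (g := Subtype.val), commProdDeriv_comp ρ (g := Subtype.val),
    onTraceClass_sub (τ.traceClass.smul_mem _ (sub_mem (m1 _) (m2 _))) (add_mem (m3 _) (m4 _)),
    onTraceClass_smul (sub_mem (m1 _) (m2 _)), onTraceClass_sub (m1 _) (m2 _)]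
  ring

end Uniform

end FSNTrace

end BreuerFredholm

namespace BreuerFredholm

variable {H : Type*} [NormedAddCommGroup H] [InnerProductSpace ℂ H] [CompleteSpace H]
  {N : VonNeumannAlgebra H} {A : Type*} [NormedRing A] [NormedAlgebra ℂ A] [StarRing A]
  {τ : FSNTrace N} {ρ : A →⋆ₐ[ℂ] (H →L[ℂ] H)} {m : ℕ} {χ : H →L[ℂ] H} {e q : ℝ}

/-! ### Derivatives of families of symmetries -/

theorem _root_.Set.OrdConnected.uniqueDiffWithinAt {I : Set ℝ} (hI : I.OrdConnected)
    (hI' : I.Nontrivial) {t : ℝ} (ht : t ∈ I) : UniqueDiffWithinAt ℝ I t :=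
  uniqueDiffWithinAt_convex hI.convex (hI.convex.nontrivial_iff_nonempty_interior.1 hI')
    (subset_closure ht)

theorem isTangent_of_hasDerivWithinAt {I : Set ℝ} {t : ℝ} (hI : UniqueDiffWithinAt ℝ I t)
    (ht : t ∈ I) {G : ℝ → H →L[ℂ] H} {D : H →L[ℂ] H}
    (hS : ∀ s ∈ I, IsGradedSymmetry N ρ m χ (G s)) (hG : HasDerivWithinAt G D I t) :
    IsTangent N m χ (G t) D where
  mem := by
    have hne : (𝓝[I \ {t}] t).NeBot := accPt_principal_iff_nhdsWithin.1
      (uniqueDiffWithinAt_iff_accPt.1 hI)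
    refine isClosed_coe.mem_of_tendsto (hasDerivWithinAt_iff_tendsto_slope.1 hG)
      (eventually_mem_nhdsWithin.mono fun s hs => ?_)
    rw [slope_def_module]
    exact real_smul_mem (sub_mem (hS s hs.1).mem (hS t ht).mem) _
  mul_comm := by
    have h1 : HasDerivWithinAt (G * G) 0 I t :=
      (hasDerivWithinAt_const t I (1 : H →L[ℂ] H)).congr (fun s hs => (hS s hs).sq) (hS t ht).sq
    have h2 := hI.eq_deriv _ (hG.mul hG) h1
    exact eq_neg_of_add_eq_zero_right h2
  mul_chi := by
    have h1 : HasDerivWithinAt (fun s => G s * χ) ((-1 : ℂ) ^ m • (χ * D)) I t :=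
      ((hG.const_mul χ).const_smul ((-1 : ℂ) ^ m)).congr (fun s hs => (hS s hs).mul_chi)
        (hS t ht).mul_chi
    exact hI.eq_deriv _ (hG.mul_const χ) h1

/-! ### Integration of the homotopy formula -/

section Vanishing

variable {n : ℕ} {φ ψ : Cochain A n}

omit [StarRing A] in
theorem VanishesOnScalars.add (hφ : VanishesOnScalars φ) (hψ : VanishesOnScalars ψ) :
    VanishesOnScalars (φ + ψ) := fun a i hi => by
  change φ a + ψ a = 0
  rw [hφ a i hi, hψ a i hi, add_zero]

omit [StarRing A] in
theorem VanishesOnScalars.neg (hφ : VanishesOnScalars φ) : VanishesOnScalars (-φ) :=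
  fun a i hi => by
    change -φ a = 0
    rw [hφ a i hi, neg_zero]

end Vanishing

omit [StarRing A] in
-- The fundamental theorem of calculus with `θ = ∫ i`. Both sides are evaluated on a fixed tuple,
-- where `b` becomes a continuous functional and commutes with the integral.
theorem exists_hochschildb_eq_sub {ch : ℝ → Cochain A (m + 1)} {i : ℝ → Cochain A m}
    (hi : Continuous i) (hv : ∀ s, VanishesOnScalars (i s))
    (h : ∀ s ∈ Set.Icc (0 : ℝ) 1, HasDerivWithinAt ch (hochschildb m (i s)) (Set.Icc 0 1) s) :
    ∃ θ : Cochain A m, VanishesOnScalars θ ∧ hochschildb m θ = ch 1 - ch 0 := by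
  let ev : (Fin (m + 1) → A) → Cochain A m →L[ℂ] ℂ := fun a =>
    ContinuousMultilinearMap.apply ℂ (fun _ : Fin (m + 1) => A) ℂ a
  have hint : IntervalIntegrable i MeasureTheory.volume 0 1 := hi.intervalIntegrable 0 1
  refine ⟨∫ s in (0 : ℝ)..1, i s, fun a j hj => ?_, ?_⟩
  · change ev a (∫ s in (0 : ℝ)..1, i s) = 0
    rw [← (ev a).intervalIntegral_comp_comm hint]
    have h1 : ∀ s, ev a (i s) = 0 := fun s => hv s a j hj
    simp only [h1, intervalIntegral.integral_zero]
  · ext a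
    let L : Cochain A m →L[ℂ] ℂ := ∑ j : Fin (m + 1), (-1 : ℂ) ^ (j : ℕ) • ev (face j a) +
      (-1 : ℂ) ^ (m + 1) • ev (lastFace a)
    have hL : ∀ φ, L φ = hochschildb m φ a := fun φ => by
      rw [hochschildb_apply]
      simp [L, ev]
    let L' : Cochain A (m + 1) →L[ℂ] ℂ :=
      ContinuousMultilinearMap.apply ℂ (fun _ : Fin (m + 2) => A) ℂ a
    have hd : ∀ s ∈ Set.Icc (0 : ℝ) 1,
        HasDerivWithinAt (fun s => ch s a) (L (i s)) (Set.Icc 0 1) s := fun s hs => by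
      rw [hL]
      exact ((L'.restrictScalars ℝ).hasFDerivAt).comp_hasDerivWithinAt s (h s hs)
    rw [← hL, ← L.intervalIntegral_comp_comm hint,
      intervalIntegral.integral_eq_sub_of_hasDerivAt_of_le zero_le_one
        (fun s hs => (hd s hs).continuousWithinAt)
        (fun s hs => (hd s (Set.Ioo_subset_Icc_self hs)).hasDerivAt (Icc_mem_nhds hs.1 hs.2))
        ((L.continuous.comp hi).intervalIntegrable 0 1)]
    rfl

namespace FSNTrace

variable [CompleteSpace A]

/-- For a `C¹` path of symmetries with locally bounded commutators the contraction depends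
continuously on the parameter, so the homotopy formula can be integrated. -/
theorem exists_hochschildb_of_path (hρ : Continuous ρ) (he : 0 < e) (heq : e < q)
    (hm : ((m + 1 : ℕ) : ℝ) * e = 1) {G K : ℝ → H →L[ℂ] H}
    (hS : ∀ s ∈ Set.Icc (0 : ℝ) 1, IsGradedSymmetry N ρ m χ (G s))
    (hG : ∀ s ∈ Set.Icc (0 : ℝ) 1, HasDerivWithinAt G (K s) (Set.Icc 0 1) s)
    (hK : ContinuousOn K (Set.Icc 0 1))
    (hb : ∀ s ∈ Set.Icc (0 : ℝ) 1, ∀ a, ∃ c, ∀ᶠ u in 𝓝[Set.Icc 0 1] s,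
      τ.HasSize q c ⁅G u, ρ a⁆)
    {φ₀ φ₁ : Cochain A (m + 1)} (hφ₀ : IsConnesCharacter τ ρ χ (G 0) φ₀)
    (hφ₁ : IsConnesCharacter τ ρ χ (G 1) φ₁) :
    ∃ θ : Cochain A m, VanishesOnScalars θ ∧ hochschildb m θ = φ₁ - φ₀ := by
  have hq : ∀ s ∈ Set.Icc (0 : ℝ) 1, ∀ a, ∃ c, τ.HasSize q c ⁅G s, ρ a⁆ := fun s hs a =>
    (hb s hs a).imp fun c hc => hc.self_of_nhdsWithin hs
  have hT : ∀ s ∈ Set.Icc (0 : ℝ) 1, IsTangent N m χ (G s) (K s) := fun s hs =>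
    isTangent_of_hasDerivWithinAt (uniqueDiffOn_Icc zero_lt_one s hs) hs hS (hG s hs)
  have hex := fun s hs => exists_isConnesCharacter (hS s hs) hρ he heq (hq s hs) hm
  have hei := fun s hs => exists_isContraction (hS s hs) hρ (hT s hs).mem he heq (hq s hs) hm
  choose ch hch using hex
  choose i hi using hei
  have huniq : ∀ s (hs : s ∈ Set.Icc (0 : ℝ) 1) (φ : Cochain A (m + 1)),
      IsConnesCharacter τ ρ χ (G s) φ → ch s hs = φ := fun s hs φ hφ => by
    ext a
    rw [(hch s hs a).2, (hφ a).2]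
  let ch' : ℝ → Cochain A (m + 1) := fun s => if hs : s ∈ Set.Icc (0 : ℝ) 1 then ch s hs else 0
  have hch' : ∀ s ∈ Set.Icc (0 : ℝ) 1, IsConnesCharacter τ ρ χ (G s) (ch' s) := fun s hs => by
    simp only [ch', dif_pos hs]
    exact hch s hs
  let i' : Set.Icc (0 : ℝ) 1 → Cochain A m := fun s => i s s.2
  have hcont : Continuous i' := by
    refine continuous_iff_continuousAt.2 fun s => ?_
    have hcoe : Tendsto ((↑) : Set.Icc (0 : ℝ) 1 → ℝ) (𝓝 s) (𝓝[Set.Icc 0 1] (s : ℝ)) :=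
      tendsto_nhdsWithin_iff.2 ⟨continuous_subtype_val.tendsto s, .of_forall fun u => u.2⟩
    exact tendsto_contraction (G := fun u : Set.Icc (0 : ℝ) 1 => G u) (K := fun u => K u)
      (hS s s.2) hρ (hT s s.2).mem he heq hm (fun u => hS u u.2) (fun u => (hT u u.2).mem)
      ((hG s s.2).continuousWithinAt.tendsto.comp hcoe) ((hK s s.2).tendsto.comp hcoe)
      (fun u => hq u u.2) (fun a => (hb s s.2 a).imp fun c hc => hcoe.eventually hc) (hq s s.2)
      (fun u => hi u u.2) (hi s s.2)
  obtain ⟨θ, h1, h2⟩ := exists_hochschildb_eq_sub (ch := ch') (i := Set.IccExtend zero_le_one i')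
    hcont.Icc_extend' (fun s => (hi _ _).vanishesOnScalars) fun s hs => by
      rw [Set.IccExtend_of_mem _ _ hs]
      exact hasDerivWithinAt_character hs hS hρ he heq hm hq (hb s hs) (hT s hs).mem (hG s hs) hch'
        (IsContraction.hochschildb_apply (hS s hs) (hT s hs) he heq (hq s hs) hm (hi s hs))
  refine ⟨θ, h1, ?_⟩
  have h01 : (0 : ℝ) ∈ Set.Icc (0 : ℝ) 1 := ⟨le_rfl, zero_le_one⟩
  have h11 : (1 : ℝ) ∈ Set.Icc (0 : ℝ) 1 := ⟨zero_le_one, le_rfl⟩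
  rw [h2]
  simp only [ch', dif_pos h01, dif_pos h11, huniq _ _ _ hφ₀, huniq _ _ _ hφ₁]

/-- Nearby symmetries are conjugate by an explicit path of invertible operators, along which the
homotopy formula can be integrated. -/
theorem exists_hochschildb_of_norm_sub_lt (hρ : Continuous ρ) (he : 0 < e) (heq : e < q)
    (hm : ((m + 1 : ℕ) : ℝ) * e = 1) {F₀ F₁ : H →L[ℂ] H} (h₀ : IsGradedSymmetry N ρ m χ F₀)
    (h₁ : IsGradedSymmetry N ρ m χ F₁) (hq₀ : ∀ a, ∃ c, τ.HasSize q c ⁅F₀, ρ a⁆)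
    (hq₁ : ∀ a, ∃ c, τ.HasSize q c ⁅F₁, ρ a⁆) (hlt : ‖F₁ - F₀‖ * ‖F₀‖ < 1)
    {φ₀ φ₁ : Cochain A (m + 1)} (hφ₀ : IsConnesCharacter τ ρ χ F₀ φ₀)
    (hφ₁ : IsConnesCharacter τ ρ χ F₁ φ₁) :
    ∃ θ : Cochain A m, VanishesOnScalars θ ∧ hochschildb m θ = φ₁ - φ₀ := by
  -- Chosen so that `1 - V = (1 + F₁F₀)/2`, which intertwines `F₀` and `F₁`. The bound on `‖F₁ - F₀‖
  -- ‖F₀‖` gives `‖V‖ < 1`, so `1 - sV` is invertible for `0 ≤ s ≤ 1`.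
  set V : H →L[ℂ] H := (2⁻¹ : ℂ) • ((F₀ - F₁) * F₀) with hVdef
  have hVN : V ∈ N := complex_smul_mem (mul_mem (sub_mem h₀.mem h₁.mem) h₀.mem) _
  have hVn : ‖V‖ < 1 := by
    rw [hVdef, norm_smul]
    have h1 := norm_mul_le (F₀ - F₁) F₀
    rw [norm_sub_rev] at h1
    have h2 : ‖(2⁻¹ : ℂ)‖ = 2⁻¹ := by simp
    rw [h2]
    linarith
  have hVχ : χ * V = V * χ := by
    have h1 : (F₀ - F₁) * χ = (-1 : ℂ) ^ m • (χ * (F₀ - F₁)) := by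
      rw [sub_mul, h₀.mul_chi, h₁.mul_chi, mul_sub, smul_sub]
    rw [hVdef, smul_mul_assoc, mul_smul_comm, mul_assoc, h₀.mul_chi, mul_smul_comm,
      ← mul_assoc (F₀ - F₁) χ, h1, smul_mul_assoc, smul_smul ((-1 : ℂ) ^ m), ← mul_pow,
      neg_mul_neg, one_mul, one_pow, one_smul, mul_assoc]
  -- The scalar `s` as an operator, so that it enters the gauge estimates as a factor of exponent
  -- `0`.
  let E : ℝ → H →L[ℂ] H := fun s => (s : ℂ) • 1
  let U : ℝ → H →L[ℂ] H := fun s => 1 - E s * V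
  let W : ℝ → H →L[ℂ] H := fun s => Ring.inverse (U s)
  let G : ℝ → H →L[ℂ] H := fun s => U s * F₀ * W s
  let K : ℝ → H →L[ℂ] H := fun s => -V * F₀ * W s + U s * F₀ * (W s * V * W s)
  have hEN : ∀ s, E s ∈ N := fun s => complex_smul_mem (one_mem N) _
  have hUN : ∀ s, U s ∈ N := fun s => sub_mem (one_mem N) (mul_mem (hEN s) hVN)
  have hWN : ∀ s, W s ∈ N := fun s => ringInverse_mem (hUN s)
  have hunit : ∀ s ∈ Set.Icc (0 : ℝ) 1, IsUnit (U s) := fun s hs => by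
    refine isUnit_one_sub_of_norm_lt_one ?_
    simp only [E, smul_mul_assoc, one_mul, norm_smul, Complex.norm_real]
    rw [Real.norm_of_nonneg hs.1]
    exact (mul_le_of_le_one_left (norm_nonneg V) hs.2).trans_lt hVn
  have hWU : ∀ s ∈ Set.Icc (0 : ℝ) 1, W s * U s = 1 := fun s hs =>
    Ring.inverse_mul_cancel _ (hunit s hs)
  have hUW : ∀ s ∈ Set.Icc (0 : ℝ) 1, U s * W s = 1 := fun s hs =>
    Ring.mul_inverse_cancel _ (hunit s hs)
  have hUd : ∀ s, HasDerivAt U (-V) s := fun s => by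
    have h1 : HasDerivAt (fun s : ℝ => (s : ℂ) • V) ((1 : ℂ) • V) s :=
      (Complex.ofRealCLM.hasDerivAt (x := s)).smul_const V
    have h2 := h1.const_sub (1 : H →L[ℂ] H)
    rw [one_smul] at h2
    have h3 : U = fun s : ℝ => 1 - (s : ℂ) • V := funext fun s => by
      simp only [U, E, smul_mul_assoc, one_mul]
    rw [h3]
    exact h2
  have hWd : ∀ s ∈ Set.Icc (0 : ℝ) 1, HasDerivAt W (W s * V * W s) s := fun s hs => by
    obtain ⟨u, hu⟩ := hunit s hs
    have h1 := hasFDerivAt_ringInverse (𝕜 := ℝ) u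
    rw [hu] at h1
    have h2 : W s = ↑u⁻¹ := by simp only [W, ← hu, Ring.inverse_unit]
    have h3 : (-((ContinuousLinearMap.mulLeftRight ℝ (H →L[ℂ] H)) ↑u⁻¹) ↑u⁻¹) (-V) =
        W s * V * W s := by
      rw [h2]
      simp
    rw [← h3]
    exact h1.comp_hasDerivAt s (hUd s)
  have hcE : Continuous E := by fun_prop
  have hcU : Continuous U := by fun_prop
  have hcW : ContinuousOn W (Set.Icc 0 1) := fun s hs =>
    (hWd s hs).continuousAt.continuousWithinAt
  have hWχ : ∀ s, W s * χ = χ * W s := fun s => by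
    refine commute_ringInverse (x := U s) (y := χ) ?_
    change U s * χ = χ * U s
    simp only [U, E, smul_mul_assoc, one_mul, sub_mul, mul_sub, mul_one, mul_smul_comm, hVχ]
  have hS : ∀ s ∈ Set.Icc (0 : ℝ) 1, IsGradedSymmetry N ρ m χ (G s) := fun s hs =>
    { rho_mem := h₀.rho_mem
      mem := mul_mem (mul_mem (hUN s) h₀.mem) (hWN s)
      sq := by
        calc U s * F₀ * W s * (U s * F₀ * W s) = U s * F₀ * (W s * U s) * F₀ * W s := by
              simp only [mul_assoc]
          _ = U s * (F₀ * F₀) * W s := by rw [hWU s hs]; simp only [mul_assoc, one_mul]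
          _ = 1 := by rw [h₀.sq, mul_one, hUW s hs]
      chi_mem := h₀.chi_mem
      chi_comm := h₀.chi_comm
      mul_chi := by
        have h1 : U s * χ = χ * U s := by
          simp only [U, E, smul_mul_assoc, one_mul, sub_mul, mul_sub, mul_one, mul_smul_comm, hVχ]
        simp only [G]
        rw [mul_assoc, hWχ, ← mul_assoc, mul_assoc (U s), h₀.mul_chi, mul_smul_comm, ← mul_assoc,
          h1, smul_mul_assoc]
        simp only [mul_assoc] }
  have hG : ∀ s ∈ Set.Icc (0 : ℝ) 1, HasDerivAt G (K s) s := fun s hs =>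
    ((hUd s).mul_const F₀).mul (hWd s hs)
  have hK : ContinuousOn K (Set.Icc 0 1) := by fun_prop
  -- Each term contains exactly one factor `[V,a]` or `[F₀,a]`, independent of `s`, and otherwise
  -- norm-continuous factors. Hence the commutators are locally bounded at exponent `q` along this
  -- path, which is not known along the original family.
  have hGa : ∀ s ∈ Set.Icc (0 : ℝ) 1, ∀ a, ⁅G s, ρ a⁆ =
      -(E s * ⁅V, ρ a⁆ * (F₀ * W s)) + U s * ⁅F₀, ρ a⁆ * W s +
        G s * E s * ⁅V, ρ a⁆ * W s := fun s hs a => by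
    have h1 : ⁅U s, ρ a⁆ = -(E s * ⁅V, ρ a⁆) := by
      simp only [U, E, Ring.lie_def, smul_mul_assoc, one_mul, sub_mul, mul_sub, mul_one,
        mul_smul_comm]
      abel
    have h2 : ⁅W s, ρ a⁆ = -(W s * ⁅U s, ρ a⁆ * W s) := by
      calc W s * ρ a - ρ a * W s = W s * ρ a * (U s * W s) - W s * U s * ρ a * W s := by
            rw [hUW s hs, hWU s hs, mul_one, one_mul]
        _ = -(W s * (U s * ρ a - ρ a * U s) * W s) := by noncomm_ring
    have h3 : ⁅G s, ρ a⁆ = ⁅U s, ρ a⁆ * (F₀ * W s) + U s * ⁅F₀, ρ a⁆ * W s +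
        U s * F₀ * ⁅W s, ρ a⁆ := by
      simp only [G, Ring.lie_def]
      noncomm_ring
    rw [h3, h2, h1]
    simp only [G]
    noncomm_ring
  have hVa : ∀ a, ∃ c, τ.HasSize q c ⁅V, ρ a⁆ := fun a => by
    obtain ⟨c, hc⟩ := hq₀ a
    obtain ⟨d, hd⟩ := hq₁ a
    obtain ⟨u, hu⟩ := (hc.sub hd).mul_bounded h₀.mem
    obtain ⟨v, hv⟩ := hc.bounded_mul (sub_mem h₀.mem h₁.mem)
    have h1 := (hu.add hv).smul (z := 2⁻¹) one_pos (by norm_num)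
    have h2 : ⁅V, ρ a⁆ = (2⁻¹ : ℂ) • ((⁅F₀, ρ a⁆ - ⁅F₁, ρ a⁆) * F₀ +
        (F₀ - F₁) * ⁅F₀, ρ a⁆) := by
      simp only [hVdef, Ring.lie_def, smul_mul_assoc, mul_smul_comm, ← smul_sub]
      congr 1
      noncomm_ring
    rw [h2]
    exact ⟨_, h1⟩
  have hb : ∀ s ∈ Set.Icc (0 : ℝ) 1, ∀ a, ∃ c, ∀ᶠ u in 𝓝[Set.Icc 0 1] s,
      τ.HasSize q c ⁅G u, ρ a⁆ := fun s hs a => by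
    have hfam : ∀ {R : ℝ → H →L[ℂ] H}, ContinuousOn R (Set.Icc 0 1) → (∀ u, R u ∈ N) →
        τ.UniformBounded (𝓝[Set.Icc 0 1] s) 0 fun u (_ : Unit) => R u := fun {R} hR hN =>
      .of_sub_small (R₀ := fun _ => R s) (.of_tendsto (hR s hs) (.of_forall hN) (hN s))
        (.const (hN s))
    have hcst : ∀ {T : H →L[ℂ] H}, (∃ c, τ.HasSize q c T) →
        τ.UniformBounded (𝓝[Set.Icc 0 1] s) q fun _ (_ : Unit) => T := fun {T} hT =>
      hT.imp fun c hc => .of_forall fun _ _ => hc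
    have hGN : ∀ u, G u ∈ N := fun u => mul_mem (mul_mem (hUN u) h₀.mem) (hWN u)
    have hcG : ContinuousOn G (Set.Icc 0 1) := fun u hu =>
      (hG u hu).continuousAt.continuousWithinAt
    have t1 := ((hfam hcE.continuousOn hEN).mul (hcst (hVa a))).mul
      (hfam (R := fun u => F₀ * W u) (by fun_prop) fun u => mul_mem h₀.mem (hWN u))
    have t2 := ((hfam hcU.continuousOn hUN).mul (hcst (hq₀ a))).mul (hfam hcW hWN)
    have t3 := ((hfam (R := fun u => G u * E u) (by fun_prop)
      fun u => mul_mem (hGN u) (hEN u)).mul (hcst (hVa a))).mul (hfam hcW hWN)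
    rw [zero_add, add_zero] at t1 t2 t3
    obtain ⟨c, hc⟩ := (t1.neg.add t2).add t3
    refine ⟨c, (hc.and eventually_mem_nhdsWithin).mono fun u hu => ?_⟩
    rw [hGa u hu.2 a]
    exact hu.1 ()
  have h01 : (0 : ℝ) ∈ Set.Icc (0 : ℝ) 1 := ⟨le_rfl, zero_le_one⟩
  have h11 : (1 : ℝ) ∈ Set.Icc (0 : ℝ) 1 := ⟨zero_le_one, le_rfl⟩
  have hG0 : G 0 = F₀ := by
    have h1 : U 0 = 1 := by simp [U, E]
    simp [G, W, h1]
  have hG1 : G 1 = F₁ := by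
    have h1 : U 1 = (2⁻¹ : ℂ) • (1 + F₁ * F₀) := by
      simp only [U, E, hVdef, sub_mul, h₀.sq, Complex.ofReal_one, one_smul, one_mul]
      module
    have h2 : U 1 * F₀ = F₁ * U 1 := by
      rw [h1, smul_mul_assoc, mul_smul_comm, add_mul, mul_add, mul_assoc, h₀.sq, ← mul_assoc, h₁.sq,
        mul_one, one_mul, add_comm]
    simp only [G]
    rw [h2, mul_assoc, hUW 1 h11, mul_one]
  exact exists_hochschildb_of_path hρ he heq hm hS (fun s hs => (hG s hs).hasDerivWithinAt) hK hb
    (by rwa [hG0]) (by rwa [hG1])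

theorem hasSize_of_pNorm_le {p : ℝ} (hp : 0 < p) {C : NNReal} {T : H →L[ℂ] H} (hT : T ∈ N)
    (h : τ.pNorm p T ≤ C) :
    τ.HasSize (1 / p) ((2 * ((C : ℝ) ^ p + 1)) ^ (1 / p)) T := by
  -- The `+ 1` keeps the bound on the trace positive when `C = 0`.
  refine HasSize.of_val_le τ hp (by positivity) hT ?_
  rw [pNorm, one_div, ENNReal.rpow_inv_le_iff hp] at h
  refine h.trans ?_
  rw [ENNReal.ofReal_add (by positivity) zero_le_one, ← ENNReal.ofReal_rpow_of_nonneg (by simp) hp.le,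
    ENNReal.ofReal_coe_nnreal]
  exact le_self_add

end FSNTrace

theorem IsOddModule.isGradedSymmetry {F : H →L[ℂ] H} (h : IsOddModule τ ρ F) (hm : Even m) :
    IsGradedSymmetry N ρ m 1 F where
  rho_mem := h.rho_mem
  mem := h.mem
  sq := h.sq
  chi_mem := one_mem N
  chi_comm a := by rw [one_mul, mul_one]
  mul_chi := by rw [hm.neg_one_pow, one_smul, one_mul, mul_one]

theorem IsEvenModule.isGradedSymmetry {F : H →L[ℂ] H} (h : IsEvenModule τ ρ χ F) (hm : Odd m) :
    IsGradedSymmetry N ρ m χ F where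
  rho_mem := h.rho_mem
  mem := h.mem
  sq := h.sq
  chi_mem := h.chi_mem
  chi_comm := h.rho_even
  mul_chi := by rw [hm.neg_one_pow, neg_smul, one_smul, h.odd, neg_neg]

end BreuerFredholm

/-! ### The main theorem -/

theorem theorem1p4
    {H : Type*} [NormedAddCommGroup H] [InnerProductSpace ℂ H] [CompleteSpace H]
    {A : Type*} [NormedRing A] [NormedAlgebra ℂ A] [CompleteSpace A] [StarRing A] [StarModule ℂ A]
    (N : VonNeumannAlgebra H) (τ : BreuerFredholm.FSNTrace N)
    (ρ : A →⋆ₐ[ℂ] (H →L[ℂ] H)) (χ : H →L[ℂ] H)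
    (I : Set ℝ) (hI : I.OrdConnected) (hI' : I.Nontrivial)
    (F : ℝ → (H →L[ℂ] H)) (hF : ContinuousOn F I)
    (p : ℝ) (hp : 0 < p) (m : ℕ) (hpm : p < ((m + 1 : ℕ) : ℝ))
    (hmod : (Even (m + 1) ∧ ∀ t ∈ I, BreuerFredholm.IsEvenModule τ ρ χ (F t)) ∨
      (Odd (m + 1) ∧ χ = 1 ∧ ∀ t ∈ I, BreuerFredholm.IsOddModule τ ρ (F t)))
    (hsum : ∀ t ∈ I, BreuerFredholm.IsSummableModule τ p ρ (F t)) :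
    ∃ ch : ℝ → BreuerFredholm.Cochain A (m + 1),
      (∀ t ∈ I, BreuerFredholm.IsConnesCharacter τ ρ χ (F t) (ch t)) ∧
      (∃ hch : ∀ t ∈ I, (Pi.single (m + 1) (ch t) : BreuerFredholm.CochainSeq A) ∈
          BreuerFredholm.entireCocycles A,
        ∀ (s : ℝ) (hs : s ∈ I) (t : ℝ) (ht : t ∈ I),
          BreuerFredholm.HE.mk _ (hch s hs) = BreuerFredholm.HE.mk _ (hch t ht)) ∧
      ∀ t ∈ I, ∀ D : H →L[ℂ] H, HasDerivWithinAt F D I t →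
        (∀ a : A, ∃ C : NNReal, ∀ᶠ s in 𝓝[I] t, τ.pNorm p ⁅F s, ρ a⁆ ≤ C) →
        ∃ i : BreuerFredholm.Cochain A m,
          BreuerFredholm.IsContraction τ ρ χ (F t) D i ∧
          (Pi.single m i : BreuerFredholm.CochainSeq A) ∈ BreuerFredholm.entireCochains A ∧
          ∃ ch' : BreuerFredholm.Cochain A (m + 1),
            HasDerivWithinAt ch ch' I t ∧
            (Pi.single (m + 1) ch' : BreuerFredholm.CochainSeq A) =
              BreuerFredholm.totalbB (Pi.single m i) := by
  classical
  have hS : ∀ t ∈ I, BreuerFredholm.IsGradedSymmetry N ρ m χ (F t) := by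
    rcases hmod with ⟨h1, h2⟩ | ⟨h1, h2, h3⟩
    · exact fun t ht => (h2 t ht).isGradedSymmetry (by simpa [Nat.even_add_one] using h1)
    · subst h2
      exact fun t ht => (h3 t ht).isGradedSymmetry (by simpa [Nat.odd_add_one] using h1)
  have hρ : Continuous ρ := by
    obtain ⟨t, ht⟩ := hI'.nonempty
    rcases hmod with ⟨-, h2⟩ | ⟨-, -, h3⟩
    exacts [(h2 t ht).rho_continuous, (h3 t ht).rho_continuous]
  have hm0 : (0 : ℝ) < ((m + 1 : ℕ) : ℝ) := by positivity
  -- The commutators have exponent `q = 1/p`; they are used at `e = 1/n`, where `n` of them make a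
  -- trace class product, and `p < n` is `e < q`.
  have he : (0 : ℝ) < 1 / ((m + 1 : ℕ) : ℝ) := by positivity
  have heq : 1 / ((m + 1 : ℕ) : ℝ) < 1 / p := one_div_lt_one_div_of_lt hp hpm
  have hm : ((m + 1 : ℕ) : ℝ) * (1 / ((m + 1 : ℕ) : ℝ)) = 1 := mul_one_div_cancel hm0.ne'
  have hq : ∀ t ∈ I, ∀ a, ∃ c, τ.HasSize (1 / p) c ⁅F t, ρ a⁆ := fun t ht a =>
    (hsum t ht a).exists_hasSize hp
  have hex : ∀ t, ∃ φ : BreuerFredholm.Cochain A (m + 1),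
      t ∈ I → BreuerFredholm.IsConnesCharacter τ ρ χ (F t) φ := fun t => by
    by_cases ht : t ∈ I
    · obtain ⟨φ, hφ⟩ := BreuerFredholm.FSNTrace.exists_isConnesCharacter (hS t ht) hρ he heq
        (hq t ht) hm
      exact ⟨φ, fun _ => hφ⟩
    · exact ⟨0, fun h => absurd h ht⟩
  choose ch hch using hex
  have hb : ∀ t ∈ I, BreuerFredholm.hochschildb (m + 1) (ch t) = 0 := fun t ht =>
    (hch t ht).hochschildb_eq_zero (hS t ht)
      (BreuerFredholm.FSNTrace.exists_hasSize_of_lt he heq (hq t ht)) hm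
  refine ⟨ch, hch, ⟨fun t ht => (hch t ht).vanishesOnScalars.single_mem_entireCocycles (hb t ht),
    fun s hs t ht => ?_⟩, fun t ht D hD hbd => ?_⟩
  -- Differing by `b θ` with `θ` vanishing on scalars is symmetric and transitive, and it holds for
  -- all points near a given one; on a connected set it therefore holds for all pairs.
  · obtain ⟨θ, h1, h2⟩ := hI.isPreconnected.induction₂ (fun x y =>
        ∃ θ : BreuerFredholm.Cochain A m, BreuerFredholm.VanishesOnScalars θ ∧
          BreuerFredholm.hochschildb m θ = ch y - ch x)
      (fun x hx => by
        have h1 : Tendsto (fun y => ‖F y - F x‖ * ‖F x‖) (𝓝[I] x) (𝓝 0) := by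
          simpa using (tendsto_iff_norm_sub_tendsto_zero.1 (hF x hx)).mul_const ‖F x‖
        filter_upwards [h1.eventually (gt_mem_nhds one_pos), eventually_mem_nhdsWithin] with y hy hyI
        exact BreuerFredholm.FSNTrace.exists_hochschildb_of_norm_sub_lt hρ he heq hm (hS x hx)
          (hS y hyI) (hq x hx) (hq y hyI) hy (hch x hx) (hch y hyI))
      (by
        rintro x y z - - - ⟨θ, h1, h2⟩ ⟨θ', h3, h4⟩
        exact ⟨θ + θ', h1.add h3, by rw [map_add, h2, h4]; abel⟩)
      (by
        rintro x y - - ⟨θ, h1, h2⟩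
        exact ⟨-θ, h1.neg, by rw [map_neg, h2, neg_sub]⟩) hs ht
    exact BreuerFredholm.HE.mk_single_eq h1 h2 _ _
  · have hT := BreuerFredholm.isTangent_of_hasDerivWithinAt (hI.uniqueDiffWithinAt hI' ht) ht hS hD
    have hsize : ∀ a, ∃ c, ∀ᶠ s in 𝓝[I] t, τ.HasSize (1 / p) c ⁅F s, ρ a⁆ := fun a => by
      obtain ⟨C, hC⟩ := hbd a
      exact ⟨_, (hC.and eventually_mem_nhdsWithin).mono fun s hs =>
        BreuerFredholm.FSNTrace.hasSize_of_pNorm_le hp (hsum s hs.2 a).1 hs.1⟩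
    obtain ⟨i, hi⟩ := BreuerFredholm.FSNTrace.exists_isContraction (hS t ht) hρ hT.mem he heq
      (hq t ht) hm
    exact ⟨i, hi, hi.vanishesOnScalars.single_mem_entireCochains,
      BreuerFredholm.hochschildb m i,
      BreuerFredholm.FSNTrace.hasDerivWithinAt_character ht hS hρ he heq hm hq hsize hT.mem hD hch
        (hi.hochschildb_apply (hS t ht) hT he heq (hq t ht) hm),
      hi.vanishesOnScalars.totalbB_single.symm⟩
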